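/- **Setting.** Let $f:\mathbb R^d\to\mathbb R$ be differentiable with $L$-Lipschitz gradient ($L>0$) and $f\ge f^*$ for some real $f^*$. Let $\boldsymbol\sigma_0,\boldsymbol\sigma_1\in[0,\infty)^d$, $0\le\beta_1<\beta_2<1$, $C_0,\epsilon_0>0$, $\eta=C_0\sqrt{1-\beta_2}$, $\epsilon=\epsilon_0\sqrt{1-\beta_2}$, $T\ge1$. Starting from a deterministic $x_1\in\mathbb R^d$ and $m_0=v_0=0$, the algorithm (Adam without bias correction on the second moment) performs for $s=1,\dots,T$ and $i=1,\dots,d$ $$m_{s,i}=\beta_1m_{s-1,i}+(1-\beta_1)g_{s,i},\quad v_{s,i}=\beta_2v_{s-1,i}+(1-\beta_2)g_{s,i}^2,\quad x_{s+1,i}=x_{s,i}-\frac{\eta}{1-\beta_1^s}\cdot\frac{m_{s,i}}{\sqrt{v_{s,i}}+\epsilon},$$ where $g_s$ is the random answer of a gradient oracle at $x_s$: with $\mathcal F_s$ the information available after $s$ answers, $g_s$ is $\mathcal F_s$-measurable and integrable, $\mathbb E[g_s\mid\mathcal F_{s-1}]=\nabla f(x_s)$ and, almost surely, $(g_{s,i}-\nabla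 f(x_s)_i)^2\le\sigma_{0,i}^2+\sigma_{1,i}^2\,\nabla f(x_s)_i^2$ for every $i$. For $\delta\in(0,1)$ put $\Sigma_{\max}=\max\{1,\sqrt{(1+\beta_2)/\beta_2}-1\}$, $$\mathcal F(T)=1+\frac2{\epsilon^2}\Big[\big(\|\boldsymbol\sigma_0\|_\infty^2+2(1+\|\boldsymbol\sigma_1\|_\infty^2)\|\nabla f(x_1)\|^2\big)T+\frac{2(1+\|\boldsymbol\sigma_1\|_\infty^2)dL^2C_0^2}{1-\beta_1/\beta_2}T^3\Big],$$ $\ell=\log(\mathcal F(T)/\beta_2^T)$, $\ell_\delta=\log(dT/\delta)$, and $$\begin{aligned}G={}&8L(f(x_1)-f^*)+\frac{256L^2C_0^2\beta_1^2d^2}{(1-\beta_1)^3(1-\beta_1/\beta_2)}+\frac{4L^2C_0^2\beta_1^2d}{(1-\beta_1)^2(1-\beta_1/\beta_2)}+\frac{48LC_0\|\boldsymbol\sigma_0\|_\infty}{1-\beta_1}d\,\ell_\delta\\&+\frac{8LC_0\beta_1^2}{(1-\beta_1)^2(1-\beta_1/\beta_2)}\Big[\frac{4\|\boldsymbol\sigma_0\|_\infty}{\beta_2}+\frac{\epsilon_0+\sqrt2\|\boldsymbol\sigma_0\|_\infty}{\sqrt{\beta_2}}+\frac{LC_0}2(1+4\Sigma_{\max}^2)\Big]d\,\ell\\&+8\Big(\frac{3L^2C_0^2}{(1-\beta_1)^2}+\frac{8L\|\boldsymbol\sigma_0\|_\infty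 C_0}{1-\beta_1}\Big)d\,\ell+\frac{2304L^2C_0^2\|\boldsymbol\sigma_1\|_\infty^2}{(1-\beta_1)^2}d^2\ell_\delta^2\\&+256\Big[\frac{16L^2C_0^2\|\boldsymbol\sigma_1\|_\infty^2}{(1-\beta_1)^2}+\frac{9L^2C_0^2\beta_1^4(1+\|\boldsymbol\sigma_1\|_\infty^2)}{\beta_2^2(1-\beta_1)^4(1-\beta_1/\beta_2)^2}\Big]d^2\ell^2.\end{aligned}$$ **Theorem.** (i) There is a universal constant $C>0$ such that in every such setting, for every $\delta\in(0,1)$, with probability at least $1-\delta$, $$\frac1T\sum_{s=1}^T\|\nabla f(x_s)\|^2\le C\left\{\frac{G}{TLC_0}\Big(\epsilon_0+\frac{G(1+\|\boldsymbol\sigma_1\|_\infty^2)}{LC_0}\Big)+\frac1{\sqrt T}\cdot\frac{G\|\boldsymbol\sigma_0\|}{LC_0}\right\}.$$ (ii) (Noise-adaptive rate.) For all $d,L,\beta_1,C_0,\epsilon_0$ and all $\Delta,S_0,S_1$ there is a constant $K>0$ such that for every $T\ge2$ and $\delta\in(0,1)$, in every such setting with $\beta_2=1-1/T>\beta_1$,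 $f(x_1)-f^*\le\Delta$, $\|\boldsymbol\sigma_0\|_\infty\le S_0$ and $\|\boldsymbol\sigma_1\|_\infty\le S_1$, with probability at least $1-\delta$, $$\frac1T\sum_{s=1}^T\|\nabla f(x_s)\|^2\le K\log^4(T/\delta)\left(\frac1T+\frac{\|\boldsymbol\sigma_0\|}{\sqrt T}\right).$$ Here $\|\cdot\|$ is the Euclidean norm and $\|\cdot\|_\infty$ the maximum norm. -/

import Mathlib

open MeasureTheory Finset

noncomputable section

namespace AdamVariant

/-- The space `ℝ^d` with its Euclidean norm. -/
abbrev Vec (d : ℕ) := EuclideanSpace ℝ (Fin d)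

/-- The `ℓ_∞`-norm of a vector (the norm of the underlying function `Fin d → ℝ`). -/
def supNorm {d : ℕ} (v : Vec d) : ℝ := ‖WithLp.ofLp v‖

/-- `f` is `L`-smooth: differentiable, with an `L`-Lipschitz gradient. -/
def IsSmooth {d : ℕ} (f : Vec d → ℝ) (L : ℝ) : Prop :=
  Differentiable ℝ f ∧ ∀ x y : Vec d, ‖gradient f x - gradient f y‖ ≤ L * ‖x - y‖

/-- First moment: `m_0 = 0`, `m_{s,i} = β₁ m_{s-1,i} + (1 - β₁) g_{s,i}`.
The stochastic gradients are `g 1, g 2, …`; the entry `g 0` is never used. -/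
def firstMoment {d : ℕ} (β₁ : ℝ) (g : ℕ → Vec d) : ℕ → Fin d → ℝ
  | 0, _ => 0
  | s + 1, i => β₁ * firstMoment β₁ g s i + (1 - β₁) * g (s + 1) i

/-- Second moment: `v_0 = 0`, `v_{s,i} = β₂ v_{s-1,i} + (1 - β₂) g_{s,i}²`. -/
def secondMoment {d : ℕ} (β₂ : ℝ) (g : ℕ → Vec d) : ℕ → Fin d → ℝ
  | 0, _ => 0
  | s + 1, i => β₂ * secondMoment β₂ g s i + (1 - β₂) * g (s + 1) i ^ 2

/-- The iterates of Adam without the corrective term on the second moment, started at `x_1`: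
`x_{s+1,i} = x_{s,i} - (η / (1 - β₁^s)) / (√v_{s,i} + ε) * m_{s,i}` for `s ≥ 1`
(with the convention `x_0 = x_1`). The point `x_s` is a function of `g 1, …, g (s-1)`. -/
def iterate {d : ℕ} (β₁ β₂ η ε : ℝ) (x₁ : Vec d) (g : ℕ → Vec d) : ℕ → Vec d
  | 0 => x₁
  | 1 => x₁
  | s + 2 => WithLp.toLp 2 fun i =>
      iterate β₁ β₂ η ε x₁ g (s + 1) i
        - (η / (1 - β₁ ^ (s + 1))) / (√(secondMoment β₂ g (s + 1) i) + ε)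
          * firstMoment β₁ g (s + 1) i

/-- The random responses `g_1, …, g_T` of the gradient oracle at the (random) query points
`x_1, …, x_T`, where `ℱ s` is the information available after the first `s` responses:
each response is an unbiased estimator of the gradient at the query point given the past,
and its error satisfies almost surely the coordinate-wise affine variance bound. -/
structure IsOracleRun {d : ℕ} {Ω : Type*} {mΩ : MeasurableSpace Ω} (μ : Measure Ω)
    (ℱ : Filtration ℕ mΩ) (T : ℕ) (f : Vec d → ℝ) (σ₀ σ₁ : Vec d)
    (x g : ℕ → Ω → Vec d) : Prop where
  measurable : ∀ s ∈ Icc 1 T, StronglyMeasurable[ℱ s] (g s)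
  integrable : ∀ s ∈ Icc 1 T, Integrable (g s) μ
  unbiased : ∀ s ∈ Icc 1 T, μ[g s | ℱ (s - 1)] =ᵐ[μ] fun ω => gradient f (x s ω)
  affine_noise : ∀ s ∈ Icc 1 T, ∀ i : Fin d, ∀ᵐ ω ∂μ,
    (g s ω i - gradient f (x s ω) i) ^ 2
      ≤ σ₀ i ^ 2 + σ₁ i ^ 2 * gradient f (x s ω) i ^ 2

/-- All the standing assumptions for a `T`-step run of the algorithm on the objective `f`, with
`η = C₀ √(1 - β₂)` and `ε = ε₀ √(1 - β₂)`. -/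
structure Setting {d : ℕ} {Ω : Type*} {mΩ : MeasurableSpace Ω} (μ : Measure Ω)
    (ℱ : Filtration ℕ mΩ) (T : ℕ) (f : Vec d → ℝ) (fstar L : ℝ) (σ₀ σ₁ : Vec d)
    (β₁ β₂ C₀ ε₀ : ℝ) (x₁ : Vec d) (g : ℕ → Ω → Vec d) : Prop where
  L_pos : 0 < L
  smooth : IsSmooth f L
  bounded_below : ∀ x, fstar ≤ f x
  σ₀_nonneg : ∀ i, 0 ≤ σ₀ i
  σ₁_nonneg : ∀ i, 0 ≤ σ₁ i
  β₁_nonneg : 0 ≤ β₁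
  β₁_lt_β₂ : β₁ < β₂
  β₂_lt_one : β₂ < 1
  C₀_pos : 0 < C₀
  ε₀_pos : 0 < ε₀
  oracle : IsOracleRun μ ℱ T f σ₀ σ₁
    (fun s ω => iterate β₁ β₂ (C₀ * √(1 - β₂)) (ε₀ * √(1 - β₂)) x₁ (fun j => g j ω) s) g

/-- `(1/T) ∑_{s=1}^T ‖∇f(x_s)‖²` along one realization `g` of the stochastic gradients, with
`η = C₀ √(1 - β₂)` and `ε = ε₀ √(1 - β₂)`. -/
def avgSqGrad {d : ℕ} (T : ℕ) (f : Vec d → ℝ) (β₁ β₂ C₀ ε₀ : ℝ) (x₁ : Vec d)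
    (g : ℕ → Vec d) : ℝ :=
  (1 / (T : ℝ)) * ∑ s ∈ Icc 1 T,
    ‖gradient f (iterate β₁ β₂ (C₀ * √(1 - β₂)) (ε₀ * √(1 - β₂)) x₁ g s)‖ ^ 2

/-- The polynomial `𝓕(T)`; here `n₁ = ‖∇f(x_1)‖`, `s₀ = ‖σ₀‖_∞`, `s₁ = ‖σ₁‖_∞`,
and `ε = ε₀ √(1 - β₂)`. -/
def calF (d T : ℕ) (L n₁ s₀ s₁ β₁ β₂ C₀ ε₀ : ℝ) : ℝ :=
  1 + 2 / (ε₀ * √(1 - β₂)) ^ 2 *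
    ((s₀ ^ 2 + 2 * (1 + s₁ ^ 2) * n₁ ^ 2) * T
      + 2 * (1 + s₁ ^ 2) * d * L ^ 2 * C₀ ^ 2 / (1 - β₁ / β₂) * T ^ 3)

/-- `Σ_max = max {1, √((1 + β₂)/β₂) - 1}`. -/
def sigmaMax (β₂ : ℝ) : ℝ := max 1 (√((1 + β₂) / β₂) - 1)

/-- The quantity `G`; here `Δ₁ = f(x_1) - f^*`, `n₁ = ‖∇f(x_1)‖`, `s₀ = ‖σ₀‖_∞`,
`s₁ = ‖σ₁‖_∞`. -/
def bigG (d T : ℕ) (L Δ₁ n₁ s₀ s₁ β₁ β₂ C₀ ε₀ δ : ℝ) : ℝ :=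
  let ℓ := Real.log (calF d T L n₁ s₀ s₁ β₁ β₂ C₀ ε₀ / β₂ ^ T)
  let ℓδ := Real.log (d * T / δ)
  8 * L * Δ₁
    + 256 * L ^ 2 * C₀ ^ 2 * β₁ ^ 2 * d ^ 2 / ((1 - β₁) ^ 3 * (1 - β₁ / β₂))
    + 4 * L ^ 2 * C₀ ^ 2 * β₁ ^ 2 * d / ((1 - β₁) ^ 2 * (1 - β₁ / β₂))
    + 48 * L * C₀ * s₀ / (1 - β₁) * d * ℓδ
    + 8 * L * C₀ * β₁ ^ 2 / ((1 - β₁) ^ 2 * (1 - β₁ / β₂))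
        * (4 * s₀ / β₂ + (ε₀ + √2 * s₀) / √β₂ + L * C₀ / 2 * (1 + 4 * sigmaMax β₂ ^ 2))
        * d * ℓ
    + 8 * (3 * L ^ 2 * C₀ ^ 2 / (1 - β₁) ^ 2 + 8 * L * s₀ * C₀ / (1 - β₁)) * d * ℓ
    + 2304 * L ^ 2 * C₀ ^ 2 * s₁ ^ 2 / (1 - β₁) ^ 2 * d ^ 2 * ℓδ ^ 2
    + 256 * (16 * L ^ 2 * C₀ ^ 2 * s₁ ^ 2 / (1 - β₁) ^ 2
        + 9 * L ^ 2 * C₀ ^ 2 * β₁ ^ 4 * (1 + s₁ ^ 2)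
          / (β₂ ^ 2 * (1 - β₁) ^ 4 * (1 - β₁ / β₂) ^ 2)) * d ^ 2 * ℓ ^ 2

end AdamVariant

end

noncomputable section

namespace AdamVariant

/-! ### Exponential moving averages -/

/-! Momentum is removed by passing to the extrapolated points `y = x_{s+1} + κ (x_{s+1} - x_s)`, `κ
= β₁ / (1 - β₁)`. Consecutive points `y` differ by the fresh preconditioned gradient plus `κ m_s`
times the change of the preconditioned step size (`extrapolate_succ_apply`), so `f(y)` obeys a
descent inequality whose first-order term uses the current stochastic gradient.

The denominator `√v_{s+1} + ε` depends on that gradient. It is replaced by `proxyDenom`, built from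
the past, the true gradient and the almost sure noise level. The replacement costs a quarter of the
descent and a multiple of `normSq`; the momentum correction costs another quarter, a multiple of
`discountedRatio`, and a telescoping term from the decreasing step size. Half of `weightedSq`
survives (`descent_step`). The accumulated errors are logarithmic because `normSq` is dominated by
the increments of a logarithmic potential (`sum_normSq_le_log`); a crude polynomial growth bound on
the gradients suffices inside that logarithm.

What remains is a martingale, `noiseTerm`, whose square is at most a constant times `weightedSq`
while the gradients stay below a level `Γ`. A Freedman-type inequality for increments truncated at
that level gives one event on which, at every time up to which no gradient has exceeded `Γ`, the
martingale is absorbed into another quarter of the descent plus a logarithm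
(`measureReal_noise_le`).

On this event the argument is deterministic. If the gradients up to time `t` are at most `Γ`, then
`f(y) - f^*` is bounded, hence so is the gradient at `y` by smoothness, hence the gradient at
`x_{t+1}`. The errors are affine in `Γ`, and `G` is large enough that `Γ = 2√G` reproduces itself
(`closure_le`). So the induction closes (`gradient_bounded`) and `L ∑ weightedSq ≤ 4G`. The weights
are at least of order `1 / (ε₀ + R)`, where `R` is controlled by the square root of the unknown sum
of squared gradients plus noise; solving this self-bounding inequality gives (i)
(`sum_sq_le_of_weighted`).

For (ii), `β₂ = 1 - 1/T` makes `calF` polynomial in `T` and keeps `β₂ ^ (-T)` bounded, so `G` is of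
order `log² (T/δ)`, and the term `G²` yields the fourth power. -/

/-- The denominator `√v_s + ε` of the update. -/
def denom {d : ℕ} (β₂ ε : ℝ) (g : ℕ → Vec d) (s : ℕ) (i : Fin d) : ℝ :=
  √(secondMoment β₂ g s i) + ε

/-- The step size `η / (1 - β₁ ^ s)`. -/
def stepSize (β₁ η : ℝ) (s : ℕ) : ℝ := η / (1 - β₁ ^ s)

/-- The discounted sum `∑_{j ≤ s} β₁^{s-j} g_{j,i}²`. -/
def discountedSq {d : ℕ} (β₁ : ℝ) (g : ℕ → Vec d) : ℕ → Fin d → ℝ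
  | 0, _ => 0
  | s + 1, i => β₁ * discountedSq β₁ g s i + g (s + 1) i ^ 2

/-- The normalized squared gradient `g_s² / (√v_s + ε)²`. -/
def normSq {d : ℕ} (β₂ ε : ℝ) (g : ℕ → Vec d) (s : ℕ) (i : Fin d) : ℝ :=
  g s i ^ 2 / denom β₂ ε g s i ^ 2

/-- The normalized discounted sum of squared gradients. -/
def discountedRatio {d : ℕ} (β₁ β₂ ε : ℝ) (g : ℕ → Vec d) (s : ℕ) (i : Fin d) : ℝ :=
  discountedSq β₁ g s i / denom β₂ ε g s i ^ 2

section Moments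

variable {d : ℕ} {β₁ β₂ ε : ℝ} (g : ℕ → Vec d) (s : ℕ) (i : Fin d)

lemma secondMoment_succ : secondMoment β₂ g (s + 1) i
    = β₂ * secondMoment β₂ g s i + (1 - β₂) * g (s + 1) i ^ 2 := rfl

lemma firstMoment_succ : firstMoment β₁ g (s + 1) i
    = β₁ * firstMoment β₁ g s i + (1 - β₁) * g (s + 1) i := rfl

lemma secondMoment_nonneg (h₀ : 0 ≤ β₂) (h₁ : β₂ ≤ 1) : 0 ≤ secondMoment β₂ g s i := by
  induction s with
  | zero => exact le_rfl
  | succ s ih =>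
    rw [secondMoment_succ]
    have := sub_nonneg.2 h₁
    positivity

lemma secondMoment_le_of_sq_le (h₀ : 0 ≤ β₂) (h₁ : β₂ ≤ 1) {M : ℝ} (hM : 0 ≤ M)
    (hg : ∀ j ∈ Icc 1 s, g j i ^ 2 ≤ M) : secondMoment β₂ g s i ≤ M := by
  induction s with
  | zero => exact hM
  | succ s ih =>
    rw [secondMoment_succ]
    have h1 := ih fun j hj => hg j (by simp only [mem_Icc] at hj ⊢; omega)
    have h2 := hg (s + 1) (by simp)
    nlinarith [sub_nonneg.2 h₁]

lemma secondMoment_le_sum (h₀ : 0 ≤ β₂) (h₁ : β₂ ≤ 1) :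
    secondMoment β₂ g s i ≤ (1 - β₂) * ∑ j ∈ Icc 1 s, g j i ^ 2 := by
  induction s with
  | zero => simp [secondMoment]
  | succ s ih =>
    rw [secondMoment_succ, sum_Icc_succ_top (by omega)]
    have := secondMoment_nonneg g s i h₀ h₁
    nlinarith

lemma denom_pos (hε : 0 < ε) : 0 < denom β₂ ε g s i := by
  unfold denom; positivity

lemma sqrt_mul_denom_le (h₀ : 0 ≤ β₂) (h₁ : β₂ ≤ 1) (hε : 0 < ε) :
    √β₂ * denom β₂ ε g s i ≤ denom β₂ ε g (s + 1) i := by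
  unfold denom
  have h2 : √β₂ ≤ 1 := Real.sqrt_le_one.2 h₁
  have h3 : √β₂ * √(secondMoment β₂ g s i) ≤ √(secondMoment β₂ g (s + 1) i) := by
    rw [← Real.sqrt_mul h₀, secondMoment_succ]
    apply Real.sqrt_le_sqrt
    have := mul_nonneg (sub_nonneg.2 h₁) (sq_nonneg (g (s + 1) i))
    linarith
  nlinarith

lemma mul_denom_sq_le (h₀ : 0 ≤ β₂) (h₁ : β₂ ≤ 1) (hε : 0 < ε) :
    β₂ * denom β₂ ε g s i ^ 2 ≤ denom β₂ ε g (s + 1) i ^ 2 := by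
  have h := sqrt_mul_denom_le g s i h₀ h₁ hε
  have h2 := (denom_pos (β₂ := β₂) g s i hε).le
  calc β₂ * denom β₂ ε g s i ^ 2 = (√β₂ * denom β₂ ε g s i) ^ 2 := by
        rw [mul_pow, Real.sq_sqrt h₀]
    _ ≤ _ := pow_le_pow_left₀ (by positivity) h 2

lemma discountedSq_nonneg (h : 0 ≤ β₁) : 0 ≤ discountedSq β₁ g s i := by
  induction s with
  | zero => exact le_rfl
  | succ s ih => unfold discountedSq; positivity

lemma discountedRatio_nonneg (h : 0 ≤ β₁) : 0 ≤ discountedRatio β₁ β₂ ε g s i :=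
  div_nonneg (discountedSq_nonneg g s i h) (sq_nonneg _)

lemma normSq_nonneg : 0 ≤ normSq β₂ ε g s i := by unfold normSq; positivity

lemma one_sub_pow_nonneg (h₀ : 0 ≤ β₁) (h₁ : β₁ < 1) : 0 ≤ 1 - β₁ ^ s :=
  sub_nonneg.2 (pow_le_one₀ h₀ h₁.le)

lemma one_sub_le_one_sub_pow (h₀ : 0 ≤ β₁) (h₁ : β₁ < 1) : 1 - β₁ ≤ 1 - β₁ ^ (s + 1) := by
  have := pow_le_one₀ (n := s) h₀ h₁.le
  rw [pow_succ]; nlinarith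

/-- Cauchy–Schwarz for the weights `(1 - β₁) β₁^{s-j}`, whose total mass is `1 - β₁^s`. This factor
is kept because it later cancels the bias correction in the step size. In the induction, the cross
term is handled by AM–GM applied to the previous bound. -/
lemma firstMoment_sq_le (h₀ : 0 ≤ β₁) (h₁ : β₁ < 1) :
    firstMoment β₁ g s i ^ 2 ≤ (1 - β₁ ^ s) * (1 - β₁) * discountedSq β₁ g s i := by
  induction s with
  | zero => simp [firstMoment]
  | succ s ih =>
    rw [firstMoment_succ]
    have hq := discountedSq_nonneg g s i h₀
    have hw := one_sub_pow_nonneg s h₀ h₁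
    have hβ : 0 < 1 - β₁ := sub_pos.2 h₁
    simp only [discountedSq, pow_succ]
    have e : 1 - β₁ ^ s * β₁ = β₁ * (1 - β₁ ^ s) + (1 - β₁) := by ring
    rw [e]
    generalize firstMoment β₁ g s i = m at *
    generalize discountedSq β₁ g s i = q at *
    generalize g (s + 1) i = c at *
    generalize 1 - β₁ ^ s = w at *
    have key : 2 * m * c ≤ (1 - β₁) * q + w * c ^ 2 := by
      have h2 : (m * c) ^ 2 ≤ ((1 - β₁) * q) * (w * c ^ 2) := by
        rw [mul_pow]; nlinarith [sq_nonneg c]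
      have hA : 0 ≤ (1 - β₁) * q := by positivity
      have hB : 0 ≤ w * c ^ 2 := by positivity
      have : (2 * (m * c)) ^ 2 ≤ ((1 - β₁) * q + w * c ^ 2) ^ 2 := by
        nlinarith [sq_nonneg ((1 - β₁) * q - w * c ^ 2)]
      have := abs_le_of_sq_le_sq' this (by positivity)
      linarith [this.2]
    have k2 := mul_le_mul_of_nonneg_left key (mul_nonneg h₀ hβ.le)
    have k3 := mul_le_mul_of_nonneg_left ih (sq_nonneg β₁)
    nlinarith

lemma firstMoment_sq_le_ratio (h₀ : 0 ≤ β₁) (h₁ : β₁ < 1) (hε : 0 < ε) :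
    firstMoment β₁ g s i ^ 2 ≤ (1 - β₁ ^ s) * (1 - β₁) *
      (denom β₂ ε g s i ^ 2 * discountedRatio β₁ β₂ ε g s i) := by
  have h := denom_pos (β₂ := β₂) g s i hε
  unfold discountedRatio
  rw [mul_div_cancel₀ _ (by positivity)]
  exact firstMoment_sq_le g s i h₀ h₁

/-- The squared denominator shrinks by at most the factor `β₂` per step, so the discount `β₁`
becomes a contraction by `β₁ / β₂ < 1` under the parameter assumptions. -/
lemma discountedRatio_succ_le (h₀ : 0 ≤ β₁) (hb : 0 < β₂) (hb1 : β₂ ≤ 1) (hε : 0 < ε) :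
    discountedRatio β₁ β₂ ε g (s + 1) i
      ≤ β₁ / β₂ * discountedRatio β₁ β₂ ε g s i + normSq β₂ ε g (s + 1) i := by
  have h1 := mul_denom_sq_le g s i hb.le hb1 hε
  have h2 := denom_pos (β₂ := β₂) g s i hε
  have h3 := denom_pos (β₂ := β₂) g (s + 1) i hε
  have hq := discountedSq_nonneg g s i h₀
  simp only [discountedRatio, normSq, discountedSq, add_div]
  gcongr
  rw [div_mul_div_comm]
  exact div_le_div_of_nonneg_left (by positivity) (by positivity) h1

lemma normSq_le (h₀ : 0 ≤ β₂) (h₁ : β₂ < 1) (hε : 0 < ε) :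
    (1 - β₂) * normSq β₂ ε g (s + 1) i ≤ 1 := by
  have h3 := denom_pos (β₂ := β₂) g (s + 1) i hε
  unfold normSq
  rw [← mul_div_assoc, div_le_one (by positivity)]
  have hv := secondMoment_nonneg g s i h₀ h₁.le
  have hv' := secondMoment_nonneg g (s + 1) i h₀ h₁.le
  have : secondMoment β₂ g (s + 1) i ≤ denom β₂ ε g (s + 1) i ^ 2 := by
    unfold denom
    nlinarith [Real.sq_sqrt hv', Real.sqrt_nonneg (secondMoment β₂ g (s + 1) i)]
  rw [secondMoment_succ] at this
  nlinarith

lemma discountedRatio_le (h₀ : 0 ≤ β₁) (h₁ : β₁ < β₂) (hb : β₂ < 1) (hε : 0 < ε) :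
    (1 - β₁ / β₂) * ((1 - β₂) * discountedRatio β₁ β₂ ε g s i) ≤ 1 := by
  have hb0 : 0 < β₂ := h₀.trans_lt h₁
  have hρ : 0 < 1 - β₁ / β₂ := sub_pos.2 ((div_lt_one hb0).2 h₁)
  have hρ0 : 0 ≤ β₁ / β₂ := by positivity
  induction s with
  | zero => simp [discountedRatio, discountedSq]
  | succ s ih =>
    have h2 := discountedRatio_succ_le g s i h₀ hb0 hb.le hε
    have h3 := normSq_le g s i hb0.le hb hε
    have h4 := mul_le_mul_of_nonneg_left h2 (mul_pos hρ (sub_pos.2 hb)).le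
    have h5 := mul_le_mul_of_nonneg_left ih hρ0
    have h6 := mul_le_mul_of_nonneg_left h3 hρ.le
    linear_combination h4 + h5 + h6

lemma sum_discountedRatio_le (h₀ : 0 ≤ β₁) (h₁ : β₁ < β₂) (hb : β₂ < 1) (hε : 0 < ε) :
    (1 - β₁ / β₂) * ∑ j ∈ range s, discountedRatio β₁ β₂ ε g j i
      ≤ ∑ j ∈ range s, normSq β₂ ε g (j + 1) i := by
  have hb0 : 0 < β₂ := h₀.trans_lt h₁
  have aux : (1 - β₁ / β₂) * ∑ j ∈ range s, discountedRatio β₁ β₂ ε g j i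
      + discountedRatio β₁ β₂ ε g s i ≤ ∑ j ∈ range s, normSq β₂ ε g (j + 1) i := by
    induction s with
    | zero => simp [discountedRatio, discountedSq]
    | succ s ih =>
      have h2 := discountedRatio_succ_le g s i h₀ hb0 hb.le hε
      rw [sum_range_succ, sum_range_succ]
      linarith
  have := discountedRatio_nonneg (β₂ := β₂) (ε := ε) g s i h₀
  linarith

/-- The potential `log ((1 + v_s / ε²) / β₂^s)` increases at each step by `-log x` with `x = β₂ (ε²
+ v_s) / (ε² + v_{s+1})`. Since `-log x ≥ 1 - x` and `(1 - β₂) g² = v_{s+1} - β₂ v_s`, each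
increment pays for one summand. -/
lemma sum_normSq_le_log (hb0 : 0 < β₂) (hb : β₂ < 1) (hε : 0 < ε) :
    (1 - β₂) * ∑ j ∈ range s, normSq β₂ ε g (j + 1) i
      ≤ Real.log ((1 + secondMoment β₂ g s i / ε ^ 2) / β₂ ^ s) := by
  have hv : ∀ s, 0 ≤ secondMoment β₂ g s i := fun s => secondMoment_nonneg g s i hb0.le hb.le
  induction s with
  | zero => simp [secondMoment]
  | succ s ih =>
    rw [sum_range_succ, mul_add]
    have hV : 0 < 1 + secondMoment β₂ g s i / ε ^ 2 := by have := hv s; positivity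
    have hV' : 0 < 1 + secondMoment β₂ g (s + 1) i / ε ^ 2 := by have := hv (s + 1); positivity
    suffices h : (1 - β₂) * normSq β₂ ε g (s + 1) i
        ≤ Real.log ((1 + secondMoment β₂ g (s + 1) i / ε ^ 2) / β₂ ^ (s + 1))
          - Real.log ((1 + secondMoment β₂ g s i / ε ^ 2) / β₂ ^ s) by linarith
    rw [← Real.log_div (by positivity) (by positivity)]
    have e : (1 + secondMoment β₂ g (s + 1) i / ε ^ 2) / β₂ ^ (s + 1)
          / ((1 + secondMoment β₂ g s i / ε ^ 2) / β₂ ^ s)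
        = (β₂ * (ε ^ 2 + secondMoment β₂ g s i) / (ε ^ 2 + secondMoment β₂ g (s + 1) i))⁻¹ := by
      have h1 : ε ^ 2 + secondMoment β₂ g s i ≠ 0 := by have := hv s; positivity
      have h2 : ε ^ 2 + secondMoment β₂ g (s + 1) i ≠ 0 := by have := hv (s + 1); positivity
      have e1 : 1 + secondMoment β₂ g s i / ε ^ 2 = (ε ^ 2 + secondMoment β₂ g s i) / ε ^ 2 := by
        field_simp
      have e2 : 1 + secondMoment β₂ g (s + 1) i / ε ^ 2
          = (ε ^ 2 + secondMoment β₂ g (s + 1) i) / ε ^ 2 := by field_simp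
      rw [e1, e2]
      field_simp
      ring
    rw [e, Real.log_inv]
    have hp : 0 < ε ^ 2 + secondMoment β₂ g s i := by have := hv s; positivity
    have hp' : 0 < ε ^ 2 + secondMoment β₂ g (s + 1) i := by have := hv (s + 1); positivity
    have h3 := Real.log_le_sub_one_of_pos
      (show 0 < β₂ * (ε ^ 2 + secondMoment β₂ g s i)
        / (ε ^ 2 + secondMoment β₂ g (s + 1) i) by positivity)
    have h4 : (1 - β₂) * normSq β₂ ε g (s + 1) i
        ≤ 1 - β₂ * (ε ^ 2 + secondMoment β₂ g s i)
          / (ε ^ 2 + secondMoment β₂ g (s + 1) i) := by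
      have h5 : ε ^ 2 + secondMoment β₂ g (s + 1) i ≤ denom β₂ ε g (s + 1) i ^ 2 := by
        unfold denom
        nlinarith [Real.sq_sqrt (hv (s + 1)), Real.sqrt_nonneg (secondMoment β₂ g (s + 1) i)]
      have h6 : normSq β₂ ε g (s + 1) i
          ≤ g (s + 1) i ^ 2 / (ε ^ 2 + secondMoment β₂ g (s + 1) i) :=
        div_le_div_of_nonneg_left (sq_nonneg _) hp' h5
      refine (mul_le_mul_of_nonneg_left h6 (sub_pos.2 hb).le).trans ?_
      rw [← mul_div_assoc, one_sub_div hp'.ne']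
      gcongr
      rw [secondMoment_succ]
      nlinarith
    linarith

end Moments

/-! ### Bias-corrected step sizes. -/

section Steps

variable {β₁ η : ℝ} (s : ℕ)

lemma stepSize_le (h₀ : 0 ≤ β₁) (h₁ : β₁ < 1) (hη : 0 ≤ η) :
    stepSize β₁ η (s + 1) ≤ η / (1 - β₁) :=
  div_le_div_of_nonneg_left hη (sub_pos.2 h₁) (one_sub_le_one_sub_pow s h₀ h₁)

lemma le_stepSize (h₀ : 0 ≤ β₁) (h₁ : β₁ < 1) (hη : 0 ≤ η) : η ≤ stepSize β₁ η (s + 1) := by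
  have h := one_sub_le_one_sub_pow s h₀ h₁
  have : 0 < 1 - β₁ := sub_pos.2 h₁
  have h2 : 0 ≤ β₁ ^ (s + 1) := by positivity
  unfold stepSize
  rw [le_div_iff₀ (by linarith)]
  nlinarith

lemma stepSize_nonneg (h₀ : 0 ≤ β₁) (h₁ : β₁ < 1) (hη : 0 ≤ η) : 0 ≤ stepSize β₁ η s :=
  div_nonneg hη (one_sub_pow_nonneg s h₀ h₁)

lemma stepSize_mul (h₀ : 0 ≤ β₁) (h₁ : β₁ < 1) :
    stepSize β₁ η (s + 1) * (1 - β₁ ^ (s + 1)) = η :=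
  div_mul_cancel₀ _ ((sub_pos.2 h₁).trans_le (one_sub_le_one_sub_pow s h₀ h₁)).ne'

lemma stepSize_succ_le (h₀ : 0 ≤ β₁) (h₁ : β₁ < 1) (hη : 0 ≤ η) :
    stepSize β₁ η (s + 2) ≤ stepSize β₁ η (s + 1) := by
  have h := one_sub_le_one_sub_pow s h₀ h₁
  refine div_le_div_of_nonneg_left hη (by linarith) ?_
  have := pow_le_pow_of_le_one h₀ h₁.le (show s + 1 ≤ s + 2 by omega)
  linarith

/-- In the momentum correction the step size of time `s + 1` meets `m_s`, whose square carries `1 -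
β₁^s`; the mismatch of exponents is harmless. -/
lemma stepSize_succ_mul_le (h₀ : 0 ≤ β₁) (h₁ : β₁ < 1) (hη : 0 ≤ η) :
    stepSize β₁ η (s + 1) * (1 - β₁ ^ s) ≤ η := by
  calc stepSize β₁ η (s + 1) * (1 - β₁ ^ s)
      ≤ stepSize β₁ η (s + 1) * (1 - β₁ ^ (s + 1)) := by
        refine mul_le_mul_of_nonneg_left ?_ (stepSize_nonneg _ h₀ h₁ hη)
        have := pow_le_pow_of_le_one h₀ h₁.le (show s ≤ s + 1 by omega)
        linarith
    _ = η := stepSize_mul s h₀ h₁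

end Steps

/-! ### Displacement of the iterates. -/

section Iterates

variable {d : ℕ} {β₁ β₂ η ε : ℝ} (x₁ : Vec d) (g : ℕ → Vec d) (s : ℕ) (i : Fin d)

lemma iterate_succ_apply : iterate β₁ β₂ η ε x₁ g (s + 1) i = iterate β₁ β₂ η ε x₁ g s i
    - stepSize β₁ η s / denom β₂ ε g s i * firstMoment β₁ g s i := by
  cases s with
  | zero => simp [iterate, firstMoment]
  | succ s => rfl

/-- Of the two step-size factors, one cancels `1 - β₁^s` exactly and the other is paid for by `1 -
β₁`, so no power of `1 / (1 - β₁)` is lost. -/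
lemma iterate_sub_sq_le (h₀ : 0 ≤ β₁) (h₁ : β₁ < 1) (hη : 0 ≤ η) (hε : 0 < ε) :
    (iterate β₁ β₂ η ε x₁ g (s + 1) i - iterate β₁ β₂ η ε x₁ g s i) ^ 2
      ≤ η ^ 2 * discountedRatio β₁ β₂ ε g s i := by
  rw [iterate_succ_apply]
  cases s with
  | zero => simp [firstMoment, discountedRatio, discountedSq]
  | succ s =>
    have h := firstMoment_sq_le_ratio (β₂ := β₂) g (s + 1) i h₀ h₁ hε
    have hd := denom_pos (β₂ := β₂) g (s + 1) i hε
    have hu := discountedRatio_nonneg (β₂ := β₂) (ε := ε) g (s + 1) i h₀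
    have hs := stepSize_le s h₀ h₁ hη
    have hm := stepSize_mul (η := η) s h₀ h₁
    have hs0 := stepSize_nonneg (s + 1) h₀ h₁ hη
    generalize stepSize β₁ η (s + 1) = a at *
    have hβ := sub_pos.2 h₁
    have hk : a * (1 - β₁) ≤ η := by rwa [le_div_iff₀ hβ] at hs
    calc _ = (a / denom β₂ ε g (s + 1) i) ^ 2 * firstMoment β₁ g (s + 1) i ^ 2 := by ring
      _ ≤ (a / denom β₂ ε g (s + 1) i) ^ 2 * _ := mul_le_mul_of_nonneg_left h (sq_nonneg _)
      _ = (a * (1 - β₁ ^ (s + 1))) * (a * (1 - β₁)) * discountedRatio β₁ β₂ ε g (s + 1) i := by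
        field_simp
      _ ≤ η * η * discountedRatio β₁ β₂ ε g (s + 1) i := by rw [hm]; gcongr
      _ = _ := by ring

end Iterates

/-! ### Smooth functions -/

section Smooth

variable {d : ℕ} {f : Vec d → ℝ} {L : ℝ}

lemma IsSmooth.le_quadratic (hf : IsSmooth f L) (x v : Vec d) :
    f (x + v) ≤ f x + inner ℝ (gradient f x) v + L / 2 * ‖v‖ ^ 2 := by
  set φ : ℝ → ℝ := fun t => f (x + t • v) - t * inner ℝ (gradient f x) v
    - L / 2 * t ^ 2 * ‖v‖ ^ 2
  have hd : ∀ t : ℝ, HasDerivAt φ (inner ℝ (gradient f (x + t • v)) v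
      - 1 * inner ℝ (gradient f x) v - L / 2 * (2 * t) * ‖v‖ ^ 2) t := by
    intro t
    have h1 : HasDerivAt (fun t : ℝ => x + t • v) v t := by
      simpa using ((hasDerivAt_id t).smul_const v).const_add x
    have h2 := (hf.1 (x + t • v)).hasGradientAt.hasFDerivAt.comp_hasDerivAt t h1
    have h3 : HasDerivAt (fun t : ℝ => f (x + t • v)) (inner ℝ (gradient f (x + t • v)) v) t :=
      h2.congr_deriv (InnerProductSpace.toDual_apply_apply ..)
    have h4 : HasDerivAt (fun t : ℝ => L / 2 * t ^ 2 * ‖v‖ ^ 2)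
        (L / 2 * (2 * t) * ‖v‖ ^ 2) t := by
      simpa using (((hasDerivAt_pow 2 t).const_mul (L / 2)).mul_const (‖v‖ ^ 2))
    exact (h3.sub ((hasDerivAt_id t).mul_const _)).sub h4
  have hanti : AntitoneOn φ (Set.Icc 0 1) := by
    refine antitoneOn_of_deriv_nonpos (convex_Icc 0 1)
      (fun t _ => (hd t).continuousAt.continuousWithinAt)
      (fun t _ => (hd t).differentiableAt.differentiableWithinAt) fun t ht => ?_
    rw [interior_Icc] at ht
    rw [(hd t).deriv]
    have h1 : inner ℝ (gradient f (x + t • v) - gradient f x) v ≤ L * (t * ‖v‖) * ‖v‖ := by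
      refine (real_inner_le_norm _ _).trans
        (mul_le_mul_of_nonneg_right ((hf.2 _ _).trans_eq ?_) (norm_nonneg _))
      rw [add_sub_cancel_left, norm_smul, Real.norm_of_nonneg ht.1.le]
    rw [inner_sub_left] at h1
    linarith
  have h := hanti (Set.left_mem_Icc.2 zero_le_one) (Set.right_mem_Icc.2 zero_le_one) zero_le_one
  simp only [φ, one_smul, zero_smul, add_zero] at h
  linarith

/-- The quadratic upper bound at the gradient step `x - ∇f(x) / L` cannot fall below `fstar`. -/
lemma IsSmooth.norm_gradient_sq_le (hf : IsSmooth f L) (hL : 0 < L) {fstar : ℝ}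
    (hb : ∀ x, fstar ≤ f x) (x : Vec d) : ‖gradient f x‖ ^ 2 ≤ 2 * L * (f x - fstar) := by
  have h := hf.le_quadratic x (-(1 / L) • gradient f x)
  have h2 := hb (x + -(1 / L) • gradient f x)
  rw [inner_smul_right, real_inner_self_eq_norm_sq, norm_smul, mul_pow, Real.norm_eq_abs,
    sq_abs] at h
  have e : L / 2 * ((-(1 / L)) ^ 2 * ‖gradient f x‖ ^ 2) = 1 / (2 * L) * ‖gradient f x‖ ^ 2 := by
    field_simp
  have e2 : -(1 / L) * ‖gradient f x‖ ^ 2 = -(2 * (1 / (2 * L) * ‖gradient f x‖ ^ 2)) := by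
    field_simp
  have h3 : 1 / (2 * L) * ‖gradient f x‖ ^ 2 ≤ f x - fstar := by linarith
  rw [div_mul_eq_mul_div, one_mul, div_le_iff₀ (by positivity)] at h3
  linarith

lemma IsSmooth.continuous_gradient (hf : IsSmooth f L) : Continuous (gradient f) := by
  refine (LipschitzWith.of_dist_le_mul (K := L.toNNReal) fun x y => ?_).continuous
  rw [dist_eq_norm, dist_eq_norm]
  exact (hf.2 x y).trans (mul_le_mul_of_nonneg_right (Real.le_coe_toNNReal L) (norm_nonneg _))

/-- Descent along an extrapolated point: the gradient is evaluated at `x`, the step `P + R` is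
taken at `x + κ D`. -/
lemma IsSmooth.descent (hf : IsSmooth f L) (hL : 0 ≤ L) {κ : ℝ} (hκ : 0 ≤ κ) (x D P R : Vec d) :
    f (x + κ • D + (P + R)) ≤ f (x + κ • D) + inner ℝ (gradient f x) P
      + inner ℝ (gradient f x) R + L / 2 * κ ^ 2 * ‖D‖ ^ 2 + 2 * L * ‖P‖ ^ 2 + 2 * L * ‖R‖ ^ 2 := by
  have h := hf.le_quadratic (x + κ • D) (P + R)
  have h1 : inner ℝ (gradient f (x + κ • D) - gradient f x) (P + R) ≤ L * (κ * ‖D‖) * ‖P + R‖ := by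
    refine (real_inner_le_norm _ _).trans
      (mul_le_mul_of_nonneg_right ((hf.2 _ _).trans_eq ?_) (norm_nonneg _))
    rw [add_sub_cancel_left, norm_smul, Real.norm_of_nonneg hκ]
  rw [inner_sub_left, inner_add_right (gradient f x)] at h1
  have h2 : ‖P + R‖ ^ 2 ≤ 2 * ‖P‖ ^ 2 + 2 * ‖R‖ ^ 2 := by
    have := pow_le_pow_left₀ (norm_nonneg _) (norm_add_le P R) 2
    nlinarith [sq_nonneg (‖P‖ - ‖R‖)]
  have h3 : κ * ‖D‖ * ‖P + R‖ ≤ (κ * ‖D‖) ^ 2 / 2 + ‖P + R‖ ^ 2 / 2 := by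
    nlinarith [sq_nonneg (κ * ‖D‖ - ‖P + R‖)]
  have h4 := mul_le_mul_of_nonneg_left h3 hL
  have h5 := mul_le_mul_of_nonneg_left h2 hL
  nlinarith

end Smooth

/-! ### Scalar inequalities for the preconditioners -/

section Scalar

variable {β V c g S ε : ℝ}

lemma sq_le_of_sq_sub_le (h : (g - c) ^ 2 ≤ S ^ 2) : g ^ 2 ≤ 2 * (c ^ 2 + S ^ 2) := by
  nlinarith [sq_nonneg (g - 2 * c)]

lemma sqrt_add_le_add_sqrt {x y : ℝ} (hx : 0 ≤ x) (hy : 0 ≤ y) : √(x + y) ≤ √x + √y := by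
  rw [Real.sqrt_le_left (by positivity)]
  nlinarith [Real.sq_sqrt hx, Real.sq_sqrt hy, mul_nonneg (Real.sqrt_nonneg x) (Real.sqrt_nonneg y)]

/-- The squares of the two roots differ by at most `(1 - β) (S² + 2 S |c|)`. The second root
dominates both `√(1 - β) S` and `√(1 - β) |c|`, so dividing by it leaves `3 √(1 - β) S`. This is why
`S²` is put into the proxy. -/
lemma abs_sqrt_sub_sqrt_le (hβ : 0 ≤ β) (hβ1 : β ≤ 1) (hV : 0 ≤ V) (hS : 0 ≤ S)
    (h : (g - c) ^ 2 ≤ S ^ 2) :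
    |√(β * V + (1 - β) * g ^ 2) - √(β * V + (1 - β) * (c ^ 2 + S ^ 2))| ≤ 3 * (√(1 - β) * S) := by
  have hb := sub_nonneg.2 hβ1
  set k := √(1 - β)
  have hk : k ^ 2 = 1 - β := Real.sq_sqrt hb
  have hk0 : 0 ≤ k := Real.sqrt_nonneg _
  rw [← hk]
  have hv1 : 0 ≤ β * V + k ^ 2 * g ^ 2 := by positivity
  have hv2 : 0 ≤ β * V + k ^ 2 * (c ^ 2 + S ^ 2) := by positivity
  have hp := Real.sq_sqrt hv1
  have hr := Real.sq_sqrt hv2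
  have hp0 := Real.sqrt_nonneg (β * V + k ^ 2 * g ^ 2)
  have hr0 := Real.sqrt_nonneg (β * V + k ^ 2 * (c ^ 2 + S ^ 2))
  have hrS : k * S ≤ √(β * V + k ^ 2 * (c ^ 2 + S ^ 2)) :=
    Real.le_sqrt_of_sq_le (by nlinarith [mul_nonneg hβ hV, mul_nonneg (sq_nonneg k) (sq_nonneg c)])
  have hrc : k * |c| ≤ √(β * V + k ^ 2 * (c ^ 2 + S ^ 2)) :=
    Real.le_sqrt_of_sq_le (by
      rw [mul_pow, sq_abs]
      nlinarith [mul_nonneg hβ hV, mul_nonneg (sq_nonneg k) (sq_nonneg S)])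
  have hg : |g - c| ≤ S := abs_le_of_sq_le_sq h hS
  have hgc : |g ^ 2 - c ^ 2 - S ^ 2| ≤ S ^ 2 + 2 * S * |c| := by
    have e : g ^ 2 - c ^ 2 - S ^ 2 = ((g - c) ^ 2 - S ^ 2) + 2 * ((g - c) * c) := by ring
    have h1 : |(g - c) ^ 2 - S ^ 2| ≤ S ^ 2 := by
      rw [abs_le]; constructor <;> nlinarith [sq_nonneg (g - c)]
    have h2 : |(g - c) * c| ≤ S * |c| := by rw [abs_mul]; gcongr
    rw [e]
    refine (abs_add_le _ _).trans ?_
    rw [abs_mul 2, abs_two]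
    linarith
  generalize √(β * V + k ^ 2 * g ^ 2) = p at *
  generalize √(β * V + k ^ 2 * (c ^ 2 + S ^ 2)) = r at *
  rcases hr0.eq_or_lt with h0 | hr0'
  · have hkS : k * S = 0 := le_antisymm (h0 ▸ hrS) (by positivity)
    have hkc : k * |c| = 0 := le_antisymm (h0 ▸ hrc) (by positivity)
    have hp2 : p ^ 2 - r ^ 2 ≤ 0 := by
      rw [hp, hr]
      have := (abs_le.1 hgc).2
      have := mul_le_mul_of_nonneg_left this (sq_nonneg k)
      nlinarith
    have : p = 0 := by
      rw [← h0] at hp2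
      nlinarith
    rw [this, ← h0, hkS]; simp
  · refine le_of_mul_le_mul_right ?_ hr0'
    have e : |p - r| * (p + r) = k ^ 2 * |g ^ 2 - c ^ 2 - S ^ 2| := by
      have e1 : (p - r) * (p + r) = k ^ 2 * (g ^ 2 - c ^ 2 - S ^ 2) := by
        linear_combination hp - hr
      have e2 := congrArg abs e1
      rwa [abs_mul, abs_mul, abs_of_nonneg (add_nonneg hp0 hr0), abs_of_nonneg (sq_nonneg k)] at e2
    calc |p - r| * r ≤ |p - r| * (p + r) := by gcongr; linarith
      _ = k ^ 2 * |g ^ 2 - c ^ 2 - S ^ 2| := e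
      _ ≤ k ^ 2 * (S ^ 2 + 2 * S * |c|) := by gcongr
      _ = k * S * (k * S + 2 * (k * |c|)) := by ring
      _ ≤ k * S * (r + 2 * r) := by gcongr
      _ = _ := by ring

/-- Replacing the denominator `b` by the predictable denominator `a` in the main descent term. -/
lemma neg_mul_div_denom_le (hβ : 0 ≤ β) (hβ1 : β ≤ 1) (hV : 0 ≤ V) (hS : 0 ≤ S) (hε : 0 < ε)
    (h : (g - c) ^ 2 ≤ S ^ 2) {a b : ℝ} (hb : b = √(β * V + (1 - β) * g ^ 2) + ε)
    (ha : a = √(β * V + (1 - β) * (c ^ 2 + S ^ 2)) + ε) :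
    -(c * g / b) ≤ -(3 / 4) * (c ^ 2 / a) - c * (g - c) / a
      + 9 * (√(1 - β) * S) * (g ^ 2 / b ^ 2) := by
  have hd := abs_sqrt_sub_sqrt_le hβ hβ1 hV hS h
  have hb0 : 0 < b := by rw [hb]; positivity
  have ha0 : 0 < a := by rw [ha]; positivity
  have hk := sub_nonneg.2 hβ1
  have hSa : √(1 - β) * S ≤ a := by
    rw [ha, ← Real.sqrt_sq hS, ← Real.sqrt_mul hk]
    have : √((1 - β) * S ^ 2) ≤ √(β * V + (1 - β) * (c ^ 2 + √(S ^ 2) ^ 2)) := by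
      apply Real.sqrt_le_sqrt
      rw [Real.sqrt_sq hS]
      nlinarith [mul_nonneg hβ hV, mul_nonneg hk (sq_nonneg c)]
    linarith
  have hdab : |b - a| ≤ 3 * (√(1 - β) * S) := by
    rw [hb, ha]; convert hd using 2; ring
  have hkS : 0 ≤ √(1 - β) * S := by positivity
  generalize √(1 - β) * S = q at *
  clear hb ha hd
  -- One factor `q` of `(3q)²` is traded for `a`; it cancels the `1 / a` left by Young's inequality
  -- below.
  have hsq : (b - a) ^ 2 ≤ 9 * q * a := by
    have := sq_le_sq' (by linarith [(abs_le.1 hdab).1]) (abs_le.1 hdab).2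
    nlinarith
  have e : -(c * g / b) = -(c ^ 2 / a) - c * (g - c) / a + c * (g * (b - a) / b) / a := by
    field_simp; ring
  have h1 : c * (g * (b - a) / b) / a ≤ (c ^ 2 / 4 + (g * (b - a) / b) ^ 2) / a := by
    gcongr
    nlinarith [sq_nonneg (c / 2 - g * (b - a) / b)]
  have h2 : (g * (b - a) / b) ^ 2 / a ≤ 9 * q * (g ^ 2 / b ^ 2) := by
    rw [div_le_iff₀ ha0, div_pow, mul_pow]
    calc g ^ 2 * (b - a) ^ 2 / b ^ 2 ≤ g ^ 2 * (9 * q * a) / b ^ 2 := by gcongr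
      _ = _ := by ring
  rw [add_div] at h1
  have e3 : c ^ 2 / 4 / a = c ^ 2 / a / 4 := by ring
  rw [e]
  linarith

/-- The change of the preconditioner in the momentum term. -/
lemma mul_inv_sub_inv_le (hβ : 0 < β) (hβ1 : β ≤ 1) (hV : 0 ≤ V) (hε : 0 < ε)
    {M : ℝ} (hM : 0 ≤ M) (hVM : V ≤ M ^ 2) (hgM : g ^ 2 ≤ M ^ 2) (hcM : c ^ 2 + S ^ 2 ≤ M ^ 2)
    {a b b' : ℝ} (hb : b = √(β * V + (1 - β) * g ^ 2) + ε) (hb' : b' = √V + ε)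
    (ha : a = √(β * V + (1 - β) * (c ^ 2 + S ^ 2)) + ε) (κ w : ℝ) :
    κ * c * w * (1 / b' - 1 / b)
      ≤ c ^ 2 / a / 4 + κ ^ 2 * (2 * (√(1 - β) * M) / β) * (w ^ 2 / b' ^ 2) := by
  have hk := sub_nonneg.2 hβ1
  have hv : 0 ≤ β * V + (1 - β) * g ^ 2 := by positivity
  have hb0 : 0 < b := by rw [hb]; positivity
  have ha0 : 0 < a := by rw [ha]; positivity
  have hb'0 : 0 < b' := by rw [hb']; positivity
  have hs0 : 0 < √β := Real.sqrt_pos.2 hβ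
  have hs1 : √β ≤ 1 := Real.sqrt_le_one.2 hβ1
  have hss : √β * √β = β := Real.mul_self_sqrt hβ.le
  have hab : a ≤ b + √(1 - β) * M := by
    rw [ha, hb]
    have h1 : √(β * V + (1 - β) * (c ^ 2 + S ^ 2))
        ≤ √(β * V + (1 - β) * g ^ 2) + √((1 - β) * M ^ 2) := by
      refine (Real.sqrt_le_sqrt ?_).trans (sqrt_add_le_add_sqrt hv (by positivity))
      nlinarith [mul_nonneg hk (sq_nonneg g)]
    rw [Real.sqrt_mul hk, Real.sqrt_sq hM] at h1
    linarith
  have hbb : √β * b' ≤ b := by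
    rw [hb, hb', mul_add, ← Real.sqrt_mul hβ.le]
    have : √(β * V) ≤ √(β * V + (1 - β) * g ^ 2) := Real.sqrt_le_sqrt (by nlinarith [sq_nonneg g])
    nlinarith
  have hd2 : |b - b'| ≤ √(1 - β) * M := by
    have e1 : b - b' = √(β * V + (1 - β) * g ^ 2) - √V := by rw [hb, hb']; ring
    rw [e1]
    refine abs_le.2 ⟨?_, ?_⟩
    · have h1 : √V ≤ √(β * V + (1 - β) * g ^ 2) + √((1 - β) * M ^ 2) := by
        refine (Real.sqrt_le_sqrt ?_).trans (sqrt_add_le_add_sqrt hv (by positivity))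
        nlinarith [mul_nonneg hk (sq_nonneg g)]
      rw [Real.sqrt_mul hk, Real.sqrt_sq hM] at h1
      linarith
    · have h1 : √(β * V + (1 - β) * g ^ 2) ≤ √V + √((1 - β) * M ^ 2) := by
        refine (Real.sqrt_le_sqrt ?_).trans (sqrt_add_le_add_sqrt hV (by positivity))
        nlinarith [mul_nonneg hk (sq_nonneg g)]
      rw [Real.sqrt_mul hk, Real.sqrt_sq hM] at h1
      linarith
  have hd3 : √β * |b - b'| ≤ b := by
    have e1 : √β * |b - b'| = |√β * (b - b')| := by rw [abs_mul, abs_of_pos hs0]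
    rw [e1]
    exact abs_le.2 ⟨by nlinarith, by nlinarith⟩
  have hkM : 0 ≤ √(1 - β) * M := by positivity
  generalize √(1 - β) * M = q at *
  -- In the part of `a ≤ b + q` containing `b`, one factor `|b - b'|` is bounded by the small
  -- quantity `q` and the other by `b / √β`. In the part containing `q`, both are bounded by `b /
  -- √β`.
  have hsq : a * (b - b') ^ 2 ≤ 2 * q / β * b ^ 2 := by
    rw [div_mul_eq_mul_div, le_div_iff₀ hβ]
    set D := |b - b'|
    have hD0 : 0 ≤ D := abs_nonneg _
    have e : (b - b') ^ 2 = D ^ 2 := (sq_abs _).symm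
    rw [e]
    have h1 : b * D ^ 2 * β ≤ q * b ^ 2 := by
      calc b * D ^ 2 * β = b * (D * √β) * (√β * D) := by linear_combination -b * D ^ 2 * hss
        _ ≤ b * (q * 1) * b := by gcongr
        _ = _ := by ring
    have h2 : q * D ^ 2 * β ≤ q * b ^ 2 := by
      calc q * D ^ 2 * β = q * ((√β * D) * (√β * D)) := by linear_combination -q * D ^ 2 * hss
        _ ≤ q * (b * b) := by gcongr
        _ = _ := by ring
    have h3 : a * (D ^ 2 * β) ≤ (b + q) * (D ^ 2 * β) := by gcongr
    linarith
  clear hb hb' ha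
  have e : κ * c * w * (1 / b' - 1 / b) = c * (κ * w * (b - b') / (b * b')) := by
    field_simp
  have h1 : c * (κ * w * (b - b') / (b * b'))
      ≤ c ^ 2 / a / 4 + a * (κ * w * (b - b') / (b * b')) ^ 2 := by
    set z := κ * w * (b - b') / (b * b')
    have : 0 ≤ (c / 2 - a * z) ^ 2 / a := by positivity
    have e : (c / 2 - a * z) ^ 2 / a = c ^ 2 / a / 4 - c * z + a * z ^ 2 := by field_simp; ring
    linarith
  have h2 : a * (κ * w * (b - b') / (b * b')) ^ 2 ≤ κ ^ 2 * (2 * q / β) * (w ^ 2 / b' ^ 2) := by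
    calc _ = κ ^ 2 * w ^ 2 / (b ^ 2 * b' ^ 2) * (a * (b - b') ^ 2) := by field_simp
      _ ≤ κ ^ 2 * w ^ 2 / (b ^ 2 * b' ^ 2) * (2 * q / β * b ^ 2) := by gcongr
      _ = _ := by field_simp
  rw [e]
  linarith

end Scalar

/-! ### One step of the method -/

/-- The standing assumptions on the hyper-parameters. -/
structure Admissible (β₁ β₂ η ε : ℝ) : Prop where
  nonneg : 0 ≤ β₁
  lt : β₁ < β₂
  lt_one : β₂ < 1
  step_pos : 0 < η
  eps_pos : 0 < ε

namespace Admissible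

variable {β₁ β₂ η ε : ℝ} (h : Admissible β₁ β₂ η ε)
include h

lemma pos : 0 < β₂ := h.nonneg.trans_lt h.lt

lemma lt_one' : β₁ < 1 := h.lt.trans h.lt_one

lemma one_sub_pos : 0 < 1 - β₁ := sub_pos.2 h.lt_one'

lemma one_sub_ratio_pos : 0 < 1 - β₁ / β₂ := sub_pos.2 ((div_lt_one h.pos).2 h.lt)

lemma momentum_nonneg : 0 ≤ β₁ / (1 - β₁) := div_nonneg h.nonneg h.one_sub_pos.le

lemma sqrt_pos : 0 < √(1 - β₂) := Real.sqrt_pos.2 (sub_pos.2 h.lt_one)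

lemma sq_sqrt : √(1 - β₂) ^ 2 = 1 - β₂ := Real.sq_sqrt (sub_nonneg.2 h.lt_one.le)

end Admissible

/-- The extrapolated iterate `y_{s+1} = x_{s+1} + β₁ / (1 - β₁) (x_{s+1} - x_s)`. -/
def extrapolate {d : ℕ} (β₁ β₂ η ε : ℝ) (x₁ : Vec d) (g : ℕ → Vec d) (s : ℕ) : Vec d :=
  iterate β₁ β₂ η ε x₁ g (s + 1) + (β₁ / (1 - β₁)) •
    (iterate β₁ β₂ η ε x₁ g (s + 1) - iterate β₁ β₂ η ε x₁ g s)

/-- The almost sure bound on the noise when the true gradient is `c`. -/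
def noiseLevel {d : ℕ} (σ₀ σ₁ c : Vec d) (i : Fin d) : ℝ := √(σ₀ i ^ 2 + σ₁ i ^ 2 * c i ^ 2)

/-- A predictable substitute for the denominator at step `s + 1`, given the true gradient `c`. -/
def proxyDenom {d : ℕ} (β₂ ε : ℝ) (σ₀ σ₁ c : Vec d) (g : ℕ → Vec d) (s : ℕ) (i : Fin d) : ℝ :=
  √(β₂ * secondMoment β₂ g s i + (1 - β₂) * (c i ^ 2 + noiseLevel σ₀ σ₁ c i ^ 2)) + ε

/-- The decrease of the step size (zero for the first step, where the momentum vanishes). -/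
def stepDecrease (β₁ η : ℝ) (s : ℕ) : ℝ :=
  if s = 0 then 0 else stepSize β₁ η s - stepSize β₁ η (s + 1)

section Step

variable {d : ℕ} {β₁ β₂ η ε : ℝ}

lemma noiseLevel_sq (σ₀ σ₁ c : Vec d) (i : Fin d) :
    noiseLevel σ₀ σ₁ c i ^ 2 = σ₀ i ^ 2 + σ₁ i ^ 2 * c i ^ 2 := Real.sq_sqrt (by positivity)

lemma noiseLevel_nonneg (σ₀ σ₁ c : Vec d) (i : Fin d) : 0 ≤ noiseLevel σ₀ σ₁ c i :=
  Real.sqrt_nonneg _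

lemma proxyDenom_ge (σ₀ σ₁ c : Vec d) (g : ℕ → Vec d) (s : ℕ) (i : Fin d) :
    ε ≤ proxyDenom β₂ ε σ₀ σ₁ c g s i := by
  unfold proxyDenom; linarith [Real.sqrt_nonneg (β₂ * secondMoment β₂ g s i
    + (1 - β₂) * (c i ^ 2 + noiseLevel σ₀ σ₁ c i ^ 2))]

lemma proxyDenom_pos (hε : 0 < ε) (σ₀ σ₁ c : Vec d) (g : ℕ → Vec d) (s : ℕ) (i : Fin d) :
    0 < proxyDenom β₂ ε σ₀ σ₁ c g s i := hε.trans_le (proxyDenom_ge ..)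

lemma stepDecrease_nonneg (h : Admissible β₁ β₂ η ε) (s : ℕ) : 0 ≤ stepDecrease β₁ η s := by
  unfold stepDecrease
  split_ifs with hs
  · exact le_rfl
  · obtain ⟨r, rfl⟩ := Nat.exists_eq_succ_of_ne_zero hs
    exact sub_nonneg.2 (stepSize_succ_le r h.nonneg h.lt_one' h.step_pos.le)

/-- The sum telescopes from `stepSize β₁ η 1`. The value at `s = 0` must be set to zero by hand:
`stepSize β₁ η 0` is `η / 0 = 0`, so the plain difference would be negative there. -/
lemma sum_stepDecrease_le (h : Admissible β₁ β₂ η ε) (t : ℕ) :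
    ∑ s ∈ range t, stepDecrease β₁ η s ≤ η / (1 - β₁) := by
  have h0 : 0 ≤ η / (1 - β₁) := div_nonneg h.step_pos.le h.one_sub_pos.le
  cases t with
  | zero => simpa using h0
  | succ t =>
    have e : ∑ s ∈ range (t + 1), stepDecrease β₁ η s
        = stepSize β₁ η 1 - stepSize β₁ η (t + 1) := by
      induction t with
      | zero => simp [stepDecrease]
      | succ t ih => rw [sum_range_succ, ih]; simp [stepDecrease]
    rw [e]
    have h1 := stepSize_le 0 h.nonneg h.lt_one' h.step_pos.le
    have h2 := stepSize_nonneg (t + 1) h.nonneg h.lt_one' h.step_pos.le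
    simp only [zero_add] at h1
    linarith

/-- The increment is `1 / (1 - β₁)` times the new displacement minus `κ` times the old one.
Expanding `m_{s+1}` gives the fresh gradient the full weight `1` and leaves `m_s` multiplied only by
the change of the preconditioned step. -/
lemma extrapolate_succ_apply (h : Admissible β₁ β₂ η ε) (x₁ : Vec d) (g : ℕ → Vec d) (s : ℕ)
    (i : Fin d) :
    extrapolate β₁ β₂ η ε x₁ g (s + 1) i = extrapolate β₁ β₂ η ε x₁ g s i
      + (-(stepSize β₁ η (s + 1) * g (s + 1) i / denom β₂ ε g (s + 1) i)
        + β₁ / (1 - β₁) * firstMoment β₁ g s i * (stepSize β₁ η s / denom β₂ ε g s i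
          - stepSize β₁ η (s + 1) / denom β₂ ε g (s + 1) i)) := by
  have hβ := h.one_sub_pos.ne'
  simp only [extrapolate, PiLp.add_apply, PiLp.smul_apply, PiLp.sub_apply, smul_eq_mul]
  rw [iterate_succ_apply x₁ g (s + 1), iterate_succ_apply x₁ g s, firstMoment_succ]
  field_simp
  ring

lemma firstMoment_sq_div_le (h : Admissible β₁ β₂ η ε) (g : ℕ → Vec d) (s : ℕ) (i : Fin d) :
    firstMoment β₁ g s i ^ 2 / denom β₂ ε g s i ^ 2
      ≤ (1 - β₁ ^ s) * discountedRatio β₁ β₂ ε g s i := by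
  have hd := denom_pos (β₂ := β₂) g s i h.eps_pos
  have h1 := firstMoment_sq_le_ratio (β₂ := β₂) g s i h.nonneg h.lt_one' h.eps_pos
  have hu := discountedRatio_nonneg (β₂ := β₂) (ε := ε) g s i h.nonneg
  have hp := one_sub_pow_nonneg s h.nonneg h.lt_one'
  rw [div_le_iff₀ (by positivity)]
  refine h1.trans ?_
  have : 0 ≤ (1 - β₁ ^ s) * (denom β₂ ε g s i ^ 2 * discountedRatio β₁ β₂ ε g s i) := by positivity
  nlinarith [mul_nonneg h.nonneg this]

lemma abs_firstMoment_div_le (h : Admissible β₁ β₂ η ε) (g : ℕ → Vec d) (s : ℕ) (i : Fin d) :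
    |firstMoment β₁ g s i| / denom β₂ ε g s i
      ≤ √((1 - β₁) / (1 - β₁ / β₂)) / √(1 - β₂) := by
  have hd := denom_pos (β₂ := β₂) g s i h.eps_pos
  have h1 := firstMoment_sq_le_ratio (β₂ := β₂) g s i h.nonneg h.lt_one' h.eps_pos
  have hu := discountedRatio_nonneg (β₂ := β₂) (ε := ε) g s i h.nonneg
  have hu1 := discountedRatio_le g s i h.nonneg h.lt h.lt_one h.eps_pos
  have hρ := h.one_sub_ratio_pos
  have hk : 0 < 1 - β₂ := sub_pos.2 h.lt_one
  have hβ := h.one_sub_pos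
  rw [← Real.sqrt_div (by positivity), ← Real.sqrt_sq (by positivity :
    0 ≤ |firstMoment β₁ g s i| / denom β₂ ε g s i)]
  apply Real.sqrt_le_sqrt
  rw [div_pow, sq_abs, div_le_iff₀ (by positivity)]
  have hp : 1 - β₁ ^ s ≤ 1 := by linarith [pow_nonneg h.nonneg s]
  have hp0 := one_sub_pow_nonneg s h.nonneg h.lt_one'
  have hu2 : discountedRatio β₁ β₂ ε g s i ≤ 1 / (1 - β₁ / β₂) / (1 - β₂) := by
    rw [le_div_iff₀ hk, le_div_iff₀ hρ]
    linarith
  calc _ ≤ _ := h1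
    _ ≤ 1 * (1 - β₁) * (denom β₂ ε g s i ^ 2 * (1 / (1 - β₁ / β₂) / (1 - β₂))) := by gcongr
    _ = _ := by field_simp

lemma one_le_sigmaMax (β₂ : ℝ) : 1 ≤ sigmaMax β₂ := le_max_left _ _

lemma inv_sqrt_sub_one_le_sigmaMax {β₂ : ℝ} (h : 0 < β₂) : 1 / √β₂ - 1 ≤ sigmaMax β₂ := by
  refine le_trans ?_ (le_max_right _ _)
  rw [← Real.sqrt_one, ← Real.sqrt_div zero_le_one, Real.sqrt_one]
  gcongr
  linarith

/-- The momentum part of the extrapolated step is controlled by the last displacement. -/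
lemma momentum_sq_le (h : Admissible β₁ β₂ η ε) (g : ℕ → Vec d) (s : ℕ) (i : Fin d) :
    (β₁ / (1 - β₁) * firstMoment β₁ g s i * (stepSize β₁ η s / denom β₂ ε g s i
          - stepSize β₁ η (s + 1) / denom β₂ ε g (s + 1) i)) ^ 2
      ≤ (β₁ / (1 - β₁)) ^ 2 * sigmaMax β₂ ^ 2 *
        (stepSize β₁ η s / denom β₂ ε g s i * firstMoment β₁ g s i) ^ 2 := by
  cases s with
  | zero => simp [firstMoment]
  | succ s =>
    have hd := denom_pos (β₂ := β₂) g (s + 1) i h.eps_pos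
    have hd' := denom_pos (β₂ := β₂) g (s + 2) i h.eps_pos
    have hη := le_stepSize s h.nonneg h.lt_one' h.step_pos.le
    have hη' := le_stepSize (s + 1) h.nonneg h.lt_one' h.step_pos.le
    have hle := stepSize_succ_le s h.nonneg h.lt_one' h.step_pos.le
    have hs := sqrt_mul_denom_le g (s + 1) i h.pos.le h.lt_one.le h.eps_pos
    have hβ := Real.sqrt_pos.2 h.pos
    have hm1 := one_le_sigmaMax β₂
    have hm2 := inv_sqrt_sub_one_le_sigmaMax h.pos
    generalize stepSize β₁ η (s + 1) = a at *
    rw [show s + 1 + 1 = s + 2 from rfl] at *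
    generalize stepSize β₁ η (s + 2) = a' at *
    generalize denom β₂ ε g (s + 1) i = b at *
    generalize denom β₂ ε g (s + 2) i = b' at *
    generalize firstMoment β₁ g (s + 1) i = m at *
    have ha : 0 < a := h.step_pos.trans_le hη
    have ha' : 0 < a' := h.step_pos.trans_le hη'
    -- The ratio of consecutive preconditioned steps lies in `[0, 1 / √β₂]`, so its distance to `1`
    -- is at most `max 1 (1 / √β₂ - 1)`; this is the role of `sigmaMax`.
    have hr : a' * b / (a * b') ≤ 1 / √β₂ := by
      rw [div_le_div_iff₀ (by positivity) hβ, one_mul, mul_assoc]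
      gcongr
      linarith
    have hr0 : 0 ≤ a' * b / (a * b') := by positivity
    have h1 : (1 - a' * b / (a * b')) ^ 2 ≤ sigmaMax β₂ ^ 2 :=
      sq_le_sq' (by linarith) (by linarith)
    calc _ = (β₁ / (1 - β₁)) ^ 2 * (1 - a' * b / (a * b')) ^ 2 * (a / b * m) ^ 2 := by
          field_simp
      _ ≤ _ := by gcongr

/-- The coordinatewise contribution of the momentum part to the first-order term. -/
lemma inner_momentum_le (h : Admissible β₁ β₂ η ε) (σ₀ σ₁ c : Vec d) (g : ℕ → Vec d) (s : ℕ)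
    (i : Fin d) {M Γ : ℝ} (hM : 0 ≤ M) (hg : ∀ j ∈ Icc 1 (s + 1), g j i ^ 2 ≤ M ^ 2)
    (hc : c i ^ 2 + noiseLevel σ₀ σ₁ c i ^ 2 ≤ M ^ 2) (hΓ : |c i| ≤ Γ) :
    c i * (β₁ / (1 - β₁) * firstMoment β₁ g s i * (stepSize β₁ η s / denom β₂ ε g s i
          - stepSize β₁ η (s + 1) / denom β₂ ε g (s + 1) i))
      ≤ stepSize β₁ η (s + 1) * (c i ^ 2 / proxyDenom β₂ ε σ₀ σ₁ c g s i) / 4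
        + η * ((β₁ / (1 - β₁)) ^ 2 * (2 * (√(1 - β₂) * M) / β₂))
          * discountedRatio β₁ β₂ ε g s i
        + Γ * (β₁ / (1 - β₁)) * (√((1 - β₁) / (1 - β₁ / β₂)) / √(1 - β₂))
          * stepDecrease β₁ η s := by
  have hV := secondMoment_nonneg g s i h.pos.le h.lt_one.le
  have hVM := secondMoment_le_of_sq_le g s i h.pos.le h.lt_one.le (sq_nonneg M)
    fun j hj => hg j (by simp only [mem_Icc] at hj ⊢; omega)
  have key := mul_inv_sub_inv_le (g := g (s + 1) i) (c := c i) (S := noiseLevel σ₀ σ₁ c i)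
    h.pos h.lt_one.le hV h.eps_pos hM hVM (hg _ (by simp)) hc
    (b := denom β₂ ε g (s + 1) i) (b' := denom β₂ ε g s i)
    (a := proxyDenom β₂ ε σ₀ σ₁ c g s i) rfl rfl rfl (β₁ / (1 - β₁)) (firstMoment β₁ g s i)
  have hstep := stepSize_nonneg (s + 1) h.nonneg h.lt_one' h.step_pos.le
  have hκ := h.momentum_nonneg
  have hkM : 0 ≤ 2 * (√(1 - β₂) * M) / β₂ := by have := h.pos; positivity
  have hm := firstMoment_sq_div_le h g s i
  have hstep2 := stepSize_succ_mul_le s h.nonneg h.lt_one' h.step_pos.le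
  have hu := discountedRatio_nonneg (β₂ := β₂) (ε := ε) g s i h.nonneg
  have h1 := mul_le_mul_of_nonneg_left key hstep
  have h2 : stepSize β₁ η (s + 1) * (firstMoment β₁ g s i ^ 2 / denom β₂ ε g s i ^ 2)
      ≤ η * discountedRatio β₁ β₂ ε g s i :=
    calc _ ≤ stepSize β₁ η (s + 1) * ((1 - β₁ ^ s) * discountedRatio β₁ β₂ ε g s i) := by gcongr
      _ = (stepSize β₁ η (s + 1) * (1 - β₁ ^ s)) * discountedRatio β₁ β₂ ε g s i := by ring
      _ ≤ _ := by gcongr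
  have h3 := mul_le_mul_of_nonneg_left h2 (mul_nonneg (sq_nonneg (β₁ / (1 - β₁))) hkM)
  have h4 : c i * (β₁ / (1 - β₁) * firstMoment β₁ g s i *
        ((stepSize β₁ η s - stepSize β₁ η (s + 1)) / denom β₂ ε g s i))
      ≤ Γ * (β₁ / (1 - β₁)) * (√((1 - β₁) / (1 - β₁ / β₂)) / √(1 - β₂))
          * stepDecrease β₁ η s := by
    cases s with
    | zero => simp [firstMoment, stepDecrease]
    | succ s =>
      have hdec := stepDecrease_nonneg h (s + 1)
      have e : stepSize β₁ η (s + 1) - stepSize β₁ η (s + 1 + 1) = stepDecrease β₁ η (s + 1) := by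
        simp [stepDecrease]
      rw [e]
      have hd := denom_pos (β₂ := β₂) g (s + 1) i h.eps_pos
      have hm := abs_firstMoment_div_le h g (s + 1) i
      have hΓ0 : 0 ≤ Γ := (abs_nonneg _).trans hΓ
      calc _ ≤ |c i * (β₁ / (1 - β₁) * firstMoment β₁ g (s + 1) i *
            (stepDecrease β₁ η (s + 1) / denom β₂ ε g (s + 1) i))| := le_abs_self _
        _ = |c i| * (β₁ / (1 - β₁)) * (|firstMoment β₁ g (s + 1) i| / denom β₂ ε g (s + 1) i)
            * stepDecrease β₁ η (s + 1) := by
          rw [abs_mul, abs_mul, abs_mul, abs_div (stepDecrease β₁ η (s + 1)), abs_of_nonneg hκ, abs_of_nonneg hdec,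
            abs_of_pos hd]
          ring
        _ ≤ _ := by gcongr
  -- The change of the preconditioned step splits into the change of the step size at the old
  -- denominator, which telescopes after summation, and the change of the denominator at the new
  -- step size.
  have e : c i * (β₁ / (1 - β₁) * firstMoment β₁ g s i * (stepSize β₁ η s / denom β₂ ε g s i
          - stepSize β₁ η (s + 1) / denom β₂ ε g (s + 1) i))
      = c i * (β₁ / (1 - β₁) * firstMoment β₁ g s i *
          ((stepSize β₁ η s - stepSize β₁ η (s + 1)) / denom β₂ ε g s i))
        + stepSize β₁ η (s + 1) * (β₁ / (1 - β₁) * c i * firstMoment β₁ g s i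
          * (1 / denom β₂ ε g s i - 1 / denom β₂ ε g (s + 1) i)) := by ring
  rw [e]
  linarith

/-- The coordinatewise contribution of the stochastic gradient to the first-order term. -/
lemma inner_gradient_le (h : Admissible β₁ β₂ η ε) (σ₀ σ₁ c : Vec d) (g : ℕ → Vec d) (s : ℕ)
    (i : Fin d) (hn : (g (s + 1) i - c i) ^ 2 ≤ σ₀ i ^ 2 + σ₁ i ^ 2 * c i ^ 2) {S : ℝ}
    (hS : noiseLevel σ₀ σ₁ c i ≤ S) :
    c i * -(stepSize β₁ η (s + 1) * g (s + 1) i / denom β₂ ε g (s + 1) i)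
      ≤ -(3 / 4) * (stepSize β₁ η (s + 1) * (c i ^ 2 / proxyDenom β₂ ε σ₀ σ₁ c g s i))
        - stepSize β₁ η (s + 1) * (c i * (g (s + 1) i - c i) / proxyDenom β₂ ε σ₀ σ₁ c g s i)
        + 9 * (η / (1 - β₁)) * (√(1 - β₂) * S) * normSq β₂ ε g (s + 1) i := by
  have hV := secondMoment_nonneg g s i h.pos.le h.lt_one.le
  have hS0 := noiseLevel_nonneg σ₀ σ₁ c i
  rw [← noiseLevel_sq] at hn
  have key := neg_mul_div_denom_le h.pos.le h.lt_one.le hV hS0 h.eps_pos hn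
    (b := denom β₂ ε g (s + 1) i) (a := proxyDenom β₂ ε σ₀ σ₁ c g s i) rfl rfl
  have hstep := stepSize_nonneg (s + 1) h.nonneg h.lt_one' h.step_pos.le
  have hstep2 := stepSize_le s h.nonneg h.lt_one' h.step_pos.le
  have hh := normSq_nonneg (β₂ := β₂) (ε := ε) g (s + 1) i
  have h1 := mul_le_mul_of_nonneg_left key hstep
  have h2 : stepSize β₁ η (s + 1) * (9 * (√(1 - β₂) * noiseLevel σ₀ σ₁ c i)
        * normSq β₂ ε g (s + 1) i)
      ≤ η / (1 - β₁) * (9 * (√(1 - β₂) * S) * normSq β₂ ε g (s + 1) i) := by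
    have := hS0.trans hS
    have := div_nonneg h.step_pos.le h.one_sub_pos.le
    gcongr
  have e : normSq β₂ ε g (s + 1) i = g (s + 1) i ^ 2 / denom β₂ ε g (s + 1) i ^ 2 := rfl
  rw [← e] at h1
  linarith [show c i * -(stepSize β₁ η (s + 1) * g (s + 1) i / denom β₂ ε g (s + 1) i)
    = stepSize β₁ η (s + 1) * -(c i * g (s + 1) i / denom β₂ ε g (s + 1) i) by ring]

end Step

/-- The gradient norm in the metric of the predictable preconditioner, times the step size. -/
def weightedSq {d : ℕ} (β₁ β₂ η ε : ℝ) (σ₀ σ₁ c : Vec d) (g : ℕ → Vec d) (s : ℕ) : ℝ :=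
  ∑ i, stepSize β₁ η (s + 1) * (c i ^ 2 / proxyDenom β₂ ε σ₀ σ₁ c g s i)

/-- The martingale increment of the first-order term. -/
def noiseTerm {d : ℕ} (β₁ β₂ η ε : ℝ) (σ₀ σ₁ c : Vec d) (g : ℕ → Vec d) (s : ℕ) : ℝ :=
  ∑ i, stepSize β₁ η (s + 1) * (c i * (g (s + 1) i - c i) / proxyDenom β₂ ε σ₀ σ₁ c g s i)

/-! ### The descent inequality for the extrapolated points. -/

section Descent

variable {d : ℕ} {β₁ β₂ η ε L : ℝ} {f : Vec d → ℝ}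

lemma iterate_sub_norm_sq_le (h : Admissible β₁ β₂ η ε) (x₁ : Vec d) (g : ℕ → Vec d) (s : ℕ) :
    ‖iterate β₁ β₂ η ε x₁ g (s + 1) - iterate β₁ β₂ η ε x₁ g s‖ ^ 2
      ≤ ∑ i, η ^ 2 * discountedRatio β₁ β₂ ε g s i := by
  rw [EuclideanSpace.real_norm_sq_eq]
  exact sum_le_sum fun i _ =>
    iterate_sub_sq_le x₁ g s i h.nonneg h.lt_one' h.step_pos.le h.eps_pos

/-- The fresh gradient contributes `-3/4` of `weightedSq`, and Young's inequality in the momentum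
correction takes back `1/4`. The second-order terms, including the gap between `x` and the
extrapolated point, are charged to `normSq` and `discountedRatio`. -/
lemma descent_step (h : Admissible β₁ β₂ η ε) (hf : IsSmooth f L) (hL : 0 ≤ L)
    (σ₀ σ₁ x₁ : Vec d) (g : ℕ → Vec d) (s : ℕ) {c : Vec d}
    (hcdef : c = gradient f (iterate β₁ β₂ η ε x₁ g (s + 1))) {M Γ S : ℝ} (hM : 0 ≤ M)
    (hn : ∀ i, (g (s + 1) i - c i) ^ 2 ≤ σ₀ i ^ 2 + σ₁ i ^ 2 * c i ^ 2)
    (hg : ∀ j ∈ Icc 1 (s + 1), ∀ i, g j i ^ 2 ≤ M ^ 2)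
    (hc : ∀ i, c i ^ 2 + noiseLevel σ₀ σ₁ c i ^ 2 ≤ M ^ 2) (hΓ : ∀ i, |c i| ≤ Γ)
    (hS : ∀ i, noiseLevel σ₀ σ₁ c i ≤ S) :
    f (extrapolate β₁ β₂ η ε x₁ g (s + 1)) ≤ f (extrapolate β₁ β₂ η ε x₁ g s)
      - 1 / 2 * weightedSq β₁ β₂ η ε σ₀ σ₁ c g s - noiseTerm β₁ β₂ η ε σ₀ σ₁ c g s
      + ∑ i, ((9 * (η / (1 - β₁)) * (√(1 - β₂) * S) + 2 * L * (η / (1 - β₁)) ^ 2)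
            * normSq β₂ ε g (s + 1) i
          + (η * ((β₁ / (1 - β₁)) ^ 2 * (2 * (√(1 - β₂) * M) / β₂))
              + L * (β₁ / (1 - β₁)) ^ 2 * η ^ 2 * (1 / 2 + 2 * sigmaMax β₂ ^ 2))
            * discountedRatio β₁ β₂ ε g s i
          + Γ * (β₁ / (1 - β₁)) * (√((1 - β₁) / (1 - β₁ / β₂)) / √(1 - β₂))
            * stepDecrease β₁ η s) := by
  set P : Vec d := WithLp.toLp 2 fun i =>
    -(stepSize β₁ η (s + 1) * g (s + 1) i / denom β₂ ε g (s + 1) i) with hP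
  set R : Vec d := WithLp.toLp 2 fun i =>
    β₁ / (1 - β₁) * firstMoment β₁ g s i * (stepSize β₁ η s / denom β₂ ε g s i
          - stepSize β₁ η (s + 1) / denom β₂ ε g (s + 1) i) with hR
  have hy : extrapolate β₁ β₂ η ε x₁ g (s + 1) = extrapolate β₁ β₂ η ε x₁ g s + (P + R) := by
    ext i
    rw [extrapolate_succ_apply h]
    simp [hP, hR]
  have hκ := h.momentum_nonneg
  have key := hf.descent hL hκ (iterate β₁ β₂ η ε x₁ g (s + 1))
    (iterate β₁ β₂ η ε x₁ g (s + 1) - iterate β₁ β₂ η ε x₁ g s) P R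
  rw [← hcdef] at key
  have hD := iterate_sub_norm_sq_le h x₁ g s
  have hinner : ∀ u v : Vec d, inner ℝ u v = ∑ i, u i * v i := fun u v => by
    simp [PiLp.inner_apply, mul_comm]
  have hstep := stepSize_nonneg (s + 1) h.nonneg h.lt_one' h.step_pos.le
  have hstep2 := stepSize_le s h.nonneg h.lt_one' h.step_pos.le
  have hPn : ‖P‖ ^ 2 ≤ ∑ i, (η / (1 - β₁)) ^ 2 * normSq β₂ ε g (s + 1) i := by
    rw [EuclideanSpace.real_norm_sq_eq]
    refine sum_le_sum fun i _ => ?_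
    have : P i ^ 2 = stepSize β₁ η (s + 1) ^ 2 * normSq β₂ ε g (s + 1) i := by
      simp only [hP, normSq]; ring
    rw [this]
    have := normSq_nonneg (β₂ := β₂) (ε := ε) g (s + 1) i
    gcongr
  have hRn : ‖R‖ ^ 2 ≤ ∑ i, (β₁ / (1 - β₁)) ^ 2 * sigmaMax β₂ ^ 2
      * (η ^ 2 * discountedRatio β₁ β₂ ε g s i) := by
    rw [EuclideanSpace.real_norm_sq_eq]
    refine sum_le_sum fun i _ => ?_
    refine (momentum_sq_le h g s i).trans ?_
    have := iterate_sub_sq_le (β₂ := β₂) x₁ g s i h.nonneg h.lt_one' h.step_pos.le h.eps_pos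
    rw [iterate_succ_apply, sub_sub_cancel_left, neg_sq] at this
    gcongr
  have h1 : inner ℝ c P ≤ ∑ i, (-(3 / 4) * (stepSize β₁ η (s + 1)
        * (c i ^ 2 / proxyDenom β₂ ε σ₀ σ₁ c g s i))
      - stepSize β₁ η (s + 1) * (c i * (g (s + 1) i - c i) / proxyDenom β₂ ε σ₀ σ₁ c g s i)
      + 9 * (η / (1 - β₁)) * (√(1 - β₂) * S) * normSq β₂ ε g (s + 1) i) := by
    rw [hinner]
    exact sum_le_sum fun i _ => inner_gradient_le h σ₀ σ₁ c g s i (hn i) (hS i)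
  have hi := fun i => inner_momentum_le h σ₀ σ₁ c g s i hM (fun j hj => hg j hj i) (hc i) (hΓ i)
  have h2 := (hinner c R).trans_le (sum_le_sum fun i _ => hi i)
  have hy' : extrapolate β₁ β₂ η ε x₁ g s = iterate β₁ β₂ η ε x₁ g (s + 1) + (β₁ / (1 - β₁)) •
    (iterate β₁ β₂ η ε x₁ g (s + 1) - iterate β₁ β₂ η ε x₁ g s) := rfl
  rw [← hy', ← hy] at key
  have h3 := mul_le_mul_of_nonneg_left hD (show 0 ≤ L / 2 * (β₁ / (1 - β₁)) ^ 2 by positivity)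
  have h4 := mul_le_mul_of_nonneg_left hPn (show 0 ≤ 2 * L by positivity)
  have h5 := mul_le_mul_of_nonneg_left hRn (show 0 ≤ 2 * L by positivity)
  refine key.trans ?_
  refine (add_le_add (add_le_add (add_le_add (add_le_add (add_le_add_right h1 _) h2) h3) h4)
    h5).trans (le_of_eq ?_)
  unfold weightedSq noiseTerm
  simp only [mul_sum]
  rw [sub_sub, ← sum_add_distrib, add_assoc, add_assoc, add_assoc, add_assoc, ← sum_add_distrib,
    ← sum_add_distrib, ← sum_add_distrib, ← sum_add_distrib, sub_add_eq_add_sub, add_sub_assoc,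
    ← sum_sub_distrib]
  congr 1
  refine sum_congr rfl fun i _ => ?_
  ring

lemma extrapolate_zero (x₁ : Vec d) (g : ℕ → Vec d) : extrapolate β₁ β₂ η ε x₁ g 0 = x₁ := by
  simp [extrapolate, iterate]

/-- Telescoping starts at `x₁` because the convention `x_0 = x_1` makes the first extrapolation
trivial. Summing in time for each coordinate before summing over coordinates produces the factor
`d`. -/
lemma descent_sum (h : Admissible β₁ β₂ η ε) (hf : IsSmooth f L) (hL : 0 ≤ L)
    (σ₀ σ₁ x₁ : Vec d) (g : ℕ → Vec d) (t : ℕ) {c : ℕ → Vec d}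
    (hcdef : ∀ s, c s = gradient f (iterate β₁ β₂ η ε x₁ g s)) {M Γ S ℓ : ℝ} (hM : 0 ≤ M)
    (hΓ0 : 0 ≤ Γ) (hS0 : 0 ≤ S)
    (hn : ∀ s ∈ Icc 1 t, ∀ i, (g s i - c s i) ^ 2 ≤ σ₀ i ^ 2 + σ₁ i ^ 2 * c s i ^ 2)
    (hg : ∀ s ∈ Icc 1 t, ∀ i, g s i ^ 2 ≤ M ^ 2)
    (hc : ∀ s ∈ Icc 1 t, ∀ i, c s i ^ 2 + noiseLevel σ₀ σ₁ (c s) i ^ 2 ≤ M ^ 2)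
    (hΓ : ∀ s ∈ Icc 1 t, ∀ i, |c s i| ≤ Γ)
    (hS : ∀ s ∈ Icc 1 t, ∀ i, noiseLevel σ₀ σ₁ (c s) i ≤ S)
    (hℓ : ∀ i, (1 - β₂) * ∑ s ∈ range t, normSq β₂ ε g (s + 1) i ≤ ℓ) :
    f (extrapolate β₁ β₂ η ε x₁ g t) ≤ f x₁
      - 1 / 2 * ∑ s ∈ range t, weightedSq β₁ β₂ η ε σ₀ σ₁ (c (s + 1)) g s
      - ∑ s ∈ range t, noiseTerm β₁ β₂ η ε σ₀ σ₁ (c (s + 1)) g s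
      + d * ((9 * (η / (1 - β₁)) * (√(1 - β₂) * S) + 2 * L * (η / (1 - β₁)) ^ 2)
            * (ℓ / (1 - β₂))
          + (η * ((β₁ / (1 - β₁)) ^ 2 * (2 * (√(1 - β₂) * M) / β₂))
              + L * (β₁ / (1 - β₁)) ^ 2 * η ^ 2 * (1 / 2 + 2 * sigmaMax β₂ ^ 2))
            * (ℓ / (1 - β₂) / (1 - β₁ / β₂))
          + Γ * (β₁ / (1 - β₁)) * (√((1 - β₁) / (1 - β₁ / β₂)) / √(1 - β₂))
            * (η / (1 - β₁))) := by
  have hk : 0 < 1 - β₂ := sub_pos.2 h.lt_one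
  have hρ := h.one_sub_ratio_pos
  have hκ := h.momentum_nonneg
  have hβ2 := h.pos
  have hη := h.step_pos
  have hηβ := div_nonneg h.step_pos.le h.one_sub_pos.le
  set A := 9 * (η / (1 - β₁)) * (√(1 - β₂) * S) + 2 * L * (η / (1 - β₁)) ^ 2 with hA
  set B := η * ((β₁ / (1 - β₁)) ^ 2 * (2 * (√(1 - β₂) * M) / β₂))
    + L * (β₁ / (1 - β₁)) ^ 2 * η ^ 2 * (1 / 2 + 2 * sigmaMax β₂ ^ 2) with hB
  set E := Γ * (β₁ / (1 - β₁)) * (√((1 - β₁) / (1 - β₁ / β₂)) / √(1 - β₂)) with hE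
  have hA0 : 0 ≤ A := by positivity
  have hB0 : 0 ≤ B := by positivity
  have hE0 : 0 ≤ E := by positivity
  have hstep : ∀ r ≤ t, f (extrapolate β₁ β₂ η ε x₁ g r) ≤ f x₁
      - 1 / 2 * ∑ s ∈ range r, weightedSq β₁ β₂ η ε σ₀ σ₁ (c (s + 1)) g s
      - ∑ s ∈ range r, noiseTerm β₁ β₂ η ε σ₀ σ₁ (c (s + 1)) g s
      + ∑ s ∈ range r, ∑ i, (A * normSq β₂ ε g (s + 1) i + B * discountedRatio β₁ β₂ ε g s i
          + E * stepDecrease β₁ η s) := by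
    intro r
    induction r with
    | zero => intro _; simp [extrapolate_zero]
    | succ r ih =>
      intro hr
      have hm : r + 1 ∈ Icc 1 t := mem_Icc.2 ⟨by omega, hr⟩
      have h1 := descent_step h hf hL σ₀ σ₁ x₁ g r (hcdef (r + 1)) hM (hn _ hm)
        (fun j hj => hg j (by simp only [mem_Icc] at hj ⊢; omega)) (hc _ hm) (hΓ _ hm) (hS _ hm)
      have h2 := ih (by omega)
      simp only [sum_range_succ]
      linarith
  refine (hstep t le_rfl).trans (add_le_add_right ?_ _)
  rw [sum_comm]
  refine (sum_le_card_nsmul univ _ _ fun i _ => ?_).trans_eq (by rw [card_fin, nsmul_eq_mul])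
  rw [sum_add_distrib, sum_add_distrib, ← mul_sum, ← mul_sum, ← mul_sum]
  have h1 : ∑ s ∈ range t, normSq β₂ ε g (s + 1) i ≤ ℓ / (1 - β₂) := by
    rw [le_div_iff₀ hk, mul_comm]; exact hℓ i
  have h2 : ∑ s ∈ range t, discountedRatio β₁ β₂ ε g s i ≤ ℓ / (1 - β₂) / (1 - β₁ / β₂) := by
    rw [le_div_iff₀ hρ, mul_comm]
    exact (sum_discountedRatio_le g t i h.nonneg h.lt h.lt_one h.eps_pos).trans h1
  have h3 := sum_stepDecrease_le h t
  gcongr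

end Descent

/-! ### Coordinatewise bounds by norms. -/

section Supremum

variable {d : ℕ}

lemma supNorm_nonneg (v : Vec d) : 0 ≤ supNorm v := norm_nonneg _

lemma sq_apply_le_supNorm_sq (v : Vec d) (i : Fin d) : v i ^ 2 ≤ supNorm v ^ 2 := by
  rw [← sq_abs (v i)]
  exact pow_le_pow_left₀ (abs_nonneg _) (norm_le_pi_norm (WithLp.ofLp v) i) 2

lemma sq_apply_le_norm_sq (v : Vec d) (i : Fin d) : v i ^ 2 ≤ ‖v‖ ^ 2 := by
  rw [EuclideanSpace.real_norm_sq_eq]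
  exact single_le_sum (f := fun i => v i ^ 2) (fun i _ => sq_nonneg _) (mem_univ i)

lemma abs_apply_le_norm (v : Vec d) (i : Fin d) : |v i| ≤ ‖v‖ :=
  abs_le_of_sq_le_sq (by simpa using sq_apply_le_norm_sq v i) (norm_nonneg _)

lemma noiseLevel_le (σ₀ σ₁ c : Vec d) (i : Fin d) {Γ : ℝ} (hΓ0 : 0 ≤ Γ) (hΓ : |c i| ≤ Γ) :
    noiseLevel σ₀ σ₁ c i ≤ supNorm σ₀ + supNorm σ₁ * Γ := by
  have h0 := supNorm_nonneg σ₀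
  have h1 := supNorm_nonneg σ₁
  refine Real.sqrt_le_iff.2 ⟨by positivity, ?_⟩
  have h2 := sq_apply_le_supNorm_sq σ₀ i
  have h3 := sq_apply_le_supNorm_sq σ₁ i
  have h4 : c i ^ 2 ≤ Γ ^ 2 := by rw [← sq_abs]; gcongr
  have h5 : σ₁ i ^ 2 * c i ^ 2 ≤ supNorm σ₁ ^ 2 * Γ ^ 2 := by gcongr
  nlinarith [mul_nonneg h0 (mul_nonneg h1 hΓ0)]

/-- The factor `2` on the left is the one in `g² ≤ 2 (c² + S²)`, so the same bound serves for
stochastic gradients and for the proxy. -/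
lemma sq_add_noiseLevel_sq_le (σ₀ σ₁ c : Vec d) (i : Fin d) {Γ : ℝ} (hΓ0 : 0 ≤ Γ)
    (hΓ : |c i| ≤ Γ) : 2 * (c i ^ 2 + noiseLevel σ₀ σ₁ c i ^ 2)
      ≤ (2 * (supNorm σ₀ + √(1 + supNorm σ₁ ^ 2) * Γ)) ^ 2 := by
  have h0 := supNorm_nonneg σ₀
  rw [noiseLevel_sq]
  have h2 := sq_apply_le_supNorm_sq σ₀ i
  have h3 := sq_apply_le_supNorm_sq σ₁ i
  have h4 : c i ^ 2 ≤ Γ ^ 2 := by rw [← sq_abs]; gcongr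
  have h5 : σ₁ i ^ 2 * c i ^ 2 ≤ supNorm σ₁ ^ 2 * Γ ^ 2 := by gcongr
  have h6 := Real.sq_sqrt (show 0 ≤ 1 + supNorm σ₁ ^ 2 by positivity)
  have h7 := Real.sqrt_nonneg (1 + supNorm σ₁ ^ 2)
  generalize √(1 + supNorm σ₁ ^ 2) = r at *
  have h8 : (2 * (supNorm σ₀ + r * Γ)) ^ 2 = 4 * supNorm σ₀ ^ 2
    + 8 * (supNorm σ₀ * (r * Γ)) + 4 * ((1 + supNorm σ₁ ^ 2) * Γ ^ 2) := by rw [← h6]; ring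
  rw [h8]
  have : 0 ≤ supNorm σ₀ * (r * Γ) := by positivity
  nlinarith [sq_nonneg (supNorm σ₀), sq_nonneg Γ, sq_nonneg (supNorm σ₁ * Γ)]

end Supremum

/-! ### Bounds along one realization -/

/-- The bound for the accumulated errors of the descent inequality when all gradients have norm
at most `Γ`. -/
def errorBound (d : ℕ) (L β₁ β₂ C₀ s₀ s₁ ℓ ℓδ Γ : ℝ) : ℝ :=
  d * ((9 * (C₀ / (1 - β₁)) * (s₀ + s₁ * Γ) + 2 * L * (C₀ / (1 - β₁)) ^ 2) * ℓ
    + (C₀ * ((β₁ / (1 - β₁)) ^ 2 * (2 * (2 * (s₀ + √(1 + s₁ ^ 2) * Γ)) / β₂))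
        + L * (β₁ / (1 - β₁)) ^ 2 * C₀ ^ 2 * (1 / 2 + 2 * sigmaMax β₂ ^ 2))
      * (ℓ / (1 - β₁ / β₂))
    + Γ * (β₁ / (1 - β₁)) * √((1 - β₁) / (1 - β₁ / β₂)) * (C₀ / (1 - β₁))
    + 4 * (C₀ / (1 - β₁)) * (s₀ + s₁ * Γ) * ℓδ)

section Path

variable {d : ℕ} {β₁ β₂ C₀ ε₀ L : ℝ} {f : Vec d → ℝ}

/-- The factor `1 - β₂` in `η²` cancels the `1 / (1 - β₂)` in the uniform bound on
`discountedRatio`. -/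
lemma iterate_sub_norm_sq_le_const (h : Admissible β₁ β₂ (C₀ * √(1 - β₂)) (ε₀ * √(1 - β₂)))
    (x₁ : Vec d) (g : ℕ → Vec d) (s : ℕ) :
    ‖iterate β₁ β₂ (C₀ * √(1 - β₂)) (ε₀ * √(1 - β₂)) x₁ g (s + 1)
      - iterate β₁ β₂ (C₀ * √(1 - β₂)) (ε₀ * √(1 - β₂)) x₁ g s‖ ^ 2
      ≤ d * C₀ ^ 2 / (1 - β₁ / β₂) := by
  refine (iterate_sub_norm_sq_le h x₁ g s).trans ?_
  refine (sum_le_card_nsmul univ _ (C₀ ^ 2 / (1 - β₁ / β₂)) fun i _ => ?_).trans_eq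
    (by rw [card_fin, nsmul_eq_mul, mul_div_assoc])
  have hu := discountedRatio_le g s i h.nonneg h.lt h.lt_one h.eps_pos
  rw [mul_pow, h.sq_sqrt, le_div_iff₀ h.one_sub_ratio_pos]
  calc _ = C₀ ^ 2 * ((1 - β₁ / β₂) * ((1 - β₂)
        * discountedRatio β₁ β₂ (ε₀ * √(1 - β₂)) g s i)) := by ring
    _ ≤ C₀ ^ 2 * 1 := by gcongr
    _ = _ := mul_one _

/-- Bounded displacements and the Lipschitz gradient give at most linear growth in time. This a
priori bound is used only inside the logarithm, so its growth costs little. -/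
lemma norm_gradient_iterate_sq_le (h : Admissible β₁ β₂ (C₀ * √(1 - β₂)) (ε₀ * √(1 - β₂)))
    (hf : IsSmooth f L) (hL : 0 ≤ L) (x₁ : Vec d) (g : ℕ → Vec d) {T s : ℕ} (hs : s + 1 ≤ T) :
    ‖gradient f (iterate β₁ β₂ (C₀ * √(1 - β₂)) (ε₀ * √(1 - β₂)) x₁ g (s + 1))‖ ^ 2
      ≤ 2 * ‖gradient f x₁‖ ^ 2 + 2 * L ^ 2 * T ^ 2 * (d * C₀ ^ 2 / (1 - β₁ / β₂)) := by
  have hr0 : 0 ≤ d * C₀ ^ 2 / (1 - β₁ / β₂) :=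
    div_nonneg (by positivity) h.one_sub_ratio_pos.le
  set r := √(d * C₀ ^ 2 / (1 - β₁ / β₂)) with hr
  have hrr : r ^ 2 = d * C₀ ^ 2 / (1 - β₁ / β₂) := Real.sq_sqrt hr0
  have hrn : 0 ≤ r := Real.sqrt_nonneg _
  have hstep : ∀ s, ‖iterate β₁ β₂ (C₀ * √(1 - β₂)) (ε₀ * √(1 - β₂)) x₁ g (s + 1) - x₁‖
      ≤ s * r := by
    intro s
    induction s with
    | zero => simp [iterate]
    | succ s ih =>
      have h1 := Real.le_sqrt_of_sq_le (iterate_sub_norm_sq_le_const h x₁ g (s + 1))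
      rw [← sub_add_sub_cancel _ (iterate β₁ β₂ (C₀ * √(1 - β₂)) (ε₀ * √(1 - β₂)) x₁ g (s + 1)) x₁]
      refine (norm_add_le _ _).trans ?_
      push_cast
      linarith
  have h1 := (hf.2 (iterate β₁ β₂ (C₀ * √(1 - β₂)) (ε₀ * √(1 - β₂)) x₁ g (s + 1)) x₁).trans
    (mul_le_mul_of_nonneg_left (hstep s) hL)
  have hsT : (s : ℝ) ≤ T := by exact_mod_cast (by omega : s ≤ T)
  have h2 : ‖gradient f (iterate β₁ β₂ (C₀ * √(1 - β₂)) (ε₀ * √(1 - β₂)) x₁ g (s + 1))‖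
      ≤ ‖gradient f x₁‖ + L * (T * r) := by
    have h3 := norm_le_norm_add_norm_sub (gradient f x₁)
      (gradient f (iterate β₁ β₂ (C₀ * √(1 - β₂)) (ε₀ * √(1 - β₂)) x₁ g (s + 1)))
    rw [norm_sub_rev] at h3
    have h4 : L * (s * r) ≤ L * (T * r) := by gcongr
    linarith
  calc _ ≤ (‖gradient f x₁‖ + L * (T * r)) ^ 2 := pow_le_pow_left₀ (norm_nonneg _) h2 2
    _ ≤ 2 * ‖gradient f x₁‖ ^ 2 + 2 * (L * (T * r)) ^ 2 := by
      nlinarith [sq_nonneg (‖gradient f x₁‖ - L * (T * r))]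
    _ = _ := by rw [← hrr]; ring

/-- The logarithmic bound for the normalized squared gradients. -/
lemma sum_normSq_le_log_calF (h : Admissible β₁ β₂ (C₀ * √(1 - β₂)) (ε₀ * √(1 - β₂)))
    (hf : IsSmooth f L) (hL : 0 ≤ L) (σ₀ σ₁ x₁ : Vec d) (g : ℕ → Vec d) {T t : ℕ} (ht : t ≤ T)
    {c : ℕ → Vec d}
    (hc : ∀ s, c s = gradient f (iterate β₁ β₂ (C₀ * √(1 - β₂)) (ε₀ * √(1 - β₂)) x₁ g s))
    (hn : ∀ s ∈ Icc 1 T, ∀ i, (g s i - c s i) ^ 2 ≤ σ₀ i ^ 2 + σ₁ i ^ 2 * c s i ^ 2) (i : Fin d) :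
    (1 - β₂) * ∑ s ∈ range t, normSq β₂ (ε₀ * √(1 - β₂)) g (s + 1) i
      ≤ Real.log (calF d T L ‖gradient f x₁‖ (supNorm σ₀) (supNorm σ₁) β₁ β₂ C₀ ε₀ / β₂ ^ T) := by
  refine (sum_normSq_le_log g t i h.pos h.lt_one h.eps_pos).trans ?_
  have hv := secondMoment_nonneg g t i h.pos.le h.lt_one.le
  have hβ := h.pos
  have hε := h.eps_pos
  apply Real.log_le_log (by positivity)
  have hpow : β₂ ^ T ≤ β₂ ^ t := pow_le_pow_of_le_one hβ.le h.lt_one.le ht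
  set K := 2 * ‖gradient f x₁‖ ^ 2 + 2 * L ^ 2 * T ^ 2 * (d * C₀ ^ 2 / (1 - β₁ / β₂)) with hK
  have hgs : ∀ s ∈ Icc 1 t, g s i ^ 2 ≤ 2 * (supNorm σ₀ ^ 2 + (1 + supNorm σ₁ ^ 2) * K) := by
    intro s hs
    have hsT : s ∈ Icc 1 T := by simp only [mem_Icc] at hs ⊢; omega
    obtain ⟨r, rfl⟩ : ∃ r, s = r + 1 := ⟨s - 1, by simp only [mem_Icc] at hs; omega⟩
    have h1 := hn _ hsT i
    rw [← noiseLevel_sq] at h1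
    have h2 := sq_le_of_sq_sub_le h1
    rw [noiseLevel_sq] at h2
    have h3 := sq_apply_le_supNorm_sq σ₀ i
    have h4 := sq_apply_le_supNorm_sq σ₁ i
    have h5 := (sq_apply_le_norm_sq (c (r + 1)) i).trans
      (hc (r + 1) ▸ norm_gradient_iterate_sq_le h hf hL x₁ g (mem_Icc.1 hsT).2)
    have hK0 : 0 ≤ K := (sq_nonneg _).trans h5
    have h6 : σ₁ i ^ 2 * c (r + 1) i ^ 2 ≤ supNorm σ₁ ^ 2 * K := by gcongr
    linarith
  have hK0 : 0 ≤ K := by have := h.one_sub_ratio_pos; positivity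
  have hvt : secondMoment β₂ g t i ≤ T * (2 * (supNorm σ₀ ^ 2 + (1 + supNorm σ₁ ^ 2) * K)) := by
    refine (secondMoment_le_sum g t i hβ.le h.lt_one.le).trans ?_
    have h1 : ∑ s ∈ Icc 1 t, g s i ^ 2
        ≤ T * (2 * (supNorm σ₀ ^ 2 + (1 + supNorm σ₁ ^ 2) * K)) := by
      refine (sum_le_card_nsmul _ _ _ hgs).trans ?_
      rw [Nat.card_Icc, nsmul_eq_mul, Nat.add_sub_cancel]
      gcongr
    have h0 : 0 ≤ ∑ s ∈ Icc 1 t, g s i ^ 2 := sum_nonneg fun _ _ => sq_nonneg _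
    nlinarith
  have hle : 1 + secondMoment β₂ g t i / (ε₀ * √(1 - β₂)) ^ 2
      ≤ calF d T L ‖gradient f x₁‖ (supNorm σ₀) (supNorm σ₁) β₁ β₂ C₀ ε₀ := by
    have e : calF d T L ‖gradient f x₁‖ (supNorm σ₀) (supNorm σ₁) β₁ β₂ C₀ ε₀
        = 1 + T * (2 * (supNorm σ₀ ^ 2 + (1 + supNorm σ₁ ^ 2) * K)) / (ε₀ * √(1 - β₂)) ^ 2 := by
      unfold calF
      rw [hK]
      ring
    rw [e]
    gcongr
  exact div_le_div₀ (le_trans (by positivity) hle) hle (by positivity) hpow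

variable {σ₀ σ₁ x₁ : Vec d} {g : ℕ → Vec d} {T : ℕ} {c : ℕ → Vec d} {fstar Γ ℓδ : ℝ}

/-- The potential is bounded as long as the gradients are. -/
lemma potential_le (h : Admissible β₁ β₂ (C₀ * √(1 - β₂)) (ε₀ * √(1 - β₂))) (hf : IsSmooth f L)
    (hL : 0 ≤ L) (hΓ0 : 0 ≤ Γ)
    (hc : ∀ s, c s = gradient f (iterate β₁ β₂ (C₀ * √(1 - β₂)) (ε₀ * √(1 - β₂)) x₁ g s))
    (hn : ∀ s ∈ Icc 1 T, ∀ i, (g s i - c s i) ^ 2 ≤ σ₀ i ^ 2 + σ₁ i ^ 2 * c s i ^ 2)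
    {t : ℕ} (ht : t ≤ T) (hΓ : ∀ s ∈ Icc 1 t, ‖c s‖ ≤ Γ)
    (hconc : -∑ s ∈ range t, noiseTerm β₁ β₂ (C₀ * √(1 - β₂)) (ε₀ * √(1 - β₂)) σ₀ σ₁ (c (s + 1)) g s
      ≤ 1 / 4 * ∑ s ∈ range t,
          weightedSq β₁ β₂ (C₀ * √(1 - β₂)) (ε₀ * √(1 - β₂)) σ₀ σ₁ (c (s + 1)) g s
        + 4 * (d * (C₀ / (1 - β₁)) * (supNorm σ₀ + supNorm σ₁ * Γ)) * ℓδ) :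
    f (extrapolate β₁ β₂ (C₀ * √(1 - β₂)) (ε₀ * √(1 - β₂)) x₁ g t) - f x₁
      + 1 / 4 * ∑ s ∈ range t,
          weightedSq β₁ β₂ (C₀ * √(1 - β₂)) (ε₀ * √(1 - β₂)) σ₀ σ₁ (c (s + 1)) g s
      ≤ errorBound d L β₁ β₂ C₀ (supNorm σ₀) (supNorm σ₁)
        (Real.log (calF d T L ‖gradient f x₁‖ (supNorm σ₀) (supNorm σ₁) β₁ β₂ C₀ ε₀ / β₂ ^ T))
        ℓδ Γ := by
  have h0 := supNorm_nonneg σ₀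
  have h1 := supNorm_nonneg σ₁
  have hci : ∀ s ∈ Icc 1 t, ∀ i, |c s i| ≤ Γ := fun s hs i =>
    (abs_apply_le_norm (c s) i).trans (hΓ s hs)
  have hn' : ∀ s ∈ Icc 1 t, ∀ i, (g s i - c s i) ^ 2 ≤ σ₀ i ^ 2 + σ₁ i ^ 2 * c s i ^ 2 :=
    fun s hs => hn s (by simp only [mem_Icc] at hs ⊢; omega)
  have hM : ∀ s ∈ Icc 1 t, ∀ i, 2 * (c s i ^ 2 + noiseLevel σ₀ σ₁ (c s) i ^ 2)
      ≤ (2 * (supNorm σ₀ + √(1 + supNorm σ₁ ^ 2) * Γ)) ^ 2 := fun s hs i =>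
    sq_add_noiseLevel_sq_le σ₀ σ₁ (c s) i hΓ0 (hci s hs i)
  have key := descent_sum h hf hL σ₀ σ₁ x₁ g t hc
    (M := 2 * (supNorm σ₀ + √(1 + supNorm σ₁ ^ 2) * Γ)) (Γ := Γ)
    (S := supNorm σ₀ + supNorm σ₁ * Γ) (by positivity) hΓ0 (by positivity) hn'
    (fun s hs i => by
      have h2 := hn' s hs i
      rw [← noiseLevel_sq] at h2
      exact (sq_le_of_sq_sub_le h2).trans (hM s hs i))
    (fun s hs i => by
      have h2 : 0 ≤ c s i ^ 2 + noiseLevel σ₀ σ₁ (c s) i ^ 2 := by positivity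
      linarith [hM s hs i])
    hci (fun s hs i => noiseLevel_le σ₀ σ₁ (c s) i hΓ0 (hci s hs i))
    (fun i => sum_normSq_le_log_calF h hf hL σ₀ σ₁ x₁ g ht hc hn i)
  have hk := h.sqrt_pos
  have hk2 := h.sq_sqrt
  generalize Real.log _ = ℓ at *
  have hβ := h.one_sub_pos
  have hρ := h.one_sub_ratio_pos
  have hb := h.pos
  -- The scaling `η = C₀ √(1 - β₂)` makes every factor `√(1 - β₂)` in the summed errors cancel; `β₂`
  -- survives only through the ratios, `sigmaMax` and `ℓ`.
  have e : (d : ℝ) * ((9 * (C₀ * √(1 - β₂) / (1 - β₁)) * (√(1 - β₂) *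
          (supNorm σ₀ + supNorm σ₁ * Γ))
        + 2 * L * (C₀ * √(1 - β₂) / (1 - β₁)) ^ 2) * (ℓ / (1 - β₂))
      + (C₀ * √(1 - β₂) * ((β₁ / (1 - β₁)) ^ 2 * (2 * (√(1 - β₂) *
          (2 * (supNorm σ₀ + √(1 + supNorm σ₁ ^ 2) * Γ))) / β₂))
        + L * (β₁ / (1 - β₁)) ^ 2 * (C₀ * √(1 - β₂)) ^ 2 * (1 / 2 + 2 * sigmaMax β₂ ^ 2))
        * (ℓ / (1 - β₂) / (1 - β₁ / β₂))
      + Γ * (β₁ / (1 - β₁)) * (√((1 - β₁) / (1 - β₁ / β₂)) / √(1 - β₂))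
        * (C₀ * √(1 - β₂) / (1 - β₁)))
      + 4 * (d * (C₀ / (1 - β₁)) * (supNorm σ₀ + supNorm σ₁ * Γ)) * ℓδ
      = errorBound d L β₁ β₂ C₀ (supNorm σ₀) (supNorm σ₁) ℓ ℓδ Γ := by
    unfold errorBound
    clear key hconc h hc
    generalize √((1 - β₁) / (1 - β₁ / β₂)) = z
    generalize √(1 - β₂) = k at *
    rw [← hk2]
    generalize 1 - β₁ / β₂ = ρ at *
    field_simp
  linarith [key, hconc, e]

/-- All gradients stay bounded by `Γ`, and the weighted sum of squared gradients is bounded. -/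
lemma gradient_bounded (h : Admissible β₁ β₂ (C₀ * √(1 - β₂)) (ε₀ * √(1 - β₂)))
    (hf : IsSmooth f L) (hL : 0 < L) (hb : ∀ x, fstar ≤ f x) (hΓ0 : 0 ≤ Γ)
    (hc : ∀ s, c s = gradient f (iterate β₁ β₂ (C₀ * √(1 - β₂)) (ε₀ * √(1 - β₂)) x₁ g s))
    (hn : ∀ s ∈ Icc 1 T, ∀ i, (g s i - c s i) ^ 2 ≤ σ₀ i ^ 2 + σ₁ i ^ 2 * c s i ^ 2)
    (hconc : ∀ t ≤ T, (∀ s ∈ Icc 1 t, ‖c s‖ ≤ Γ) →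
      -∑ s ∈ range t, noiseTerm β₁ β₂ (C₀ * √(1 - β₂)) (ε₀ * √(1 - β₂)) σ₀ σ₁ (c (s + 1)) g s
      ≤ 1 / 4 * ∑ s ∈ range t,
          weightedSq β₁ β₂ (C₀ * √(1 - β₂)) (ε₀ * √(1 - β₂)) σ₀ σ₁ (c (s + 1)) g s
        + 4 * (d * (C₀ / (1 - β₁)) * (supNorm σ₀ + supNorm σ₁ * Γ)) * ℓδ)
    (hclose : 4 * L * (f x₁ - fstar + errorBound d L β₁ β₂ C₀ (supNorm σ₀) (supNorm σ₁)
        (Real.log (calF d T L ‖gradient f x₁‖ (supNorm σ₀) (supNorm σ₁) β₁ β₂ C₀ ε₀ / β₂ ^ T))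
        ℓδ Γ)
      + 2 * L ^ 2 * (β₁ / (1 - β₁)) ^ 2 * (d * C₀ ^ 2 / (1 - β₁ / β₂)) ≤ Γ ^ 2) :
    L * ∑ s ∈ range T, weightedSq β₁ β₂ (C₀ * √(1 - β₂)) (ε₀ * √(1 - β₂)) σ₀ σ₁ (c (s + 1)) g s
      ≤ Γ ^ 2 := by
  have hlast : 0 ≤ 2 * L ^ 2 * (β₁ / (1 - β₁)) ^ 2 * (d * C₀ ^ 2 / (1 - β₁ / β₂)) := by
    have := h.one_sub_ratio_pos
    positivity
  have hW : ∀ s, 0 ≤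
      weightedSq β₁ β₂ (C₀ * √(1 - β₂)) (ε₀ * √(1 - β₂)) σ₀ σ₁ (c (s + 1)) g s := fun s =>
    sum_nonneg fun i _ => mul_nonneg (stepSize_nonneg _ h.nonneg h.lt_one' h.step_pos.le)
      (div_nonneg (sq_nonneg _) (proxyDenom_pos h.eps_pos ..).le)
  -- Bootstrap: bounds up to time `t` control the potential at the extrapolated point, hence its
  -- gradient, and the Lipschitz property transfers the bound to `x_{t+1}`. The potential after `t`
  -- steps does not involve the gradient at `x_{t+1}`, so there is no circularity.
  have hall : ∀ t ≤ T, ∀ s ∈ Icc 1 t, ‖c s‖ ≤ Γ := by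
    intro t
    induction t with
    | zero => intro _ s hs; simp at hs
    | succ t ih =>
      intro ht s hs
      have ih' := ih (by omega)
      rcases (mem_Icc.1 hs).2.lt_or_eq with hlt | rfl
      · exact ih' s (mem_Icc.2 ⟨(mem_Icc.1 hs).1, by omega⟩)
      · have hp := potential_le h hf hL.le hΓ0 hc hn (show t ≤ T by omega) ih'
          (hconc t (by omega) ih')
        have hg := hf.norm_gradient_sq_le hL hb
          (extrapolate β₁ β₂ (C₀ * √(1 - β₂)) (ε₀ * √(1 - β₂)) x₁ g t)
        have hd := iterate_sub_norm_sq_le_const h x₁ g t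
        have hlip := hf.2 (iterate β₁ β₂ (C₀ * √(1 - β₂)) (ε₀ * √(1 - β₂)) x₁ g (t + 1))
          (extrapolate β₁ β₂ (C₀ * √(1 - β₂)) (ε₀ * √(1 - β₂)) x₁ g t)
        rw [extrapolate, sub_add_cancel_left, norm_neg, norm_smul,
          Real.norm_of_nonneg h.momentum_nonneg, ← extrapolate, ← hc] at hlip
        have htri := norm_le_norm_add_norm_sub (gradient f
          (extrapolate β₁ β₂ (C₀ * √(1 - β₂)) (ε₀ * √(1 - β₂)) x₁ g t)) (c (t + 1))
        rw [norm_sub_rev] at htri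
        have hsum : 0 ≤ ∑ s ∈ range t,
            weightedSq β₁ β₂ (C₀ * √(1 - β₂)) (ε₀ * √(1 - β₂)) σ₀ σ₁ (c (s + 1)) g s :=
          sum_nonneg fun s _ => hW s
        refine abs_le_of_sq_le_sq' ?_ hΓ0 |>.2
        set D := ‖iterate β₁ β₂ (C₀ * √(1 - β₂)) (ε₀ * √(1 - β₂)) x₁ g (t + 1)
          - iterate β₁ β₂ (C₀ * √(1 - β₂)) (ε₀ * √(1 - β₂)) x₁ g t‖
        set n := ‖gradient f (extrapolate β₁ β₂ (C₀ * √(1 - β₂)) (ε₀ * √(1 - β₂)) x₁ g t)‖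
        have h1 : ‖c (t + 1)‖ ^ 2 ≤ 2 * n ^ 2 + 2 * L ^ 2 * (β₁ / (1 - β₁)) ^ 2 * D ^ 2 :=
          calc ‖c (t + 1)‖ ^ 2 ≤ (n + L * (β₁ / (1 - β₁) * D)) ^ 2 :=
                pow_le_pow_left₀ (norm_nonneg _) (htri.trans (by linarith)) 2
            _ ≤ _ := by nlinarith [sq_nonneg (n - L * (β₁ / (1 - β₁) * D))]
        have h2 : 2 * L ^ 2 * (β₁ / (1 - β₁)) ^ 2 * D ^ 2
          ≤ 2 * L ^ 2 * (β₁ / (1 - β₁)) ^ 2 * (d * C₀ ^ 2 / (1 - β₁ / β₂)) := by gcongr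
        have h3 : 4 * L * (f (extrapolate β₁ β₂ (C₀ * √(1 - β₂)) (ε₀ * √(1 - β₂)) x₁ g t) - fstar)
            ≤ 4 * L * (f x₁ - fstar + errorBound d L β₁ β₂ C₀ (supNorm σ₀) (supNorm σ₁)
        (Real.log (calF d T L ‖gradient f x₁‖ (supNorm σ₀) (supNorm σ₁) β₁ β₂ C₀ ε₀ / β₂ ^ T))
        ℓδ Γ) := by
          gcongr
          linarith
        linarith
  have hp := potential_le h hf hL.le hΓ0 hc hn le_rfl (hall T le_rfl) (hconc T le_rfl (hall T le_rfl))
  have hg := hb (extrapolate β₁ β₂ (C₀ * √(1 - β₂)) (ε₀ * √(1 - β₂)) x₁ g T)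
  have h4 := mul_le_mul_of_nonneg_left (show 1 / 4 * ∑ s ∈ range T,
      weightedSq β₁ β₂ (C₀ * √(1 - β₂)) (ε₀ * √(1 - β₂)) σ₀ σ₁ (c (s + 1)) g s ≤ _ from
    le_trans (by linarith) (add_le_add_right hp (f x₁ - fstar))) (show 0 ≤ 4 * L by linarith)
  linarith

/-- The self-bounding argument for the unweighted sum of squared gradients. -/
lemma sum_sq_le_of_weighted (h : Admissible β₁ β₂ (C₀ * √(1 - β₂)) (ε₀ * √(1 - β₂)))
    (hC₀ : 0 < C₀) (hε₀ : 0 < ε₀)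
    (hn : ∀ s ∈ Icc 1 T, ∀ i, (g s i - c s i) ^ 2 ≤ σ₀ i ^ 2 + σ₁ i ^ 2 * c s i ^ 2) {P : ℝ}
    (hP : ∑ s ∈ range T, weightedSq β₁ β₂ (C₀ * √(1 - β₂)) (ε₀ * √(1 - β₂)) σ₀ σ₁ (c (s + 1)) g s
      ≤ C₀ * P) (hP0 : 0 ≤ P) :
    ∑ s ∈ Icc 1 T, ‖c s‖ ^ 2
      ≤ 2 * P * (ε₀ + 2 * √T * ‖σ₀‖) + 2 * P ^ 2 * (1 + supNorm σ₁ ^ 2) := by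
  set Z := ∑ s ∈ Icc 1 T, ‖c s‖ ^ 2 with hZ
  have hZ0 : 0 ≤ Z := sum_nonneg fun _ _ => sq_nonneg _
  -- Chosen so that every proxy denominator is at most `√(1 - β₂) (ε₀ + R)`: the past enters through
  -- `v_s ≤ (1 - β₂) ∑ g_j²`, and the current term fits into the same sum over all times.
  set R := √(2 * (T * ‖σ₀‖ ^ 2 + (1 + supNorm σ₁ ^ 2) * Z)) with hR
  have hR0 : 0 ≤ R := Real.sqrt_nonneg _
  have hk := h.sqrt_pos
  have hcS : ∀ s ∈ Icc 1 T, ∀ i, c s i ^ 2 + noiseLevel σ₀ σ₁ (c s) i ^ 2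
      ≤ ‖σ₀‖ ^ 2 + (1 + supNorm σ₁ ^ 2) * ‖c s‖ ^ 2 := by
    intro s _ i
    rw [noiseLevel_sq]
    have h1 := sq_apply_le_norm_sq σ₀ i
    have h2 := sq_apply_le_supNorm_sq σ₁ i
    have h3 := sq_apply_le_norm_sq (c s) i
    have h4 : σ₁ i ^ 2 * c s i ^ 2 ≤ supNorm σ₁ ^ 2 * ‖c s‖ ^ 2 := by gcongr
    linarith
  have ha : ∀ s < T, ∀ i, proxyDenom β₂ (ε₀ * √(1 - β₂)) σ₀ σ₁ (c (s + 1)) g s i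
      ≤ √(1 - β₂) * (ε₀ + R) := by
    intro s hs i
    have hv := secondMoment_le_sum g s i h.pos.le h.lt_one.le
    have hv0 := secondMoment_nonneg g s i h.pos.le h.lt_one.le
    have hk2 : 0 ≤ 1 - β₂ := sub_nonneg.2 h.lt_one.le
    have h1 : ∑ j ∈ Icc 1 s, g j i ^ 2 ≤ ∑ j ∈ Icc 1 s,
        2 * (‖σ₀‖ ^ 2 + (1 + supNorm σ₁ ^ 2) * ‖c j‖ ^ 2) := sum_le_sum fun j hj => by
      have hjT : j ∈ Icc 1 T := by simp only [mem_Icc] at hj ⊢; omega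
      have h2 := hn j hjT i
      rw [← noiseLevel_sq] at h2
      have := sq_le_of_sq_sub_le h2
      linarith [hcS j hjT i]
    have h3 : ∑ j ∈ Icc 1 (s + 1), 2 * (‖σ₀‖ ^ 2 + (1 + supNorm σ₁ ^ 2) * ‖c j‖ ^ 2)
        ≤ ∑ j ∈ Icc 1 T, 2 * (‖σ₀‖ ^ 2 + (1 + supNorm σ₁ ^ 2) * ‖c j‖ ^ 2) :=
      sum_le_sum_of_subset_of_nonneg (Icc_subset_Icc le_rfl hs) fun _ _ _ => by positivity
    rw [sum_Icc_succ_top (by omega)] at h3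
    have h4 : ∑ j ∈ Icc 1 T, 2 * (‖σ₀‖ ^ 2 + (1 + supNorm σ₁ ^ 2) * ‖c j‖ ^ 2)
        = 2 * (T * ‖σ₀‖ ^ 2 + (1 + supNorm σ₁ ^ 2) * Z) := by
      rw [← mul_sum, sum_add_distrib, ← mul_sum, sum_const, Nat.card_Icc, nsmul_eq_mul,
        Nat.add_sub_cancel]
    have h5 := hcS (s + 1) (by simp only [mem_Icc]; omega) i
    have h50 : 0 ≤ c (s + 1) i ^ 2 + noiseLevel σ₀ σ₁ (c (s + 1)) i ^ 2 := by positivity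
    have h6 : β₂ * secondMoment β₂ g s i
        + (1 - β₂) * (c (s + 1) i ^ 2 + noiseLevel σ₀ σ₁ (c (s + 1)) i ^ 2)
        ≤ (1 - β₂) * (2 * (T * ‖σ₀‖ ^ 2 + (1 + supNorm σ₁ ^ 2) * Z)) := by
      have h7 : β₂ * secondMoment β₂ g s i ≤ secondMoment β₂ g s i :=
        mul_le_of_le_one_left hv0 h.lt_one.le
      have h8 : ∑ j ∈ Icc 1 s, g j i ^ 2
          + (c (s + 1) i ^ 2 + noiseLevel σ₀ σ₁ (c (s + 1)) i ^ 2)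
          ≤ 2 * (T * ‖σ₀‖ ^ 2 + (1 + supNorm σ₁ ^ 2) * Z) := by linarith
      have := mul_le_mul_of_nonneg_left h8 hk2
      linarith
    have h9 := Real.sqrt_le_sqrt h6
    rw [Real.sqrt_mul hk2] at h9
    unfold proxyDenom
    linarith
  have hA : 0 < ε₀ + R := by positivity
  have hlow : C₀ * (Z / (ε₀ + R)) ≤ C₀ * P := by
    refine le_trans ?_ hP
    have e : Z = ∑ s ∈ range T, ‖c (s + 1)‖ ^ 2 := by
      rw [hZ, range_eq_Ico, sum_Ico_add' (fun s => ‖c s‖ ^ 2) 0 T 1]; rfl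
    rw [e, sum_div, mul_sum]
    refine sum_le_sum fun s hs => ?_
    rw [EuclideanSpace.real_norm_sq_eq, sum_div, mul_sum]
    refine sum_le_sum fun i _ => ?_
    have h1 := ha s (mem_range.1 hs) i
    have h2 := le_stepSize s h.nonneg h.lt_one' h.step_pos.le
    have h3 := proxyDenom_pos (β₂ := β₂) h.eps_pos σ₀ σ₁ (c (s + 1)) g s i
    calc C₀ * (c (s + 1) i ^ 2 / (ε₀ + R))
        = C₀ * √(1 - β₂) * (c (s + 1) i ^ 2 / (√(1 - β₂) * (ε₀ + R))) := by field_simp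
      _ ≤ _ := by
        have := h.step_pos
        have := stepSize_nonneg (s + 1) h.nonneg h.lt_one' h.step_pos.le
        gcongr
  have hZP : Z ≤ P * (ε₀ + R) := by
    rw [← div_le_iff₀ hA]; exact le_of_mul_le_mul_left hlow hC₀
  -- `R` grows like `√Z`, so Young's inequality leaves `Z / 2`, to be absorbed on the left of `Z ≤ P
  -- (ε₀ + R)`.
  have hRle : P * R ≤ 2 * P * (√T * ‖σ₀‖) + (Z / 2 + P ^ 2 * (1 + supNorm σ₁ ^ 2)) := by
    have h1 : R ≤ √(2 * T * ‖σ₀‖ ^ 2) + √(2 * (1 + supNorm σ₁ ^ 2) * Z) := by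
      rw [hR, show 2 * (T * ‖σ₀‖ ^ 2 + (1 + supNorm σ₁ ^ 2) * Z)
        = 2 * T * ‖σ₀‖ ^ 2 + 2 * (1 + supNorm σ₁ ^ 2) * Z by ring]
      exact sqrt_add_le_add_sqrt (by positivity) (by positivity)
    have h2 : √(2 * T * ‖σ₀‖ ^ 2) ≤ 2 * (√T * ‖σ₀‖) := by
      refine Real.sqrt_le_iff.2 ⟨by positivity, ?_⟩
      rw [mul_pow, mul_pow, Real.sq_sqrt (Nat.cast_nonneg T)]
      nlinarith [mul_nonneg (Nat.cast_nonneg (α := ℝ) T) (sq_nonneg ‖σ₀‖)]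
    have h3 := Real.sq_sqrt (show 0 ≤ 2 * (1 + supNorm σ₁ ^ 2) * Z by positivity)
    have h4 := Real.sqrt_nonneg (2 * (1 + supNorm σ₁ ^ 2) * Z)
    have h5 : P * √(2 * (1 + supNorm σ₁ ^ 2) * Z) ≤ Z / 2 + P ^ 2 * (1 + supNorm σ₁ ^ 2) := by
      refine abs_le_of_sq_le_sq' ?_ (by positivity) |>.2
      rw [mul_pow, h3]
      nlinarith [sq_nonneg (Z / 2 - P ^ 2 * (1 + supNorm σ₁ ^ 2))]
    have h6 := mul_le_mul_of_nonneg_left (h1.trans (add_le_add_left h2 _)) hP0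
    linarith
  linarith

end Path

/-! ### Concentration -/

/-- For a centered `X` with `|X| ≤ w` this gives a conditional exponential moment at most `exp (λ²
w²)` for every `λ`, with no smallness condition. For `|x| ≤ 1` it is Taylor's bound; for `x > 1` use
`x ≤ x²`; for `x < -1` use `e^x ≤ 1`. -/
lemma exp_le_add_exp_sq (x : ℝ) : Real.exp x ≤ x + Real.exp (x ^ 2) := by
  have h2 := Real.add_one_le_exp (x ^ 2)
  rcases le_or_gt |x| 1 with h | h
  · have := (abs_le.1 (Real.abs_exp_sub_one_sub_id_le h)).2
    linarith
  · rcases lt_abs.1 h with h1 | h1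
    · have := Real.exp_le_exp.2 (show x ≤ x ^ 2 by nlinarith)
      linarith
    · have := Real.exp_le_one_iff.2 (show x ≤ 0 by linarith)
      nlinarith

section Concentration

variable {Ω : Type*} {mΩ : MeasurableSpace Ω} {μ : Measure Ω} [IsProbabilityMeasure μ]
  {ℱ : Filtration ℕ mΩ} {T : ℕ} {X w : ℕ → Ω → ℝ}

/-- The exponential of a compensated sum of conditionally centered, predictably bounded
increments has integral at most one. -/
lemma integrable_exp_compensated (hX : ∀ s < T, StronglyMeasurable[ℱ (s + 1)] (X s))
    (hw : ∀ s < T, StronglyMeasurable[ℱ s] (w s))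
    (hXw : ∀ s < T, ∀ᵐ ω ∂μ, |X s ω| ≤ w s ω) (hint : ∀ s < T, Integrable (X s) μ)
    (hzero : ∀ s < T, μ[X s | ℱ s] =ᵐ[μ] 0) (lam : ℝ) :
    ∀ t ≤ T, StronglyMeasurable[ℱ t] (fun ω => Real.exp (∑ s ∈ range t,
        (lam * X s ω - lam ^ 2 * w s ω ^ 2))) ∧
      (∀ᵐ ω ∂μ, Real.exp (∑ s ∈ range t, (lam * X s ω - lam ^ 2 * w s ω ^ 2))
        ≤ Real.exp (t / 4)) ∧
      Integrable (fun ω => Real.exp (∑ s ∈ range t, (lam * X s ω - lam ^ 2 * w s ω ^ 2))) μ ∧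
      ∫ ω, Real.exp (∑ s ∈ range t, (lam * X s ω - lam ^ 2 * w s ω ^ 2)) ∂μ ≤ 1 := by
  intro t
  induction t with
  | zero =>
    intro _
    refine ⟨?_, ?_, ?_, ?_⟩
    · simpa using stronglyMeasurable_const
    · simp
    · simp
    · simp
  | succ t ih =>
    intro ht
    obtain ⟨h1, h2, h3, h4⟩ := ih (by omega)
    have htT : t < T := by omega
    set M : Ω → ℝ := fun ω => Real.exp (∑ s ∈ range t, (lam * X s ω - lam ^ 2 * w s ω ^ 2)) with hM
    have hsm : StronglyMeasurable[ℱ (t + 1)] (fun ω => Real.exp (∑ s ∈ range (t + 1),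
        (lam * X s ω - lam ^ 2 * w s ω ^ 2))) := by
      refine Real.continuous_exp.comp_stronglyMeasurable ?_
      refine Finset.stronglyMeasurable_fun_sum _ fun s hs => ?_
      have hs' : s < t + 1 := mem_range.1 hs
      exact (((hX s (by omega)).mono (ℱ.mono (by omega))).const_mul lam).sub
        ((((hw s (by omega)).mono (ℱ.mono (by omega))).pow 2).const_mul (lam ^ 2))
    -- Each summand is at most `|λ| w - (|λ| w)² ≤ 1/4`. This gives integrability although `w` need
    -- not be bounded.
    have hle : ∀ᵐ ω ∂μ, Real.exp (∑ s ∈ range (t + 1), (lam * X s ω - lam ^ 2 * w s ω ^ 2))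
        ≤ Real.exp ((t + 1 : ℕ) / 4) := by
      filter_upwards [h2, hXw t htT] with ω hω1 hω2
      rw [Real.exp_le_exp] at hω1 ⊢
      rw [sum_range_succ]
      push_cast
      have h5 : lam * X t ω ≤ |lam| * w t ω :=
        (le_abs_self _).trans (by rw [abs_mul]; gcongr)
      have h6 := sq_abs lam
      nlinarith [sq_nonneg (|lam| * w t ω - 1 / 2)]
    have hI : Integrable (fun ω => Real.exp (∑ s ∈ range (t + 1),
        (lam * X s ω - lam ^ 2 * w s ω ^ 2))) μ := by
      refine Integrable.of_bound (hsm.mono (ℱ.le _)).aestronglyMeasurable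
        (Real.exp ((t + 1 : ℕ) / 4)) ?_
      filter_upwards [hle] with ω hω
      rw [Real.norm_of_nonneg (Real.exp_pos _).le]
      exact hω
    refine ⟨hsm, hle, hI, ?_⟩
    -- The factor multiplying `X t` in the linear part of the exponential bound. It is known at time
    -- `t` and almost surely bounded, so it can be pulled out of the conditional expectation, which
    -- vanishes.
    set D : Ω → ℝ := fun ω => lam * (M ω * Real.exp (-(lam ^ 2 * w t ω ^ 2))) with hD
    have hDm : StronglyMeasurable[ℱ t] D :=
      (h1.mul (Real.continuous_exp.comp_stronglyMeasurable
        (((hw t htT).pow 2).const_mul (lam ^ 2)).neg)).const_mul lam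
    have hDb : ∀ᵐ ω ∂μ, ‖D ω‖ ≤ |lam| * (Real.exp (t / 4) * 1) := by
      filter_upwards [h2] with ω hω
      rw [Real.norm_eq_abs, abs_mul,
        abs_of_nonneg (mul_nonneg (Real.exp_pos _).le (Real.exp_pos _).le)]
      exact mul_le_mul_of_nonneg_left (mul_le_mul hω
        (Real.exp_le_one_iff.2 (neg_nonpos.2 (by positivity))) (Real.exp_pos _).le
        (Real.exp_pos _).le) (abs_nonneg _)
    have hDX : Integrable (fun ω => D ω * X t ω) μ :=
      (hint t htT).bdd_mul (hDm.mono (ℱ.le _)).aestronglyMeasurable hDb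
    have hDX0 : ∫ ω, D ω * X t ω ∂μ = 0 := by
      have h5 := condExp_stronglyMeasurable_mul_of_bound (ℱ.le t) hDm (hint t htT) _ hDb
      calc ∫ ω, D ω * X t ω ∂μ = ∫ ω, (μ[D * X t | ℱ t]) ω ∂μ := (integral_condExp (ℱ.le t)).symm
        _ = ∫ _, (0 : ℝ) ∂μ := integral_congr_ae (by
          filter_upwards [h5, hzero t htT] with ω hω1 hω2
          rw [hω1, Pi.mul_apply, hω2, Pi.zero_apply, mul_zero])
        _ = 0 := by simp
    calc ∫ ω, Real.exp (∑ s ∈ range (t + 1), (lam * X s ω - lam ^ 2 * w s ω ^ 2)) ∂μ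
        ≤ ∫ ω, (M ω + D ω * X t ω) ∂μ := by
          refine integral_mono_ae hI (h3.add hDX) ?_
          filter_upwards [hXw t htT] with ω hω
          have h5 := exp_le_add_exp_sq (lam * X t ω)
          have h6 : (lam * X t ω) ^ 2 ≤ lam ^ 2 * w t ω ^ 2 := by
            rw [mul_pow, ← sq_abs (X t ω)]; gcongr
          have h7 : Real.exp (lam * X t ω - lam ^ 2 * w t ω ^ 2)
              ≤ lam * X t ω * Real.exp (-(lam ^ 2 * w t ω ^ 2)) + 1 := by
            rw [sub_eq_add_neg, Real.exp_add]
            have h8 := mul_le_mul_of_nonneg_right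
              (h5.trans (add_le_add_right (Real.exp_le_exp.2 h6) _))
              (Real.exp_pos (-(lam ^ 2 * w t ω ^ 2))).le
            rw [add_mul, ← Real.exp_add (lam ^ 2 * w t ω ^ 2), add_neg_cancel, Real.exp_zero] at h8
            exact h8
          have h9 := mul_le_mul_of_nonneg_left h7
            (Real.exp_pos (∑ s ∈ range t, (lam * X s ω - lam ^ 2 * w s ω ^ 2))).le
          simp only [sum_range_succ, Real.exp_add]
          refine h9.trans (le_of_eq ?_)
          simp only [hM, hD]
          ring
      _ = ∫ ω, M ω ∂μ := by rw [integral_add h3 hDX, hDX0, add_zero]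
      _ ≤ 1 := h4

/-- A time-uniform Freedman-type inequality. -/
theorem measureReal_exists_sum_ge_le (hX : ∀ s < T, StronglyMeasurable[ℱ (s + 1)] (X s))
    (hw : ∀ s < T, StronglyMeasurable[ℱ s] (w s))
    (hXw : ∀ s < T, ∀ᵐ ω ∂μ, |X s ω| ≤ w s ω) (hint : ∀ s < T, Integrable (X s) μ)
    (hzero : ∀ s < T, μ[X s | ℱ s] =ᵐ[μ] 0) (hT : 1 ≤ T) (lam : ℝ) {δ : ℝ} (hδ : 0 < δ) :
    μ.real {ω | ∃ t ∈ Icc 1 T, Real.log (T / δ)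
      ≤ ∑ s ∈ range t, (lam * X s ω - lam ^ 2 * w s ω ^ 2)} ≤ δ := by
  have hT0 : (0 : ℝ) < T := by exact_mod_cast hT
  have hsub : {ω | ∃ t ∈ Icc 1 T, Real.log (T / δ)
      ≤ ∑ s ∈ range t, (lam * X s ω - lam ^ 2 * w s ω ^ 2)}
      ⊆ ⋃ t ∈ Icc 1 T, {ω | T / δ ≤ Real.exp (∑ s ∈ range t,
        (lam * X s ω - lam ^ 2 * w s ω ^ 2))} := by
    rintro ω ⟨t, ht, hω⟩
    refine Set.mem_biUnion ht ?_
    rw [Set.mem_ofPred_eq, ← Real.log_le_iff_le_exp (by positivity)]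
    exact hω
  refine (measureReal_mono hsub (measure_ne_top _ _)).trans
    ((measureReal_biUnion_finset_le _ _).trans ?_)
  -- Uniformity in time is a union bound: Markov's inequality costs `δ / T` for each of the `T`
  -- times.
  refine (sum_le_card_nsmul _ _ (δ / T) fun t ht => ?_).trans_eq ?_
  · obtain ⟨-, -, h3, h4⟩ := integrable_exp_compensated hX hw hXw hint hzero lam t (mem_Icc.1 ht).2
    have h5 := mul_meas_ge_le_integral_of_nonneg
      (Filter.Eventually.of_forall fun ω => (Real.exp_pos _).le) h3 (T / δ)
    rw [le_div_iff₀ hT0]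
    have h6 := mul_le_mul_of_nonneg_left (h5.trans h4) hδ.le
    calc _ = δ * (T / δ * μ.real {ω | T / δ ≤ Real.exp (∑ s ∈ range t,
        (lam * X s ω - lam ^ 2 * w s ω ^ 2))}) := by field_simp
      _ ≤ _ := by simpa using h6
  · rw [Nat.card_Icc, nsmul_eq_mul, Nat.add_sub_cancel]
    field_simp

end Concentration

/-! ### Measurability of the run -/

section Measurability

variable {Ω : Type*} {mΩ : MeasurableSpace Ω} {d : ℕ} {β₁ β₂ η ε : ℝ} {G : ℕ → Ω → Vec d} {s : ℕ}

lemma measurable_coord {F : Ω → Vec d} (hF : Measurable F) (i : Fin d) :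
    Measurable fun ω => F ω i :=
  (EuclideanSpace.proj (𝕜 := ℝ) i).continuous.measurable.comp hF

lemma measurable_firstMoment (hG : ∀ j ∈ Icc 1 s, Measurable (G j)) (i : Fin d) :
    Measurable fun ω => firstMoment β₁ (fun j => G j ω) s i := by
  induction s with
  | zero => exact measurable_const
  | succ s ih =>
    simp only [firstMoment_succ]
    exact ((ih fun j hj => hG j (by simp only [mem_Icc] at hj ⊢; omega)).const_mul _).add
      ((measurable_coord (hG (s + 1) (by simp)) i).const_mul _)

lemma measurable_secondMoment (hG : ∀ j ∈ Icc 1 s, Measurable (G j)) (i : Fin d) :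
    Measurable fun ω => secondMoment β₂ (fun j => G j ω) s i := by
  induction s with
  | zero => exact measurable_const
  | succ s ih =>
    simp only [secondMoment_succ]
    exact ((ih fun j hj => hG j (by simp only [mem_Icc] at hj ⊢; omega)).const_mul _).add
      (((measurable_coord (hG (s + 1) (by simp)) i).pow_const 2).const_mul _)

lemma measurable_iterate_succ (x₁ : Vec d) (hG : ∀ j ∈ Icc 1 s, Measurable (G j)) :
    Measurable fun ω => iterate β₁ β₂ η ε x₁ (fun j => G j ω) (s + 1) := by
  induction s with
  | zero => exact measurable_const
  | succ s ih =>
    have h1 := ih fun j hj => hG j (by simp only [mem_Icc] at hj ⊢; omega)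
    refine (PiLp.continuous_toLp 2 _).measurable.comp (measurable_pi_lambda _ fun i => ?_)
    refine (measurable_coord h1 i).sub (Measurable.mul ?_ (measurable_firstMoment hG i))
    exact measurable_const.div (((measurable_secondMoment hG i).sqrt).add_const _)

lemma measurable_proxyDenom {σ₀ σ₁ : Vec d} (hG : ∀ j ∈ Icc 1 s, Measurable (G j))
    {F : Ω → Vec d} (hF : Measurable F) (i : Fin d) :
    Measurable fun ω => proxyDenom β₂ ε σ₀ σ₁ (F ω) (fun j => G j ω) s i := by
  have h1 := (measurable_coord hF i).pow_const 2
  simp only [proxyDenom, noiseLevel_sq]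
  exact (((measurable_secondMoment hG i).const_mul _).add
    ((h1.add ((h1.const_mul _).const_add _)).const_mul _)).sqrt.add_const _

end Measurability

/-! ### The martingale part of the descent inequality -/

section Noise

variable {d : ℕ} {β₁ β₂ C₀ ε₀ L : ℝ} {f : Vec d → ℝ} {σ₀ σ₁ : Vec d}

lemma weightedSq_nonneg {η ε : ℝ} (h : Admissible β₁ β₂ η ε) (c : Vec d) (g : ℕ → Vec d) (s : ℕ) :
    0 ≤ weightedSq β₁ β₂ η ε σ₀ σ₁ c g s := by
  unfold weightedSq
  exact sum_nonneg fun i _ => mul_nonneg (stepSize_nonneg _ h.nonneg h.lt_one' h.step_pos.le)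
    (div_nonneg (sq_nonneg _) (proxyDenom_pos h.eps_pos ..).le)

/-- Cauchy–Schwarz over the coordinates costs the factor `d`. In each coordinate one of the two
factors `1 / a` from the squared proxy is spent on `√(1 - β₂) * noiseLevel ≤ a`, and the other
rebuilds `weightedSq`. -/
lemma noiseTerm_sq_le (h : Admissible β₁ β₂ (C₀ * √(1 - β₂)) (ε₀ * √(1 - β₂))) (hC₀ : 0 ≤ C₀)
    (c : Vec d) (g : ℕ → Vec d) (s : ℕ)
    (hn : ∀ i, (g (s + 1) i - c i) ^ 2 ≤ σ₀ i ^ 2 + σ₁ i ^ 2 * c i ^ 2) {S : ℝ}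
    (hS : ∀ i, noiseLevel σ₀ σ₁ c i ≤ S) :
    noiseTerm β₁ β₂ (C₀ * √(1 - β₂)) (ε₀ * √(1 - β₂)) σ₀ σ₁ c g s ^ 2
      ≤ d * (C₀ / (1 - β₁)) * S
        * weightedSq β₁ β₂ (C₀ * √(1 - β₂)) (ε₀ * √(1 - β₂)) σ₀ σ₁ c g s := by
  unfold noiseTerm weightedSq
  refine sq_sum_le_card_mul_sum_sq.trans ?_
  have e : d * (C₀ / (1 - β₁)) * S * ∑ i, stepSize β₁ (C₀ * √(1 - β₂)) (s + 1)
        * (c i ^ 2 / proxyDenom β₂ (ε₀ * √(1 - β₂)) σ₀ σ₁ c g s i)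
      = d * ∑ i, C₀ / (1 - β₁) * S * (stepSize β₁ (C₀ * √(1 - β₂)) (s + 1)
        * (c i ^ 2 / proxyDenom β₂ (ε₀ * √(1 - β₂)) σ₀ σ₁ c g s i)) := by
    rw [← mul_sum univ _ (C₀ / (1 - β₁) * S), mul_assoc, mul_assoc, mul_assoc]
  rw [card_fin, e]
  clear e
  refine mul_le_mul_of_nonneg_left (sum_le_sum fun i _ => ?_) (Nat.cast_nonneg d)
  have ha := proxyDenom_pos (β₂ := β₂) h.eps_pos σ₀ σ₁ c g s i
  have hst := stepSize_nonneg (s + 1) h.nonneg h.lt_one' h.step_pos.le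
  have hst2 := stepSize_le s h.nonneg h.lt_one' h.step_pos.le
  have hS0 := noiseLevel_nonneg σ₀ σ₁ c i
  have hk := h.sqrt_pos
  have hβ := h.one_sub_pos
  have hkS : √(1 - β₂) * noiseLevel σ₀ σ₁ c i
      ≤ proxyDenom β₂ (ε₀ * √(1 - β₂)) σ₀ σ₁ c g s i := by
    have h1 : √(1 - β₂) * noiseLevel σ₀ σ₁ c i ≤ √(β₂ * secondMoment β₂ g s i
        + (1 - β₂) * (c i ^ 2 + noiseLevel σ₀ σ₁ c i ^ 2)) := by
      apply Real.le_sqrt_of_sq_le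
      rw [mul_pow, h.sq_sqrt]
      have := mul_nonneg h.pos.le (secondMoment_nonneg g s i h.pos.le h.lt_one.le)
      nlinarith [mul_nonneg (sub_nonneg.2 h.lt_one.le) (sq_nonneg (c i))]
    have := h.eps_pos
    unfold proxyDenom
    linarith
  have hi := hn i
  rw [← noiseLevel_sq] at hi
  generalize proxyDenom β₂ (ε₀ * √(1 - β₂)) σ₀ σ₁ c g s i = a at *
  generalize stepSize β₁ (C₀ * √(1 - β₂)) (s + 1) = e at *
  have hSi := hS i
  generalize noiseLevel σ₀ σ₁ c i = q at *
  have h2 : e * q ^ 2 / a ≤ C₀ / (1 - β₁) * S := by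
    rw [div_le_iff₀ ha]
    calc e * q ^ 2 ≤ C₀ * √(1 - β₂) / (1 - β₁) * q ^ 2 := by gcongr
      _ = C₀ / (1 - β₁) * q * (√(1 - β₂) * q) := by ring
      _ ≤ C₀ / (1 - β₁) * S * a := by
        have := hS0.trans hSi
        gcongr
  calc (e * (c i * (g (s + 1) i - c i) / a)) ^ 2
      = e ^ 2 * c i ^ 2 * (g (s + 1) i - c i) ^ 2 / a ^ 2 := by ring
    _ ≤ e ^ 2 * c i ^ 2 * q ^ 2 / a ^ 2 := by gcongr
    _ = e * q ^ 2 / a * (e * (c i ^ 2 / a)) := by field_simp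
    _ ≤ C₀ / (1 - β₁) * S * (e * (c i ^ 2 / a)) := by gcongr
    _ = _ := by ring

variable {Ω : Type*} {mΩ : MeasurableSpace Ω} {μ : Measure Ω} [IsProbabilityMeasure μ]
  {ℱ : Filtration ℕ mΩ} {T : ℕ} {x₁ : Vec d} {g : ℕ → Ω → Vec d}

/-- With high probability the martingale part is dominated by the weighted gradient norms, as
long as the gradients stay bounded by `Γ`. -/
theorem measureReal_noise_le (h : Admissible β₁ β₂ (C₀ * √(1 - β₂)) (ε₀ * √(1 - β₂)))
    (hC₀ : 0 ≤ C₀) (hf : IsSmooth f L) {c : ℕ → Ω → Vec d}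
    (hc : ∀ s ω, c s ω = gradient f
      (iterate β₁ β₂ (C₀ * √(1 - β₂)) (ε₀ * √(1 - β₂)) x₁ (fun j => g j ω) s))
    (hr : IsOracleRun μ ℱ T f σ₀ σ₁ (fun s ω =>
      iterate β₁ β₂ (C₀ * √(1 - β₂)) (ε₀ * √(1 - β₂)) x₁ (fun j => g j ω) s) g)
    (hT : 1 ≤ T) {Γ δ : ℝ} (hΓ : 0 ≤ Γ) (hδ : 0 < δ) (hδ1 : δ < 1) :
    ∃ E : Set Ω, 1 - δ ≤ μ.real E ∧
      (∀ ω ∈ E, ∀ s ∈ Icc 1 T, ∀ i, (g s ω i - c s ω i) ^ 2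
        ≤ σ₀ i ^ 2 + σ₁ i ^ 2 * c s ω i ^ 2) ∧
      ∀ ω ∈ E, ∀ t ≤ T, (∀ s ∈ Icc 1 t, ‖c s ω‖ ≤ Γ) →
        -∑ s ∈ range t, noiseTerm β₁ β₂ (C₀ * √(1 - β₂)) (ε₀ * √(1 - β₂)) σ₀ σ₁ (c (s + 1) ω)
            (fun j => g j ω) s
          ≤ 1 / 4 * ∑ s ∈ range t, weightedSq β₁ β₂ (C₀ * √(1 - β₂)) (ε₀ * √(1 - β₂)) σ₀ σ₁
              (c (s + 1) ω) (fun j => g j ω) s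
            + 4 * (d * (C₀ / (1 - β₁)) * (supNorm σ₀ + supNorm σ₁ * Γ)) * Real.log (d * T / δ) := by
  have hs0 := supNorm_nonneg σ₀
  have hs1 := supNorm_nonneg σ₁
  have hβ := h.one_sub_pos
  set W := d * (C₀ / (1 - β₁)) * (supNorm σ₀ + supNorm σ₁ * Γ) with hW
  have hW0 : 0 ≤ W := by positivity
  have hnoise : ∀ᵐ ω ∂μ, ∀ s ∈ Icc 1 T, ∀ i, (g s ω i - c s ω i) ^ 2
        ≤ σ₀ i ^ 2 + σ₁ i ^ 2 * c s ω i ^ 2 := by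
    refine ae_all_iff.2 fun s => ?_
    by_cases hs : s ∈ Icc 1 T
    · filter_upwards [ae_all_iff.2 (hr.affine_noise s hs)] with ω hω _ i
      rw [hc]
      exact hω i
    · exact Filter.Eventually.of_forall fun ω h => absurd h hs
  have hsq : ∀ ω s, (∀ s ∈ Icc 1 T, ∀ i, (g s ω i - c s ω i) ^ 2
        ≤ σ₀ i ^ 2 + σ₁ i ^ 2 * c s ω i ^ 2) → s < T → ‖c (s + 1) ω‖ ≤ Γ →
      noiseTerm β₁ β₂ (C₀ * √(1 - β₂)) (ε₀ * √(1 - β₂)) σ₀ σ₁ (c (s + 1) ω)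
            (fun j => g j ω) s ^ 2
        ≤ W * weightedSq β₁ β₂ (C₀ * √(1 - β₂)) (ε₀ * √(1 - β₂)) σ₀ σ₁
              (c (s + 1) ω) (fun j => g j ω) s := fun ω s hω hs hΓs =>
    noiseTerm_sq_le h hC₀ (c (s + 1) ω) (fun j => g j ω) s
      (hω (s + 1) (by simp only [mem_Icc]; omega))
      fun i => noiseLevel_le σ₀ σ₁ _ i hΓ ((abs_apply_le_norm _ i).trans hΓs)
  have hQ0 : ∀ ω s, 0 ≤ weightedSq β₁ β₂ (C₀ * √(1 - β₂)) (ε₀ * √(1 - β₂)) σ₀ σ₁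
              (c (s + 1) ω) (fun j => g j ω) s := fun ω s => weightedSq_nonneg h _ _ _
  set A : Set Ω := {ω | ∀ s ∈ Icc 1 T, ∀ i, (g s ω i - c s ω i) ^ 2
        ≤ σ₀ i ^ 2 + σ₁ i ^ 2 * c s ω i ^ 2} with hA
  have hA1 : μ.real A = 1 := by
    rw [measureReal_def, measure_eq_measure_of_null_sdiff (Set.subset_univ A) (by
      rw [← Set.compl_eq_univ_sdiff]; exact hnoise), measure_univ, ENNReal.toReal_one]
  -- If `W = 0`, the choice `λ = 1 / (4W)` is meaningless, but the noise terms vanish below the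
  -- threshold, so no concentration is needed.
  rcases hW0.eq_or_lt with hWz | hWpos
  · refine ⟨A, ?_, fun ω hω => hω, fun ω hω t ht hΓt => ?_⟩
    · rw [hA1]; linarith
    · rw [← hWz]
      have h1 : ∀ s ∈ range t, noiseTerm β₁ β₂ (C₀ * √(1 - β₂)) (ε₀ * √(1 - β₂)) σ₀ σ₁
          (c (s + 1) ω) (fun j => g j ω) s = 0 := fun s hs => by
        have h2 := hsq ω s hω (by have := mem_range.1 hs; omega)
          (hΓt _ (by have := mem_range.1 hs; simp only [mem_Icc]; omega))
        rw [← hWz, zero_mul] at h2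
        exact pow_eq_zero_iff two_ne_zero |>.1 (le_antisymm h2 (sq_nonneg _))
      rw [sum_eq_zero h1]
      have := sum_nonneg fun s (_ : s ∈ range t) => hQ0 ω s
      linarith
  have hd : 1 ≤ d := by
    by_contra hd
    have : (d : ℝ) = 0 := by exact_mod_cast (by omega : d = 0)
    rw [hW, this] at hWpos
    simp at hWpos
  have hgm : ∀ s ≤ T, ∀ j ∈ Icc 1 s, Measurable[ℱ s] (g j) := fun s hs j hj =>
    ((hr.measurable j (by simp only [mem_Icc] at hj ⊢; omega)).mono
      (ℱ.mono (mem_Icc.1 hj).2)).measurable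
  have hcm : ∀ s ≤ T, Measurable[ℱ s] (c (s + 1)) := fun s hs => by
    have e : c (s + 1) = fun ω => gradient f
      (iterate β₁ β₂ (C₀ * √(1 - β₂)) (ε₀ * √(1 - β₂)) x₁ (fun j => g j ω) (s + 1)) :=
      funext fun ω => hc (s + 1) ω
    rw [e]
    exact hf.continuous_gradient.measurable.comp
      (@measurable_iterate_succ Ω (ℱ s) d β₁ β₂ _ _ g s x₁ (hgm s hs))
  -- Truncating each increment separately is enough: the indicator is known at time `s`, makes the
  -- coefficients of the noise bounded, and equals `1` at every time where the conclusion is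
  -- claimed.
  set I : ℕ → Ω → ℝ := fun s ω => if ‖c (s + 1) ω‖ ≤ Γ then 1 else 0 with hI
  have hIm : ∀ s ≤ T, Measurable[ℱ s] (I s) := fun s hs =>
    (Measurable.ite (measurableSet_le measurable_norm measurable_const) measurable_const
      measurable_const : Measurable fun v : Vec d => if ‖v‖ ≤ Γ then (1 : ℝ) else 0).comp (hcm s hs)
  set a : ℕ → Fin d → Ω → ℝ := fun s i ω =>
    proxyDenom β₂ (ε₀ * √(1 - β₂)) σ₀ σ₁ (c (s + 1) ω) (fun j => g j ω) s i with ha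
  have ham : ∀ s ≤ T, ∀ i, Measurable[ℱ s] (a s i) := fun s hs i =>
    @measurable_proxyDenom Ω (ℱ s) d β₂ _ g s σ₀ σ₁ (hgm s hs) _ (hcm s hs) i
  have hapos : ∀ s i ω, ε₀ * √(1 - β₂) ≤ a s i ω := fun s i ω => proxyDenom_ge ..
  have hε := h.eps_pos
  set D : ℕ → Fin d → Ω → ℝ := fun s i ω => -(I s ω *
    (stepSize β₁ (C₀ * √(1 - β₂)) (s + 1) * (c (s + 1) ω i / a s i ω))) with hD
  have hDm : ∀ s ≤ T, ∀ i, Measurable[ℱ s] (D s i) := fun s hs i =>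
    ((hIm s hs).mul (((measurable_coord (hcm s hs) i).div (ham s hs i)).const_mul _)).neg
  have hDb : ∀ s i ω, ‖D s i ω‖
      ≤ stepSize β₁ (C₀ * √(1 - β₂)) (s + 1) * (Γ / (ε₀ * √(1 - β₂))) := by
    intro s i ω
    have hst := stepSize_nonneg (s + 1) h.nonneg h.lt_one' h.step_pos.le
    simp only [hD, hI]
    split_ifs with hle
    · rw [norm_neg, one_mul, norm_mul, Real.norm_of_nonneg hst, norm_div, Real.norm_eq_abs,
        Real.norm_of_nonneg (hε.trans_le (hapos s i ω)).le]
      exact mul_le_mul_of_nonneg_left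
        (div_le_div₀ hΓ ((abs_apply_le_norm _ i).trans hle) hε (hapos s i ω)) hst
    · simpa using by positivity
  set ξ : ℕ → Fin d → Ω → ℝ := fun s i ω => g (s + 1) ω i - c (s + 1) ω i with hξ
  set X : ℕ → Ω → ℝ := fun s ω => ∑ i, D s i ω * ξ s i ω with hX
  have hXeq : ∀ s ω, X s ω = -(I s ω * noiseTerm β₁ β₂ (C₀ * √(1 - β₂)) (ε₀ * √(1 - β₂)) σ₀ σ₁
      (c (s + 1) ω) (fun j => g j ω) s) := by
    intro s ω
    simp only [hX, hD, hξ, noiseTerm, mul_sum, ← sum_neg_distrib]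
    refine sum_congr rfl fun i _ => ?_
    simp only [ha]
    ring
  have hmem : ∀ s < T, s + 1 ∈ Icc 1 T := fun s hs => by simp only [mem_Icc]; omega
  -- The true gradient is almost everywhere a conditional expectation, so its integrability need not
  -- be assumed.
  have hcint : ∀ s < T, Integrable (c (s + 1)) μ := fun s hs => by
    refine (integrable_condExp (m := ℱ s) (f := g (s + 1))).congr ?_
    refine (hr.unbiased (s + 1) (hmem s hs)).trans (Filter.Eventually.of_forall fun ω => ?_)
    exact (hc (s + 1) ω).symm
  have hξint : ∀ s < T, ∀ i, Integrable (ξ s i) μ := fun s hs i =>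
    ((EuclideanSpace.proj (𝕜 := ℝ) i).integrable_comp (hr.integrable _ (hmem s hs))).sub
      ((EuclideanSpace.proj (𝕜 := ℝ) i).integrable_comp (hcint s hs))
  have hξ0 : ∀ s < T, ∀ i, μ[ξ s i | ℱ s] =ᵐ[μ] 0 := by
    intro s hs i
    have h1 := (EuclideanSpace.proj (𝕜 := ℝ) i).integrable_comp (hr.integrable _ (hmem s hs))
    have h2 := (EuclideanSpace.proj (𝕜 := ℝ) i).integrable_comp (hcint s hs)
    have h3 := condExp_sub h1 h2 (ℱ s)
    have h4 := (EuclideanSpace.proj (𝕜 := ℝ) i).comp_condExp_comm (m := ℱ s)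
      (hr.integrable _ (hmem s hs))
    have h5 : μ[fun ω => EuclideanSpace.proj (𝕜 := ℝ) i (c (s + 1) ω) | ℱ s]
        = fun ω => EuclideanSpace.proj (𝕜 := ℝ) i (c (s + 1) ω) :=
      condExp_of_stronglyMeasurable (ℱ.le s)
        (measurable_coord (hcm s hs.le) i).stronglyMeasurable h2
    have h6 := hr.unbiased (s + 1) (hmem s hs)
    filter_upwards [h3, h4, h6] with ω hω3 hω4 hω6
    refine hω3.trans ?_
    rw [Pi.sub_apply, h5]
    refine (congrArg (fun z => z - EuclideanSpace.proj (𝕜 := ℝ) i (c (s + 1) ω)) hω4.symm).trans ?_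
    simp only [Function.comp_apply]
    rw [Nat.add_sub_cancel] at hω6
    rw [hω6, hc]
    simp
  have hDξint : ∀ s < T, ∀ i, Integrable (D s i * ξ s i) μ := fun s hs i =>
    (hξint s hs i).bdd_mul ((hDm s hs.le i).mono (ℱ.le s) le_rfl).aestronglyMeasurable
      (Filter.Eventually.of_forall (hDb s i))
  have hXsum : ∀ s, X s = ∑ i, D s i * ξ s i := fun s => by
    ext ω; simp [hX, Finset.sum_apply]
  -- With `w² = W * weightedSq` below the threshold and `λ = 1 / (4W)`, the compensated increment
  -- becomes `λ (-noiseTerm - weightedSq / 4)`.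
  have key := measureReal_exists_sum_ge_le (μ := μ) (ℱ := ℱ) (T := T) (X := X)
    (w := fun s ω => I s ω * √(W * weightedSq β₁ β₂ (C₀ * √(1 - β₂)) (ε₀ * √(1 - β₂)) σ₀ σ₁
              (c (s + 1) ω) (fun j => g j ω) s))
    (fun s hs => by
      have hle : ℱ s ≤ ℱ (s + 1) := ℱ.mono (Nat.le_succ s)
      refine Measurable.stronglyMeasurable (Finset.measurable_fun_sum _ fun i _ => ?_)
      exact ((hDm s hs.le i).mono hle le_rfl).mul
        ((measurable_coord (hgm (s + 1) hs (s + 1) (by simp)) i).sub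
          ((measurable_coord (hcm s hs.le) i).mono hle le_rfl)))
    (fun s hs => by
      refine Measurable.stronglyMeasurable ((hIm s hs.le).mul (Measurable.sqrt ?_))
      refine (Finset.measurable_fun_sum _ fun i _ => ?_).const_mul _
      exact (((measurable_coord (hcm s hs.le) i).pow_const 2).div (ham s hs.le i)).const_mul _)
    (fun s hs => by
      filter_upwards [hnoise] with ω hω
      rw [hXeq, abs_neg, abs_mul]
      simp only [hI]
      split_ifs with hle
      · rw [abs_one, one_mul, one_mul]
        exact Real.abs_le_sqrt (hsq ω s hω hs hle)
      · simp)
    (fun s hs => by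
      rw [hXsum]
      exact integrable_finsetSum' _ fun i _ => hDξint s hs i)
    (fun s hs => by
      rw [hXsum]
      refine (condExp_finsetSum (fun i _ => hDξint s hs i) _).trans ?_
      have h1 : ∀ i, μ[D s i * ξ s i | ℱ s] =ᵐ[μ] 0 := fun i => by
        filter_upwards [condExp_mul_of_stronglyMeasurable_left (hDm s hs.le i).stronglyMeasurable
          (hDξint s hs i) (hξint s hs i), hξ0 s hs i] with ω h1 h2
        rw [h1, Pi.mul_apply, h2, Pi.zero_apply, mul_zero]
      filter_upwards [ae_all_iff.2 h1] with ω hω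
      simp [Finset.sum_apply, hω])
    hT (1 / (4 * W)) hδ
  set B : Set Ω := {ω | ∃ t ∈ Icc 1 T, Real.log (T / δ) ≤ ∑ s ∈ range t, (1 / (4 * W) * X s ω
    - (1 / (4 * W)) ^ 2 * (I s ω * √(W * weightedSq β₁ β₂ (C₀ * √(1 - β₂)) (ε₀ * √(1 - β₂)) σ₀ σ₁
              (c (s + 1) ω) (fun j => g j ω) s)) ^ 2)} with hB
  refine ⟨A \ B, ?_, fun ω hω => hω.1, fun ω hω t ht hΓt => ?_⟩
  · have h1 := le_measureReal_sdiff (μ := μ) (s₁ := A) (s₂ := B)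
    rw [hA1] at h1
    linarith
  · have hlog : Real.log (T / δ) ≤ Real.log (d * T / δ) := by
      have hT0 : (0 : ℝ) < T := by exact_mod_cast hT
      have hd1 : (1 : ℝ) ≤ d := by exact_mod_cast hd
      apply Real.log_le_log (by positivity)
      gcongr
      nlinarith
    have hlog0 : 0 ≤ Real.log (T / δ) := by
      apply Real.log_nonneg
      rw [le_div_iff₀ hδ]
      have hT0 : (1 : ℝ) ≤ T := by exact_mod_cast hT
      linarith
    have hlt : ∑ s ∈ range t, (1 / (4 * W) * X s ω
        - (1 / (4 * W)) ^ 2 * (I s ω * √(W * weightedSq β₁ β₂ (C₀ * √(1 - β₂)) (ε₀ * √(1 - β₂)) σ₀ σ₁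
              (c (s + 1) ω) (fun j => g j ω) s)) ^ 2) ≤ Real.log (T / δ) := by
      -- The exceptional event only concerns `t ≥ 1`; for the empty sum, nonnegativity of the
      -- logarithm suffices.
      rcases Nat.eq_zero_or_pos t with rfl | htpos
      · simpa using hlog0
      · by_contra hcon
        exact hω.2 ⟨t, mem_Icc.2 ⟨htpos, ht⟩, (not_le.1 hcon).le⟩
    have heq : ∑ s ∈ range t, (1 / (4 * W) * X s ω
        - (1 / (4 * W)) ^ 2 * (I s ω * √(W * weightedSq β₁ β₂ (C₀ * √(1 - β₂)) (ε₀ * √(1 - β₂)) σ₀ σ₁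
              (c (s + 1) ω) (fun j => g j ω) s)) ^ 2)
        = ∑ s ∈ range t, 1 / (4 * W) * (-noiseTerm β₁ β₂ (C₀ * √(1 - β₂)) (ε₀ * √(1 - β₂)) σ₀ σ₁
            (c (s + 1) ω) (fun j => g j ω) s - 1 / 4 * weightedSq β₁ β₂ (C₀ * √(1 - β₂))
            (ε₀ * √(1 - β₂)) σ₀ σ₁ (c (s + 1) ω) (fun j => g j ω) s) := by
      refine sum_congr rfl fun s hs => ?_
      have hle : ‖c (s + 1) ω‖ ≤ Γ :=
        hΓt _ (by have := mem_range.1 hs; simp only [mem_Icc]; omega)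
      have hI1 : I s ω = 1 := if_pos hle
      rw [hXeq, hI1, one_mul, one_mul, Real.sq_sqrt (mul_nonneg hW0 (hQ0 ω s))]
      field_simp
    rw [heq, ← mul_sum, sum_sub_distrib, sum_neg_distrib, ← mul_sum, div_mul_eq_mul_div, one_mul,
      div_le_iff₀ (by positivity)] at hlt
    have := mul_le_mul_of_nonneg_left hlog (show 0 ≤ 4 * W by positivity)
    linarith

end Noise

/-! ### Absorbing the errors into `G` -/

section Absorb

variable {d T : ℕ} {L Δ n₁ s₀ s₁ β₁ β₂ η ε C₀ ε₀ δ : ℝ}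

lemma one_le_calF (h : Admissible β₁ β₂ η ε) : 1 ≤ calF d T L n₁ s₀ s₁ β₁ β₂ C₀ ε₀ := by
  unfold calF
  have := h.one_sub_ratio_pos
  exact le_add_of_nonneg_right (by positivity)

lemma log_calF_nonneg (h : Admissible β₁ β₂ η ε) :
    0 ≤ Real.log (calF d T L n₁ s₀ s₁ β₁ β₂ C₀ ε₀ / β₂ ^ T) := by
  apply Real.log_nonneg
  rw [le_div_iff₀ (pow_pos h.pos T), one_mul]
  exact (pow_le_one₀ h.pos.le h.lt_one.le).trans (one_le_calF h)

lemma natCast_mul_log_nonneg (d : ℕ) (hT : 1 ≤ T) (hδ : 0 < δ) (hδ1 : δ < 1) :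
    0 ≤ (d : ℝ) * Real.log (d * T / δ) := by
  rcases Nat.eq_zero_or_pos d with rfl | hd
  · simp
  · refine mul_nonneg (Nat.cast_nonneg _) (Real.log_nonneg ?_)
    rw [le_div_iff₀ hδ]
    have h1 : (1 : ℝ) ≤ d := by exact_mod_cast hd
    have h2 : (1 : ℝ) ≤ T := by exact_mod_cast hT
    nlinarith

/-- The quantity `G` dominates the sum of its nonnegative constituents, written in terms of
`κ = β₁ / (1 - β₁)` and `r = C₀ / (1 - β₁)`. -/
lemma le_bigG (h : Admissible β₁ β₂ η ε) (hL : 0 ≤ L) (hC₀ : 0 ≤ C₀) (hε₀ : 0 ≤ ε₀)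
    (hs₀ : 0 ≤ s₀) {ℓ ℓδ κ r ρ : ℝ}
    (hℓ : ℓ = Real.log (calF d T L n₁ s₀ s₁ β₁ β₂ C₀ ε₀ / β₂ ^ T))
    (hℓδ : ℓδ = Real.log (d * T / δ)) (hκ : κ = β₁ / (1 - β₁)) (hr : r = C₀ / (1 - β₁))
    (hρ : ρ = 1 - β₁ / β₂) :
    8 * L * Δ + 256 * (L * κ * √((1 - β₁) / ρ) * r * d) ^ 2 + 4 * (L ^ 2 * κ ^ 2 * C₀ ^ 2 * d / ρ)
      + 48 * (L * r * s₀ * d * ℓδ) + 32 * (L * C₀ * κ ^ 2 * s₀ / (β₂ * ρ) * d * ℓ)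
      + 4 * (L ^ 2 * C₀ ^ 2 * κ ^ 2 / ρ * d * ℓ)
      + 16 * (L ^ 2 * C₀ ^ 2 * κ ^ 2 * sigmaMax β₂ ^ 2 / ρ * d * ℓ)
      + 24 * (L ^ 2 * r ^ 2 * d * ℓ) + 64 * (L * r * s₀ * d * ℓ)
      + 2304 * (L * r * s₁ * d * ℓδ) ^ 2 + 4096 * (L * r * s₁ * d * ℓ) ^ 2
      + 2304 * (L * C₀ * κ ^ 2 * √(1 + s₁ ^ 2) / (β₂ * ρ) * d * ℓ) ^ 2
      ≤ bigG d T L Δ n₁ s₀ s₁ β₁ β₂ C₀ ε₀ δ := by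
  have hℓ0 : 0 ≤ ℓ := hℓ ▸ log_calF_nonneg h
  have hβ := h.one_sub_pos
  have hρ0 : 0 < ρ := hρ ▸ h.one_sub_ratio_pos
  have hb := h.pos
  have hq := Real.sq_sqrt (show 0 ≤ (1 - β₁) / ρ by positivity)
  have hq2 := Real.sq_sqrt (show 0 ≤ 1 + s₁ ^ 2 by positivity)
  -- This summand of `G` is not needed to absorb the errors; all the others appear exactly on the
  -- left.
  have hdrop : 0 ≤ 8 * L * C₀ * κ ^ 2 / ρ * ((ε₀ + √2 * s₀) / √β₂) * d * ℓ := by positivity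
  simp only [bigG]
  rw [← hℓ, ← hℓδ, ← hρ]
  refine (le_add_of_nonneg_right hdrop).trans (le_of_eq ?_)
  simp only [mul_pow, div_pow]
  rw [hq, hq2, hκ, hr]
  clear hq hq2 hdrop hℓ hℓδ hκ hr hρ h
  generalize (ε₀ + √2 * s₀) / √β₂ = z
  generalize 1 - β₁ = y at *
  field_simp
  ring

/-- The closure condition for the threshold `Γ = 2 √G`. -/
lemma closure_le (h : Admissible β₁ β₂ η ε) (hL : 0 ≤ L) (hC₀ : 0 ≤ C₀) (hε₀ : 0 ≤ ε₀)
    (hΔ : 0 ≤ Δ) (hs₀ : 0 ≤ s₀) (hT : 1 ≤ T) (hδ : 0 < δ) (hδ1 : δ < 1) {G : ℝ}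
    (hG : G = bigG d T L Δ n₁ s₀ s₁ β₁ β₂ C₀ ε₀ δ) :
    0 ≤ G ∧ 4 * L * (Δ + errorBound d L β₁ β₂ C₀ s₀ s₁
        (Real.log (calF d T L n₁ s₀ s₁ β₁ β₂ C₀ ε₀ / β₂ ^ T)) (Real.log (d * T / δ)) (2 * √G))
      + 2 * L ^ 2 * (β₁ / (1 - β₁)) ^ 2 * (d * C₀ ^ 2 / (1 - β₁ / β₂)) ≤ (2 * √G) ^ 2 := by
  have key := le_bigG (d := d) (T := T) (n₁ := n₁) (s₁ := s₁) (δ := δ) (Δ := Δ) h hL hC₀ hε₀ hs₀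
    rfl rfl rfl rfl rfl
  rw [← hG] at key
  have hℓ0 := log_calF_nonneg (d := d) (T := T) (L := L) (n₁ := n₁) (s₀ := s₀) (s₁ := s₁)
    (C₀ := C₀) (ε₀ := ε₀) h
  have hδ0 := natCast_mul_log_nonneg d hT hδ hδ1
  generalize Real.log (calF d T L n₁ s₀ s₁ β₁ β₂ C₀ ε₀ / β₂ ^ T) = ℓ at *
  generalize Real.log (d * T / δ) = ℓδ at *
  have hβ := h.one_sub_pos
  have hκ0 := h.momentum_nonneg
  have hρ0 := h.one_sub_ratio_pos
  have hb := h.pos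
  have hr0 : 0 ≤ C₀ / (1 - β₁) := by positivity
  -- The error is affine in `Γ`: the constant part is matched with the plain summands of `G`, the
  -- slope with its squared summands.
  have he : L * errorBound d L β₁ β₂ C₀ s₀ s₁ ℓ ℓδ (2 * √G)
      = 9 * (L * (C₀ / (1 - β₁)) * s₀ * d * ℓ) + 2 * (L ^ 2 * (C₀ / (1 - β₁)) ^ 2 * d * ℓ)
        + 4 * (L * C₀ * (β₁ / (1 - β₁)) ^ 2 * s₀ / (β₂ * (1 - β₁ / β₂)) * d * ℓ)
        + 1 / 2 * (L ^ 2 * C₀ ^ 2 * (β₁ / (1 - β₁)) ^ 2 / (1 - β₁ / β₂) * d * ℓ)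
        + 2 * (L ^ 2 * C₀ ^ 2 * (β₁ / (1 - β₁)) ^ 2 * sigmaMax β₂ ^ 2 / (1 - β₁ / β₂) * d * ℓ)
        + 4 * (L * (C₀ / (1 - β₁)) * s₀ * d * ℓδ)
        + (9 * (L * (C₀ / (1 - β₁)) * s₁ * d * ℓ)
          + 4 * (L * C₀ * (β₁ / (1 - β₁)) ^ 2 * √(1 + s₁ ^ 2) / (β₂ * (1 - β₁ / β₂)) * d * ℓ)
          + L * (β₁ / (1 - β₁)) * √((1 - β₁) / (1 - β₁ / β₂)) * (C₀ / (1 - β₁)) * d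
          + 4 * (L * (C₀ / (1 - β₁)) * s₁ * d * ℓδ)) * (2 * √G) := by
    unfold errorBound
    generalize √((1 - β₁) / (1 - β₁ / β₂)) = z
    generalize √(1 + s₁ ^ 2) = z'
    generalize √G = z''
    generalize sigmaMax β₂ = z₃
    generalize β₁ / (1 - β₁) = κ at *
    generalize C₀ / (1 - β₁) = r at *
    generalize 1 - β₁ / β₂ = ρ at *
    clear key hG hβ h hδ0
    field_simp
    ring
  rw [show 4 * L * (Δ + errorBound d L β₁ β₂ C₀ s₀ s₁ ℓ ℓδ (2 * √G))
    = 4 * L * Δ + 4 * (L * errorBound d L β₁ β₂ C₀ s₀ s₁ ℓ ℓδ (2 * √G)) by ring, he]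
  have e6 : 2 * L ^ 2 * (β₁ / (1 - β₁)) ^ 2 * (d * C₀ ^ 2 / (1 - β₁ / β₂))
      = 2 * (L ^ 2 * (β₁ / (1 - β₁)) ^ 2 * C₀ ^ 2 * d / (1 - β₁ / β₂)) := by ring
  rw [e6]
  have hLΔ : 0 ≤ L * Δ := by positivity
  have ha1 : 0 ≤ L * (C₀ / (1 - β₁)) * s₀ * d * ℓ := by positivity
  have ha2 : 0 ≤ L ^ 2 * (C₀ / (1 - β₁)) ^ 2 * d * ℓ := by positivity
  have ha3 : 0 ≤ L * C₀ * (β₁ / (1 - β₁)) ^ 2 * s₀ / (β₂ * (1 - β₁ / β₂)) * d * ℓ := by positivity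
  have ha4 : 0 ≤ L ^ 2 * C₀ ^ 2 * (β₁ / (1 - β₁)) ^ 2 / (1 - β₁ / β₂) * d * ℓ := by positivity
  have ha4' : 0 ≤ L ^ 2 * C₀ ^ 2 * (β₁ / (1 - β₁)) ^ 2 * sigmaMax β₂ ^ 2 / (1 - β₁ / β₂) * d * ℓ := by
    positivity
  have ha5 : 0 ≤ L * (C₀ / (1 - β₁)) * s₀ * d * ℓδ := by
    rw [mul_assoc _ (d : ℝ)]; positivity
  have ha6 : 0 ≤ L ^ 2 * (β₁ / (1 - β₁)) ^ 2 * C₀ ^ 2 * d / (1 - β₁ / β₂) := by positivity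
  generalize L * (C₀ / (1 - β₁)) * s₀ * d * ℓ = a1 at *
  generalize L ^ 2 * (C₀ / (1 - β₁)) ^ 2 * d * ℓ = a2 at *
  generalize L * C₀ * (β₁ / (1 - β₁)) ^ 2 * s₀ / (β₂ * (1 - β₁ / β₂)) * d * ℓ = a3 at *
  generalize L ^ 2 * C₀ ^ 2 * (β₁ / (1 - β₁)) ^ 2 / (1 - β₁ / β₂) * d * ℓ = a4 at *
  generalize L ^ 2 * C₀ ^ 2 * (β₁ / (1 - β₁)) ^ 2 * sigmaMax β₂ ^ 2 / (1 - β₁ / β₂) * d * ℓ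
    = a4' at *
  generalize L * (C₀ / (1 - β₁)) * s₀ * d * ℓδ = a5 at *
  generalize L ^ 2 * (β₁ / (1 - β₁)) ^ 2 * C₀ ^ 2 * d / (1 - β₁ / β₂) = a6 at *
  generalize L * (C₀ / (1 - β₁)) * s₁ * d * ℓ = e1 at *
  generalize L * C₀ * (β₁ / (1 - β₁)) ^ 2 * √(1 + s₁ ^ 2) / (β₂ * (1 - β₁ / β₂)) * d * ℓ = e2 at *
  generalize L * (β₁ / (1 - β₁)) * √((1 - β₁) / (1 - β₁ / β₂)) * (C₀ / (1 - β₁)) * d = e3 at *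
  generalize L * (C₀ / (1 - β₁)) * s₁ * d * ℓδ = e4 at *
  clear he e6
  have hG0 : 0 ≤ G := by
    linarith [sq_nonneg e1, sq_nonneg e2, sq_nonneg e3, sq_nonneg e4]
  refine ⟨hG0, ?_⟩
  have hGG : √G ^ 2 = G := Real.sq_sqrt hG0
  have hsq : (9 * e1 + 4 * e2 + e3 + 4 * e4) ^ 2
      ≤ 4 * (81 * e1 ^ 2 + 16 * e2 ^ 2 + e3 ^ 2 + 16 * e4 ^ 2) := by
    linarith [sq_nonneg (9 * e1 - 4 * e2), sq_nonneg (9 * e1 - e3), sq_nonneg (9 * e1 - 4 * e4),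
      sq_nonneg (4 * e2 - e3), sq_nonneg (4 * e2 - 4 * e4), sq_nonneg (e3 - 4 * e4)]
  -- Of the available `Γ² = 4G`, Young's inequality spends `2G`; the lower bound `key` on the other
  -- `2G` covers the squared slope and the constant part.
  have h1 : (9 * e1 + 4 * e2 + e3 + 4 * e4) * (4 * (2 * √G))
      ≤ 8 * (9 * e1 + 4 * e2 + e3 + 4 * e4) ^ 2 + 2 * √G ^ 2 := by
    linarith [sq_nonneg (2 * (9 * e1 + 4 * e2 + e3 + 4 * e4) - √G),
      sq_nonneg ((9 * e1 + 4 * e2 + e3 + 4 * e4)), sq_nonneg (√G)]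
  rw [mul_pow, hGG]
  rw [hGG] at h1
  linarith [sq_nonneg e1, sq_nonneg e2, sq_nonneg e3, sq_nonneg e4]

end Absorb

/-! ### The high-probability bound. -/

namespace Setting

variable {d : ℕ} {Ω : Type*} {mΩ : MeasurableSpace Ω} {μ : Measure Ω}
  {ℱ : Filtration ℕ mΩ} {T : ℕ} {f : Vec d → ℝ} {fstar L : ℝ} {σ₀ σ₁ : Vec d}
  {β₁ β₂ C₀ ε₀ : ℝ} {x₁ : Vec d} {g : ℕ → Ω → Vec d} {δ G : ℝ}

lemma admissible (hs : Setting μ ℱ T f fstar L σ₀ σ₁ β₁ β₂ C₀ ε₀ x₁ g) :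
    Admissible β₁ β₂ (C₀ * √(1 - β₂)) (ε₀ * √(1 - β₂)) := by
  have hk : 0 < √(1 - β₂) := Real.sqrt_pos.2 (sub_pos.2 hs.β₂_lt_one)
  exact ⟨hs.β₁_nonneg, hs.β₁_lt_β₂, hs.β₂_lt_one, mul_pos hs.C₀_pos hk, mul_pos hs.ε₀_pos hk⟩

/-- The high-probability bound on the averaged squared gradient norm, with an explicit constant. -/
theorem one_sub_le_measureReal_avgSqGrad_le [IsProbabilityMeasure μ]
    (hs : Setting μ ℱ T f fstar L σ₀ σ₁ β₁ β₂ C₀ ε₀ x₁ g) (hT : 1 ≤ T) (hδ : 0 < δ) (hδ1 : δ < 1)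
    (hG : G = bigG d T L (f x₁ - fstar) ‖gradient f x₁‖ (supNorm σ₀) (supNorm σ₁)
      β₁ β₂ C₀ ε₀ δ) :
    0 ≤ G ∧ 1 - δ ≤ μ.real {ω | avgSqGrad T f β₁ β₂ C₀ ε₀ x₁ (fun s => g s ω)
      ≤ 32 * (G / (T * (L * C₀)) * (ε₀ + G * (1 + supNorm σ₁ ^ 2) / (L * C₀))
          + 1 / √(T : ℝ) * (G * ‖σ₀‖ / (L * C₀)))} := by
  have h := hs.admissible
  have hL := hs.L_pos
  have hC := hs.C₀_pos
  have hε := hs.ε₀_pos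
  obtain ⟨hG0, hclose⟩ := closure_le (d := d) h hL.le hC.le hε.le
    (sub_nonneg.2 (hs.bounded_below x₁)) (supNorm_nonneg σ₀) hT hδ hδ1 hG
  refine ⟨hG0, ?_⟩
  obtain ⟨E, hE, hnoise, hconc⟩ := measureReal_noise_le (Γ := 2 * √G) h hC.le hs.smooth
    (fun _ _ => rfl) hs.oracle hT (by positivity) hδ hδ1
  refine hE.trans (measureReal_mono (fun ω hω => ?_) (measure_ne_top _ _))
  have hbd := gradient_bounded (g := fun j => g j ω) h hs.smooth hL hs.bounded_below (by positivity)
    (fun _ => rfl) (hnoise ω hω) (hconc ω hω) hclose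
  have hT0 : (0 : ℝ) < T := by exact_mod_cast hT
  have hP : (2 * √G) ^ 2 = 4 * G := by rw [mul_pow, Real.sq_sqrt hG0]; norm_num
  have hsum := sum_sq_le_of_weighted (g := fun j => g j ω) (P := 4 * G / (L * C₀)) h hC hε
    (hnoise ω hω) (by
      rw [hP] at hbd
      refine ((le_div_iff₀' hL).2 hbd).trans (le_of_eq ?_)
      field_simp) (by positivity)
  rw [Set.mem_ofPred_eq]
  unfold avgSqGrad
  refine (mul_le_mul_of_nonneg_left hsum (by positivity)).trans ?_
  have hsT : √(T : ℝ) ^ 2 = T := Real.sq_sqrt hT0.le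
  have hsT0 : 0 < √(T : ℝ) := Real.sqrt_pos.2 hT0
  generalize √(T : ℝ) = q at *
  rw [← hsT]
  -- The three terms carry the coefficients `8`, `32`, `16`; their maximum `32 = 2 * 4²` is the
  -- universal constant.
  have e1 : 1 / q ^ 2 * (2 * (4 * G / (L * C₀)) * (ε₀ + 2 * q * ‖σ₀‖)
      + 2 * (4 * G / (L * C₀)) ^ 2 * (1 + supNorm σ₁ ^ 2))
      = 8 * (G / (q ^ 2 * (L * C₀)) * ε₀)
        + 32 * (G / (q ^ 2 * (L * C₀)) * (G * (1 + supNorm σ₁ ^ 2) / (L * C₀)))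
        + 16 * (1 / q * (G * ‖σ₀‖ / (L * C₀))) := by
    field_simp
    ring
  rw [e1]
  have h1 : 0 ≤ G / (q ^ 2 * (L * C₀)) * ε₀ := by positivity
  have h2 : 0 ≤ 1 / q * (G * ‖σ₀‖ / (L * C₀)) := by positivity
  linarith

end Setting

/-! ### The noise-adaptive rate -/

section Rate

/-- `1 - β₁ / (1 - 1/T)` increases with `T`, so its value at the smallest admissible integer is a
uniform bound. This keeps `K` independent of `T`. -/
lemma exists_pos_le_one_sub_ratio {β₁ : ℝ} (h₀ : 0 ≤ β₁) (h₁ : β₁ < 1) :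
    ∃ ρ : ℝ, 0 < ρ ∧ ∀ T : ℕ, 2 ≤ T → β₁ < 1 - 1 / (T : ℝ) → ρ ≤ 1 - β₁ / (1 - 1 / (T : ℝ)) := by
  have hex : ∃ n : ℕ, 2 ≤ n ∧ β₁ < 1 - 1 / (n : ℝ) := by
    obtain ⟨n, hn⟩ := exists_nat_gt (1 / (1 - β₁))
    have hβ : 0 < 1 - β₁ := sub_pos.2 h₁
    have hn0 : (0 : ℝ) < n := lt_trans (by positivity) hn
    refine ⟨n + 2, by omega, ?_⟩
    rw [div_lt_iff₀ hβ] at hn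
    push_cast
    rw [lt_sub_comm, div_lt_iff₀ (by positivity)]
    nlinarith
  classical
  obtain ⟨hN2, hN⟩ := Nat.find_spec hex
  set N := Nat.find hex
  have hpos : 0 < 1 - 1 / (N : ℝ) := h₀.trans_lt hN
  refine ⟨1 - β₁ / (1 - 1 / (N : ℝ)), sub_pos.2 ((div_lt_one hpos).2 hN), fun T hT2 hT => ?_⟩
  have hNT : N ≤ T := Nat.find_min' hex ⟨hT2, hT⟩
  have hN0 : (0 : ℝ) < N := by exact_mod_cast (by omega : 0 < N)
  gcongr

variable {d T : ℕ} {L Δ n₁ s₀ s₁ β₁ β₂ C₀ ε₀ δ S₀ S₁ ρ : ℝ}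

/-- The cubic term gains one more power of `T` from `ε² = ε₀² / T`. -/
lemma calF_le_mul_pow (hρ : 0 < ρ) (hT : 2 ≤ T) (hβ₂ : β₂ = 1 - 1 / (T : ℝ))
    (hρle : ρ ≤ 1 - β₁ / β₂) (hε₀ : 0 < ε₀)
    (hn₁ : n₁ ^ 2 ≤ 2 * L * Δ) (h0 : 0 ≤ s₀) (h1 : 0 ≤ s₁) (hs₀ : s₀ ≤ S₀) (hs₁ : s₁ ≤ S₁) :
    calF d T L n₁ s₀ s₁ β₁ β₂ C₀ ε₀ ≤
      (1 + 2 / ε₀ ^ 2 * ((S₀ ^ 2 + 2 * (1 + S₁ ^ 2) * (2 * L * Δ))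
        + 2 * (1 + S₁ ^ 2) * d * L ^ 2 * C₀ ^ 2 / ρ)) * T ^ 4 := by
  have hT1 : (1 : ℝ) ≤ T := by exact_mod_cast (by omega : 1 ≤ T)
  have hT0 : (0 : ℝ) < T := by linarith
  have hk : 1 - β₂ = 1 / T := by rw [hβ₂]; ring
  have hsq : (ε₀ * √(1 - β₂)) ^ 2 = ε₀ ^ 2 / T := by
    rw [mul_pow, hk, Real.sq_sqrt (by positivity)]; ring
  have hΔ0 : 0 ≤ 2 * L * Δ := (sq_nonneg _).trans hn₁
  have hρ' : 0 < 1 - β₁ / β₂ := hρ.trans_le hρle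
  unfold calF
  rw [hsq]
  have hA : (s₀ ^ 2 + 2 * (1 + s₁ ^ 2) * n₁ ^ 2) * T
      ≤ (S₀ ^ 2 + 2 * (1 + S₁ ^ 2) * (2 * L * Δ)) * T ^ 3 := by
    have : (T : ℝ) ≤ T ^ 3 := le_self_pow₀ hT1 (by norm_num)
    gcongr
  have hB : 2 * (1 + s₁ ^ 2) * d * L ^ 2 * C₀ ^ 2 / (1 - β₁ / β₂) * T ^ 3
      ≤ 2 * (1 + S₁ ^ 2) * d * L ^ 2 * C₀ ^ 2 / ρ * T ^ 3 := by gcongr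
  have h2 := mul_le_mul_of_nonneg_left (add_le_add hA hB)
    (show 0 ≤ 2 / (ε₀ ^ 2 / (T : ℝ)) by positivity)
  have h3 : (1 : ℝ) ≤ T ^ 4 := one_le_pow₀ hT1
  refine (add_le_add h3 h2).trans (le_of_eq ?_)
  field_simp

/-- The power contributes only `-T log β₂ ≤ T (1 / β₂ - 1) = 1 / β₂ ≤ 2`. Additive constants are
turned into multiples of `lam` by `lam ≥ log 2`. -/
lemma log_calF_le (hT : 2 ≤ T) (hβ₂ : β₂ = 1 - 1 / (T : ℝ)) {A lam : ℝ}
    (hF0 : 0 < calF d T L n₁ s₀ s₁ β₁ β₂ C₀ ε₀) (hA : 1 ≤ A)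
    (hF : calF d T L n₁ s₀ s₁ β₁ β₂ C₀ ε₀ ≤ A * T ^ 4) (hlam : Real.log T ≤ lam)
    (hlam2 : Real.log 2 ≤ lam) :
    Real.log (calF d T L n₁ s₀ s₁ β₁ β₂ C₀ ε₀ / β₂ ^ T)
      ≤ (4 + (Real.log A + 2) / Real.log 2) * lam := by
  have hT2 : (2 : ℝ) ≤ T := by exact_mod_cast hT
  have hT0 : (0 : ℝ) < T := by linarith
  have hb : 0 < β₂ := by
    rw [hβ₂, sub_pos, div_lt_one hT0]; linarith
  have hlog2 : 0 < Real.log 2 := Real.log_pos one_lt_two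
  rw [Real.log_div hF0.ne' (by positivity), Real.log_pow]
  have h1 : Real.log (calF d T L n₁ s₀ s₁ β₁ β₂ C₀ ε₀) ≤ Real.log A + 4 * Real.log T := by
    refine (Real.log_le_log hF0 hF).trans_eq ?_
    rw [Real.log_mul (by positivity) (by positivity), Real.log_pow]
    norm_num
  have h2 : -(T * Real.log β₂) ≤ 2 := by
    have h3 := Real.one_sub_inv_le_log_of_pos hb
    have h4 : T * (β₂⁻¹ - 1) ≤ 2 := by
      have e : β₂ * T = T - 1 := by rw [hβ₂]; field_simp
      rw [inv_eq_one_div, div_sub_one hb.ne', ← mul_div_assoc, div_le_iff₀ hb]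
      have : T * (1 - β₂) = 1 := by rw [hβ₂]; field_simp; ring
      rw [this]
      nlinarith
    nlinarith
  have h5 : Real.log A + 2 ≤ (Real.log A + 2) / Real.log 2 * lam := by
    rw [div_mul_eq_mul_div, le_div_iff₀ hlog2]
    exact mul_le_mul_of_nonneg_left hlam2 (by linarith [Real.log_nonneg hA])
  linarith

lemma log_dim_nonneg (d : ℕ) (hT : 1 ≤ T) (hδ : 0 < δ) (hδ1 : δ < 1) :
    0 ≤ Real.log (d * T / δ) := by
  rcases Nat.eq_zero_or_pos d with rfl | hd
  · simp
  · exact (mul_nonneg_iff_of_pos_left (by exact_mod_cast hd)).1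
      (natCast_mul_log_nonneg d hT hδ hδ1)

lemma log_dim_le (d : ℕ) (hT : 1 ≤ T) (hδ : 0 < δ) {lam : ℝ} (hlam : lam = Real.log (T / δ))
    (hlam2 : Real.log 2 ≤ lam) :
    Real.log (d * T / δ) ≤ (1 + Real.log (d + 1) / Real.log 2) * lam := by
  have hlog2 : 0 < Real.log 2 := Real.log_pos one_lt_two
  have hT0 : (0 : ℝ) < T := by exact_mod_cast hT
  have hd0 : 0 ≤ Real.log ((d : ℝ) + 1) := Real.log_nonneg (by simp)
  rcases Nat.eq_zero_or_pos d with rfl | hd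
  · simp only [Nat.cast_zero, zero_mul, zero_div, Real.log_zero, zero_add, Real.log_one, add_zero,
      one_mul]
    linarith
  · have hdp : (0 : ℝ) < d := by exact_mod_cast hd
    rw [mul_div_assoc, Real.log_mul hdp.ne' (by positivity), ← hlam]
    have h1 : Real.log d ≤ Real.log (d + 1) := Real.log_le_log hdp (by linarith)
    have h2 : Real.log ((d : ℝ) + 1) ≤ Real.log (d + 1) / Real.log 2 * lam := by
      rw [div_mul_eq_mul_div, le_div_iff₀ hlog2]
      exact mul_le_mul_of_nonneg_left hlam2 hd0
    linarith

lemma sigmaMax_le_one (h : 1 / 2 ≤ β₂) : sigmaMax β₂ ≤ 1 := by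
  refine max_le le_rfl ?_
  have hb : 0 < β₂ := by linarith
  have : √((1 + β₂) / β₂) ≤ 2 := by
    refine Real.sqrt_le_iff.2 ⟨by norm_num, ?_⟩
    rw [div_le_iff₀ hb]
    linarith
  linarith

/-- `G` is at most quadratic in the logarithmic factors. -/
lemma bigG_le_mul_sq {lam K₁ K₂ Δ₀ m : ℝ} (hρ : 0 < ρ) (hρle : ρ ≤ 1 - β₁ / β₂)
    (hβ₁' : β₁ < 1) (hβ₂ : 1 / 2 ≤ β₂) (hL : 0 < L) (hC₀ : 0 < C₀)
    (hε₀ : 0 < ε₀) (h0 : 0 ≤ s₀) (h1 : 0 ≤ s₁) (hs₀ : s₀ ≤ S₀) (hs₁ : s₁ ≤ S₁) (hΔ : Δ₀ ≤ Δ)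
    (hΔ0 : 0 ≤ Δ₀) (hm : 1 ≤ m * lam)
    (hℓ0 : 0 ≤ Real.log (calF d T L n₁ s₀ s₁ β₁ β₂ C₀ ε₀ / β₂ ^ T))
    (hℓ : Real.log (calF d T L n₁ s₀ s₁ β₁ β₂ C₀ ε₀ / β₂ ^ T) ≤ K₁ * lam)
    (hℓδ0 : 0 ≤ Real.log (d * T / δ)) (hℓδ : Real.log (d * T / δ) ≤ K₂ * lam) :
    bigG d T L Δ₀ n₁ s₀ s₁ β₁ β₂ C₀ ε₀ δ ≤
      ((8 * L * Δ + 256 * L ^ 2 * C₀ ^ 2 * β₁ ^ 2 * d ^ 2 / ((1 - β₁) ^ 3 * ρ)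
          + 4 * L ^ 2 * C₀ ^ 2 * β₁ ^ 2 * d / ((1 - β₁) ^ 2 * ρ)) * m ^ 2
        + (48 * L * C₀ * S₀ / (1 - β₁) * d * K₂
          + 8 * L * C₀ * β₁ ^ 2 / ((1 - β₁) ^ 2 * ρ)
            * (4 * S₀ / (1 / 2) + (ε₀ + √2 * S₀) / (1 / 2) + L * C₀ / 2 * (1 + 4 * 1 ^ 2)) * d * K₁
          + 8 * (3 * L ^ 2 * C₀ ^ 2 / (1 - β₁) ^ 2 + 8 * L * S₀ * C₀ / (1 - β₁)) * d * K₁) * m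
        + 2304 * L ^ 2 * C₀ ^ 2 * S₁ ^ 2 / (1 - β₁) ^ 2 * d ^ 2 * K₂ ^ 2
        + 256 * (16 * L ^ 2 * C₀ ^ 2 * S₁ ^ 2 / (1 - β₁) ^ 2
            + 9 * L ^ 2 * C₀ ^ 2 * β₁ ^ 4 * (1 + S₁ ^ 2)
              / ((1 / 2) ^ 2 * (1 - β₁) ^ 4 * ρ ^ 2)) * d ^ 2 * K₁ ^ 2) * lam ^ 2 := by
  have hsig := sigmaMax_le_one hβ₂
  have hsig0 : 0 ≤ sigmaMax β₂ := zero_le_one.trans (one_le_sigmaMax β₂)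
  have hsq : 1 / 2 ≤ √β₂ := Real.le_sqrt_of_sq_le (by linarith)
  have hβ : 0 < 1 - β₁ := sub_pos.2 hβ₁'
  simp only [bigG]
  have hS₀ : 0 ≤ S₀ := h0.trans hs₀
  have hS₁ : 0 ≤ S₁ := h1.trans hs₁
  have hΔ1 : 0 ≤ Δ := hΔ0.trans hΔ
  generalize Real.log (calF d T L n₁ s₀ s₁ β₁ β₂ C₀ ε₀ / β₂ ^ T) = ℓ at *
  generalize Real.log (d * T / δ) = ℓδ at *
  generalize sigmaMax β₂ = z at *
  generalize √β₂ = q at *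
  generalize 1 - β₁ / β₂ = ρ' at *
  generalize 1 - β₁ = y at *
  have hK₁ : 0 ≤ K₁ * lam := hℓ0.trans hℓ
  have hK₂ : 0 ≤ K₂ * lam := hℓδ0.trans hℓδ
  have hρ' : 0 < ρ' := hρ.trans_le hρle
  have hq : 0 < q := by linarith
  have hb : 0 < β₂ := by linarith
  calc _ ≤ 8 * L * Δ
    + 256 * L ^ 2 * C₀ ^ 2 * β₁ ^ 2 * d ^ 2 / (y ^ 3 * ρ)
    + 4 * L ^ 2 * C₀ ^ 2 * β₁ ^ 2 * d / (y ^ 2 * ρ)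
    + 48 * L * C₀ * S₀ / y * d * (K₂ * lam)
    + 8 * L * C₀ * β₁ ^ 2 / (y ^ 2 * ρ)
        * (4 * S₀ / (1 / 2) + (ε₀ + √2 * S₀) / (1 / 2) + L * C₀ / 2 * (1 + 4 * 1 ^ 2))
        * d * (K₁ * lam)
    + 8 * (3 * L ^ 2 * C₀ ^ 2 / y ^ 2 + 8 * L * S₀ * C₀ / y) * d * (K₁ * lam)
    + 2304 * L ^ 2 * C₀ ^ 2 * S₁ ^ 2 / y ^ 2 * d ^ 2 * (K₂ * lam) ^ 2
    + 256 * (16 * L ^ 2 * C₀ ^ 2 * S₁ ^ 2 / y ^ 2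
        + 9 * L ^ 2 * C₀ ^ 2 * β₁ ^ 4 * (1 + S₁ ^ 2)
          / ((1 / 2) ^ 2 * y ^ 4 * ρ ^ 2)) * d ^ 2 * (K₁ * lam) ^ 2 := by
        gcongr
    _ = (8 * L * Δ + 256 * L ^ 2 * C₀ ^ 2 * β₁ ^ 2 * d ^ 2 / (y ^ 3 * ρ)
          + 4 * L ^ 2 * C₀ ^ 2 * β₁ ^ 2 * d / (y ^ 2 * ρ)) * 1
        + (48 * L * C₀ * S₀ / y * d * (K₂ * lam)
          + 8 * L * C₀ * β₁ ^ 2 / (y ^ 2 * ρ)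
            * (4 * S₀ / (1 / 2) + (ε₀ + √2 * S₀) / (1 / 2) + L * C₀ / 2 * (1 + 4 * 1 ^ 2))
              * d * (K₁ * lam)
          + 8 * (3 * L ^ 2 * C₀ ^ 2 / y ^ 2 + 8 * L * S₀ * C₀ / y) * d * (K₁ * lam)) * 1
        + 2304 * L ^ 2 * C₀ ^ 2 * S₁ ^ 2 / y ^ 2 * d ^ 2 * (K₂ * lam) ^ 2
        + 256 * (16 * L ^ 2 * C₀ ^ 2 * S₁ ^ 2 / y ^ 2
            + 9 * L ^ 2 * C₀ ^ 2 * β₁ ^ 4 * (1 + S₁ ^ 2)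
              / ((1 / 2) ^ 2 * y ^ 4 * ρ ^ 2)) * d ^ 2 * (K₁ * lam) ^ 2 := by ring
    -- Homogenization: since `m * lam ≥ 1`, constant and linear terms are raised to degree two in
    -- `lam`.
    _ ≤ (8 * L * Δ + 256 * L ^ 2 * C₀ ^ 2 * β₁ ^ 2 * d ^ 2 / (y ^ 3 * ρ)
          + 4 * L ^ 2 * C₀ ^ 2 * β₁ ^ 2 * d / (y ^ 2 * ρ)) * (m * lam) ^ 2
        + (48 * L * C₀ * S₀ / y * d * (K₂ * lam)
          + 8 * L * C₀ * β₁ ^ 2 / (y ^ 2 * ρ)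
            * (4 * S₀ / (1 / 2) + (ε₀ + √2 * S₀) / (1 / 2) + L * C₀ / 2 * (1 + 4 * 1 ^ 2))
              * d * (K₁ * lam)
          + 8 * (3 * L ^ 2 * C₀ ^ 2 / y ^ 2 + 8 * L * S₀ * C₀ / y) * d * (K₁ * lam)) * (m * lam)
        + 2304 * L ^ 2 * C₀ ^ 2 * S₁ ^ 2 / y ^ 2 * d ^ 2 * (K₂ * lam) ^ 2
        + 256 * (16 * L ^ 2 * C₀ ^ 2 * S₁ ^ 2 / y ^ 2
            + 9 * L ^ 2 * C₀ ^ 2 * β₁ ^ 4 * (1 + S₁ ^ 2)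
              / ((1 / 2) ^ 2 * y ^ 4 * ρ ^ 2)) * d ^ 2 * (K₁ * lam) ^ 2 := by
        have : 1 ≤ (m * lam) ^ 2 := one_le_pow₀ hm
        gcongr
    _ = _ := by ring

/-- The passage from a bound on `G` to the rate. -/
lemma rate_le {G K₃ lam m σ : ℝ} (hG : 0 ≤ G) (hGle : G ≤ K₃ * lam ^ 2) (hL : 0 < L)
    (hC₀ : 0 < C₀) (hε₀ : 0 < ε₀) (h1 : 0 ≤ s₁) (hs₁ : s₁ ≤ S₁) (hm : 1 ≤ m * lam)
    (hσ : 0 ≤ σ) (hK₃ : 0 ≤ K₃) (hT : 1 ≤ T) :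
    32 * (G / (T * (L * C₀)) * (ε₀ + G * (1 + s₁ ^ 2) / (L * C₀))
        + 1 / √(T : ℝ) * (G * σ / (L * C₀)))
      ≤ (32 / (L * C₀) * (K₃ * m ^ 2 * ε₀ + K₃ ^ 2 * (1 + S₁ ^ 2) / (L * C₀) + K₃ * m ^ 2) + 1)
        * lam ^ 4 * (1 / (T : ℝ) + σ / √(T : ℝ)) := by
  have hT0 : (0 : ℝ) < T := by exact_mod_cast hT
  have hmm : 1 ≤ (m * lam) ^ 2 := one_le_pow₀ hm
  have hS₁ : 0 ≤ S₁ := h1.trans hs₁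
  -- The terms linear in `G` are only of order `lam²`; they are lifted to the order `lam⁴` dictated
  -- by `G²`.
  have hGm : G ≤ K₃ * m ^ 2 * lam ^ 4 := by
    refine hGle.trans ?_
    calc K₃ * lam ^ 2 = K₃ * lam ^ 2 * 1 := (mul_one _).symm
      _ ≤ K₃ * lam ^ 2 * (m * lam) ^ 2 := by gcongr
      _ = _ := by ring
  have hGG : G * G ≤ K₃ ^ 2 * lam ^ 4 :=
    calc G * G ≤ (K₃ * lam ^ 2) * (K₃ * lam ^ 2) := by gcongr
      _ = _ := by ring
  have ha : 32 * (G * ε₀ / (L * C₀) * (1 / (T : ℝ)))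
      ≤ 32 / (L * C₀) * (K₃ * m ^ 2 * ε₀) * lam ^ 4 * (1 / (T : ℝ)) :=
    calc _ ≤ 32 * ((K₃ * m ^ 2 * lam ^ 4) * ε₀ / (L * C₀) * (1 / (T : ℝ))) := by gcongr
      _ = _ := by ring
  have hb : 32 * (G * G * (1 + s₁ ^ 2) / (L * C₀) ^ 2 * (1 / (T : ℝ)))
      ≤ 32 / (L * C₀) * (K₃ ^ 2 * (1 + S₁ ^ 2) / (L * C₀)) * lam ^ 4 * (1 / (T : ℝ)) :=
    calc _ ≤ 32 * (K₃ ^ 2 * lam ^ 4 * (1 + S₁ ^ 2) / (L * C₀) ^ 2 * (1 / (T : ℝ))) := by gcongr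
      _ = _ := by field_simp
  have hc : 32 * (G / (L * C₀) * (σ / √(T : ℝ)))
      ≤ 32 / (L * C₀) * (K₃ * m ^ 2) * lam ^ 4 * (σ / √(T : ℝ)) :=
    calc _ ≤ 32 * ((K₃ * m ^ 2 * lam ^ 4) / (L * C₀) * (σ / √(T : ℝ))) := by gcongr
      _ = _ := by ring
  have e : 32 * (G / (T * (L * C₀)) * (ε₀ + G * (1 + s₁ ^ 2) / (L * C₀))
        + 1 / √(T : ℝ) * (G * σ / (L * C₀)))
      = 32 * (G * ε₀ / (L * C₀) * (1 / (T : ℝ)))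
        + 32 * (G * G * (1 + s₁ ^ 2) / (L * C₀) ^ 2 * (1 / (T : ℝ)))
        + 32 * (G / (L * C₀) * (σ / √(T : ℝ))) := by
    have hq : 0 < √(T : ℝ) := Real.sqrt_pos.2 hT0
    field_simp
  rw [e]
  have hl : 0 ≤ lam ^ 4 := by positivity
  have r1 : 0 ≤ 32 / (L * C₀) * (K₃ * m ^ 2) * lam ^ 4 * (1 / (T : ℝ)) := by positivity
  have r2 : 0 ≤ 32 / (L * C₀) * (K₃ * m ^ 2 * ε₀) * lam ^ 4 * (σ / √(T : ℝ)) := by positivity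
  have r3 : 0 ≤ 32 / (L * C₀) * (K₃ ^ 2 * (1 + S₁ ^ 2) / (L * C₀)) * lam ^ 4
    * (σ / √(T : ℝ)) := by positivity
  have r4 : 0 ≤ lam ^ 4 * (1 / (T : ℝ)) := by positivity
  have r5 : 0 ≤ lam ^ 4 * (σ / √(T : ℝ)) := by positivity
  linarith

end Rate

universe u

/-- The noise-adaptive rate for `β₂ = 1 - 1 / T`. -/
theorem exists_noise_adaptive_rate (d : ℕ) (L β₁ C₀ ε₀ Δ S₀ S₁ : ℝ) : ∃ K : ℝ, 0 < K ∧
    ∀ (T : ℕ) (Ω : Type u) (mΩ : MeasurableSpace Ω) (μ : Measure Ω) (ℱ : Filtration ℕ mΩ)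
      (f : Vec d → ℝ) (fstar : ℝ) (σ₀ σ₁ : Vec d) (x₁ : Vec d) (g : ℕ → Ω → Vec d) (δ : ℝ),
      IsProbabilityMeasure μ → 2 ≤ T → 0 < δ → δ < 1 →
      Setting μ ℱ T f fstar L σ₀ σ₁ β₁ (1 - 1 / (T : ℝ)) C₀ ε₀ x₁ g →
      f x₁ - fstar ≤ Δ → supNorm σ₀ ≤ S₀ → supNorm σ₁ ≤ S₁ →
      1 - δ ≤ μ.real {ω | avgSqGrad T f β₁ (1 - 1 / (T : ℝ)) C₀ ε₀ x₁ (fun s => g s ω)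
        ≤ K * Real.log (T / δ) ^ 4 * (1 / (T : ℝ) + ‖σ₀‖ / √(T : ℝ))} := by
  -- The parameters are arbitrary reals. Outside this range no setting satisfies the assumptions, so
  -- any positive `K` works.
  by_cases hpar : 0 < L ∧ 0 ≤ β₁ ∧ β₁ < 1 ∧ 0 < C₀ ∧ 0 < ε₀ ∧ 0 ≤ Δ ∧ 0 ≤ S₀ ∧ 0 ≤ S₁
  swap
  · refine ⟨1, one_pos, fun T Ω mΩ μ ℱ f fstar σ₀ σ₁ x₁ g δ _ _ _ _ hs hΔ h0 h1 =>
      absurd ⟨hs.L_pos, hs.β₁_nonneg, hs.β₁_lt_β₂.trans hs.β₂_lt_one, hs.C₀_pos, hs.ε₀_pos,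
        (sub_nonneg.2 (hs.bounded_below x₁)).trans hΔ, (supNorm_nonneg σ₀).trans h0,
        (supNorm_nonneg σ₁).trans h1⟩ hpar⟩
  obtain ⟨hL, hβ₁, hβ₁', hC₀, hε₀, hΔ0, hS₀, hS₁⟩ := hpar
  obtain ⟨ρ, hρ, hρle⟩ := exists_pos_le_one_sub_ratio hβ₁ hβ₁'
  have hlog2 : 0 < Real.log 2 := Real.log_pos one_lt_two
  have hβ : 0 < 1 - β₁ := sub_pos.2 hβ₁'
  set A := 1 + 2 / ε₀ ^ 2 * ((S₀ ^ 2 + 2 * (1 + S₁ ^ 2) * (2 * L * Δ))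
        + 2 * (1 + S₁ ^ 2) * d * L ^ 2 * C₀ ^ 2 / ρ) with hAdef
  have hA : 1 ≤ A := le_add_of_nonneg_right (by positivity)
  have hlogA := Real.log_nonneg hA
  set K₁ := 4 + (Real.log A + 2) / Real.log 2 with hK₁def
  set K₂ := 1 + Real.log ((d : ℝ) + 1) / Real.log 2 with hK₂def
  have hK₁ : 0 ≤ K₁ := by positivity
  have hK₂ : 0 ≤ K₂ := by
    have : 0 ≤ Real.log ((d : ℝ) + 1) := Real.log_nonneg (by simp)
    positivity
  set m := 1 / Real.log 2 with hmdef
  have hm0 : 0 ≤ m := by positivity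
  obtain ⟨K₃, hK₃0, hK₃⟩ : ∃ K₃ : ℝ, 0 ≤ K₃ ∧ ((8 * L * Δ
          + 256 * L ^ 2 * C₀ ^ 2 * β₁ ^ 2 * d ^ 2 / ((1 - β₁) ^ 3 * ρ)
          + 4 * L ^ 2 * C₀ ^ 2 * β₁ ^ 2 * d / ((1 - β₁) ^ 2 * ρ)) * m ^ 2
        + (48 * L * C₀ * S₀ / (1 - β₁) * d * K₂
          + 8 * L * C₀ * β₁ ^ 2 / ((1 - β₁) ^ 2 * ρ)
            * (4 * S₀ / (1 / 2) + (ε₀ + √2 * S₀) / (1 / 2) + L * C₀ / 2 * (1 + 4 * 1 ^ 2)) * d * K₁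
          + 8 * (3 * L ^ 2 * C₀ ^ 2 / (1 - β₁) ^ 2 + 8 * L * S₀ * C₀ / (1 - β₁)) * d * K₁) * m
        + 2304 * L ^ 2 * C₀ ^ 2 * S₁ ^ 2 / (1 - β₁) ^ 2 * d ^ 2 * K₂ ^ 2
        + 256 * (16 * L ^ 2 * C₀ ^ 2 * S₁ ^ 2 / (1 - β₁) ^ 2
            + 9 * L ^ 2 * C₀ ^ 2 * β₁ ^ 4 * (1 + S₁ ^ 2)
              / ((1 / 2) ^ 2 * (1 - β₁) ^ 4 * ρ ^ 2)) * d ^ 2 * K₁ ^ 2) = K₃ :=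
    ⟨_, by positivity, rfl⟩
  -- The summand `1` keeps the constant positive when `K₃ = 0`, for instance if `d = 0` and `Δ = 0`.
  refine ⟨32 / (L * C₀) * (K₃ * m ^ 2 * ε₀ + K₃ ^ 2 * (1 + S₁ ^ 2) / (L * C₀) + K₃ * m ^ 2) + 1,
    by positivity, ?_⟩
  intro T Ω mΩ μ ℱ f fstar σ₀ σ₁ x₁ g δ hμ hT hδ hδ1 hs hΔ hs₀ hs₁
  have hT2 : (2 : ℝ) ≤ T := by exact_mod_cast hT
  have hT0 : (0 : ℝ) < T := by linarith
  obtain ⟨hG0, hmain⟩ := hs.one_sub_le_measureReal_avgSqGrad_le (by omega) hδ hδ1 rfl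
  refine hmain.trans (measureReal_mono (fun ω hω => ?_) (measure_ne_top _ _))
  have h := hs.admissible
  have hρT := hρle T hT hs.β₁_lt_β₂
  have hb : 1 / 2 ≤ 1 - 1 / (T : ℝ) := by
    have : 1 / (T : ℝ) ≤ 1 / 2 := one_div_le_one_div_of_le two_pos hT2
    linarith
  have hTδ : (T : ℝ) ≤ T / δ := by rw [le_div_iff₀ hδ]; exact mul_le_of_le_one_right hT0.le hδ1.le
  have hlamT : Real.log T ≤ Real.log (T / δ) := Real.log_le_log hT0 hTδ
  have hlam2 : Real.log 2 ≤ Real.log (T / δ) := (Real.log_le_log two_pos hT2).trans hlamT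
  have hm : 1 ≤ m * Real.log (T / δ) := by
    rw [hmdef, div_mul_eq_mul_div, one_mul, le_div_iff₀ hlog2, one_mul]; exact hlam2
  have hn₁ : ‖gradient f x₁‖ ^ 2 ≤ 2 * L * Δ :=
    (hs.smooth.norm_gradient_sq_le hL hs.bounded_below x₁).trans (by gcongr)
  have hF := calF_le_mul_pow (d := d) (C₀ := C₀) hρ hT rfl hρT hε₀ hn₁
    (supNorm_nonneg σ₀) (supNorm_nonneg σ₁) hs₀ hs₁
  have hℓ := log_calF_le hT rfl (zero_lt_one.trans_le (one_le_calF h)) hA hF hlamT hlam2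
  have hGle := bigG_le_mul_sq hρ hρT hβ₁' hb hL hC₀ hε₀ (supNorm_nonneg σ₀)
    (supNorm_nonneg σ₁) hs₀ hs₁ hΔ (sub_nonneg.2 (hs.bounded_below x₁)) hm
    (log_calF_nonneg h) hℓ (log_dim_nonneg d (by omega) hδ hδ1)
    (log_dim_le d (by omega) hδ rfl hlam2)
  rw [hK₃] at hGle
  exact (show _ ≤ _ from hω).trans (rate_le hG0 hGle hL hC₀ hε₀ (supNorm_nonneg σ₁) hs₁ hm
    (norm_nonneg _) hK₃0 (by omega))

end AdamVariant

end

theorem theorem2 :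
    -- the bound, with a universal constant `C`
    (∃ C : ℝ, 0 < C ∧
      ∀ (d T : ℕ) (Ω : Type*) (mΩ : MeasurableSpace Ω) (μ : Measure Ω) (ℱ : Filtration ℕ mΩ)
        (f : AdamVariant.Vec d → ℝ) (fstar L : ℝ) (σ₀ σ₁ : AdamVariant.Vec d)
        (β₁ β₂ C₀ ε₀ : ℝ) (x₁ : AdamVariant.Vec d) (g : ℕ → Ω → AdamVariant.Vec d) (δ G : ℝ),
        IsProbabilityMeasure μ → 1 ≤ T → 0 < δ → δ < 1 →
        AdamVariant.Setting μ ℱ T f fstar L σ₀ σ₁ β₁ β₂ C₀ ε₀ x₁ g →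
        G = AdamVariant.bigG d T L (f x₁ - fstar) ‖gradient f x₁‖
              (AdamVariant.supNorm σ₀) (AdamVariant.supNorm σ₁) β₁ β₂ C₀ ε₀ δ →
        1 - δ ≤ μ.real {ω |
          AdamVariant.avgSqGrad T f β₁ β₂ C₀ ε₀ x₁ (fun s => g s ω)
            ≤ C * (G / (T * (L * C₀)) * (ε₀ + G * (1 + AdamVariant.supNorm σ₁ ^ 2) / (L * C₀))
                + 1 / √(T : ℝ) * (G * ‖σ₀‖ / (L * C₀)))}) ∧
    -- the noise-adaptive rate for `β₂ = 1 - 1/T`; `K` does not depend on `T`, `δ` or `σ₀`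
    -- (beyond the a priori bound `S₀`)
    (∀ (d : ℕ) (L β₁ C₀ ε₀ Δ S₀ S₁ : ℝ), ∃ K : ℝ, 0 < K ∧
      ∀ (T : ℕ) (Ω : Type*) (mΩ : MeasurableSpace Ω) (μ : Measure Ω) (ℱ : Filtration ℕ mΩ)
        (f : AdamVariant.Vec d → ℝ) (fstar : ℝ) (σ₀ σ₁ : AdamVariant.Vec d)
        (x₁ : AdamVariant.Vec d) (g : ℕ → Ω → AdamVariant.Vec d) (δ : ℝ),
        IsProbabilityMeasure μ → 2 ≤ T → 0 < δ → δ < 1 →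
        AdamVariant.Setting μ ℱ T f fstar L σ₀ σ₁ β₁ (1 - 1 / (T : ℝ)) C₀ ε₀ x₁ g →
        f x₁ - fstar ≤ Δ → AdamVariant.supNorm σ₀ ≤ S₀ → AdamVariant.supNorm σ₁ ≤ S₁ →
        1 - δ ≤ μ.real {ω |
          AdamVariant.avgSqGrad T f β₁ (1 - 1 / (T : ℝ)) C₀ ε₀ x₁ (fun s => g s ω)
            ≤ K * Real.log (T / δ) ^ 4 * (1 / (T : ℝ) + ‖σ₀‖ / √(T : ℝ))}) := by
  refine ⟨⟨32, by norm_num, ?_⟩, ?_⟩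
  · intro d T Ω mΩ μ ℱ f fstar L σ₀ σ₁ β₁ β₂ C₀ ε₀ x₁ g δ G hμ hT hδ hδ1 hs hG
    exact (hs.one_sub_le_measureReal_avgSqGrad_le hT hδ hδ1 hG).2
  · exact AdamVariant.exists_noise_adaptive_rate
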